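/- Let $M$ be a compact smooth manifold of dimension $n\ge 1$ with (possibly empty) boundary $\partial M$, and let $\varepsilon>0$. For $|t|<\varepsilon$ let $g(t)$ be smooth Riemannian metrics on $M$ depending differentiably on $t$, let $\eta:(-\varepsilon,\varepsilon)\times M\to\mathbb R$ be a smooth function, $\eta(t)=\eta(t,\cdot)$, and put $dm_t=e^{-\eta(t)}\,dV_{g(t)}$ and $$\bar L_t f=\Delta_{g(t)}f-g(t)(\nabla\eta(t),\nabla f),$$ where $\nabla$ is the gradient for $g(t)$ and $\Delta_{g(t)}=\operatorname{div}\nabla$. Let $\phi_1(t),\dots,\phi_m(t)\in C^\infty(M)$ and $\lambda_1(t),\dots,\lambda_m(t)\in\mathbb R$ depend differentiably on $t$ and satisfy, for all $|t|<\varepsilon$ and all $i,j$, $$-\bar L_t\phi_i(t)=\lambda_i(t)\phi_i(t)\ \text{ in } M,\qquad \phi_i(t)=0\ \text{ on }\partial M,\qquad \int_M\phi_i(t)\phi_j(t)\,dm_t=\delta_{ij},$$ and suppose that $\lambda_1(0)=\dots=\lambda_m(0)=\lambda$. (For $g(t)$ and $\phi_i(t)$, "differentiably" means that the difference quotients in $t$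 of the components $g_{kl}(t)$ in charts, respectively of $\phi_i(t)$, converge locally uniformly on the domain of the chart, respectively on $M$; this is the case, for instance, if they are $C^1$ in $(t,x)$.) Write $g=g(0)$, $dm=dm_0$, $L=\bar L_0$, $\phi_i=\phi_i(0)$, $H=\frac{d}{dt}\big|_{t=0}g(t)$, $\dot\eta=\frac{d}{dt}\big|_{t=0}\eta(t)$, and let $\langle T,S\rangle=\sum g^{ik}g^{jl}T_{ij}S_{kl}$ be the inner product induced by $g$ on $(0,2)$-tensors, $\langle\cdot,\cdot\rangle=g(\cdot,\cdot)$ on vectors. Then for all $i,j$ the two integrands below are integrable and the function $t\mapsto(\lambda_i(t)+\lambda_j(t))\delta_{ij}$ has at $t=0$ the derivative $$(\lambda_i+\lambda_j)'\delta_{ij}=\int_M\Big\langle\tfrac12 L(\phi_i\phi_j)\,g-2\,d\phi_i\otimes d\phi_j,\,H\Big\rangle\,dm+\int_M\langle\nabla\dot\eta,\nabla(\phi_i\phi_j)\rangle\,dm.$$ -/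

import Mathlib

open Set Filter Topology MeasureTheory
open scoped Manifold ContDiff

noncomputable section

namespace EtaLaplacian

/-- The model vector space `ℝⁿ`. -/
abbrev Model (n : ℕ) : Type := EuclideanSpace ℝ (Fin n)

/-- Smooth Riemannian metrics on a smooth `n`-manifold `M` (possibly with boundary, modelled on the
Euclidean half space): smooth sections of the bundle of bilinear forms on the tangent spaces which
are symmetric and positive definite at every point. -/
abbrev Metric (n : ℕ) [NeZero n] (M : Type*) [TopologicalSpace M]
    [ChartedSpace (EuclideanHalfSpace n) M] [IsManifold (𝓡∂ n) ∞ M] :=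
  Bundle.ContMDiffRiemannianMetric (𝓡∂ n) ∞ (Model n) (fun p : M => TangentSpace (𝓡∂ n) p)

variable {n : ℕ} [NeZero n] {M : Type*} [TopologicalSpace M]
  [ChartedSpace (EuclideanHalfSpace n) M] [IsManifold (𝓡∂ n) ∞ M]

/-! ### Pointwise tensor algebra -/

/-- The basis `e₁, …, eₙ` of the tangent space at `p` (the coordinate basis at `p` of the preferred
chart at `p`, in which Mathlib models the tangent space). It serves to compute traces and
contractions, none of which depends on the choice of a basis. -/
def frame (p : M) (i : Fin n) : TangentSpace (𝓡∂ n) p :=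
  (EuclideanSpace.single i (1 : ℝ) : Model n)

/-- The matrix `(g_{ij})` of the metric at `p` in the basis `frame p`. -/
def gram (g : Metric n M) (p : M) : Matrix (Fin n) (Fin n) ℝ :=
  Matrix.of fun i j => g.inner p (frame p i) (frame p j)

/-- The inner product `⟨T, S⟩ = ∑ g^{ik} g^{jl} T_{ij} S_{kl}` induced by `g` on the
`(0,2)`-tensors at `p`. -/
def tensorInner (g : Metric n M) (p : M)
    (T S : TangentSpace (𝓡∂ n) p → TangentSpace (𝓡∂ n) p → ℝ) : ℝ :=
  ∑ i, ∑ j, ∑ k, ∑ l, (gram g p)⁻¹ i k * (gram g p)⁻¹ j l *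
    T (frame p i) (frame p j) * S (frame p k) (frame p l)

/-- The differential `df` at `p`, as a covector. -/
def differential (f : M → ℝ) (p : M) (v : TangentSpace (𝓡∂ n) p) : ℝ :=
  mfderiv (𝓡∂ n) 𝓘(ℝ, ℝ) f p v

/-- The gradient `∇f = ∑ g^{ij} (∂_j f) e_i` of `f` with respect to `g`. -/
def riemannianGradient (g : Metric n M) (f : M → ℝ) (p : M) : TangentSpace (𝓡∂ n) p :=
  ∑ i, (∑ j, (gram g p)⁻¹ i j * differential f p (frame p j)) • frame p i

/-! ### Volume, divergence, Laplacian -/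

/-- The matrix `g_{ij} = g(∂_i, ∂_j)` of the metric in the preferred chart at `x₀`, as a function of
the coordinates `y`. The coordinate vector `∂_i` is the push-forward of the `i`-th standard basis
vector under the inverse chart. -/
def chartGram (g : Metric n M) (x₀ : M) (y : Model n) : Matrix (Fin n) (Fin n) ℝ :=
  Matrix.of fun i j => g.inner ((extChartAt (𝓡∂ n) x₀).symm y)
    (mfderivWithin 𝓘(ℝ, Model n) (𝓡∂ n) (extChartAt (𝓡∂ n) x₀).symm (range (𝓡∂ n)) y
      (EuclideanSpace.single i (1 : ℝ) : Model n))
    (mfderivWithin 𝓘(ℝ, Model n) (𝓡∂ n) (extChartAt (𝓡∂ n) x₀).symm (range (𝓡∂ n)) y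
      (EuclideanSpace.single j (1 : ℝ) : Model n))

/-- The Riemannian volume on the domain of the preferred chart at `x₀`: the measure
`√det(g_{ij}) dy¹ ⋯ dyⁿ`, transported to `M` by the inverse chart. -/
def chartVolume [MeasurableSpace M] (g : Metric n M) (x₀ : M) : Measure M :=
  (((volume : Measure (Model n)).restrict (extChartAt (𝓡∂ n) x₀).target).withDensity
    (fun y => ENNReal.ofReal (√(chartGram g x₀ y).det))).map (extChartAt (𝓡∂ n) x₀).symm

/-- The Riemannian volume measure `dV` of `g`. The measures `chartVolume g x₀` agree on overlaps of
charts, and the measure on `M` obtained by gluing them is their least upper bound. -/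
def riemannianVolume [MeasurableSpace M] (g : Metric n M) : Measure M :=
  ⨆ x₀ : M, chartVolume g x₀

/-- The weighted measure `dm = e^{-η} dV`. -/
def weightedVolume [MeasurableSpace M] (g : Metric n M) (η : M → ℝ) : Measure M :=
  (riemannianVolume g).withDensity (fun p => ENNReal.ofReal (Real.exp (-η p)))

/-- The divergence of a vector field `X` with respect to `g`, computed at `p` in the preferred chart
at `p` by `div X = (1 / √det g) ∑ ∂_i (√det g Xⁱ)` (the value does not depend on the chart). At
boundary points the partial derivatives are those within the half space. -/
def divergence (g : Metric n M) (X : (p : M) → TangentSpace (𝓡∂ n) p) (p : M) : ℝ :=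
  (√(chartGram g p (extChartAt (𝓡∂ n) p p)).det)⁻¹ *
    ∑ i, fderivWithin ℝ
      (fun y : Model n => √(chartGram g p y).det *
        (EuclideanSpace.proj i : Model n →L[ℝ] ℝ)
          (mfderiv (𝓡∂ n) 𝓘(ℝ, Model n) (extChartAt (𝓡∂ n) p) ((extChartAt (𝓡∂ n) p).symm y)
            (X ((extChartAt (𝓡∂ n) p).symm y))))
      (range (𝓡∂ n)) (extChartAt (𝓡∂ n) p p) (EuclideanSpace.single i (1 : ℝ))

/-- The Laplace-Beltrami operator `Δ f = div ∇f`. -/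
def laplacian (g : Metric n M) (f : M → ℝ) (p : M) : ℝ :=
  divergence g (riemannianGradient g f) p

/-- The `η`-Laplacian `L f = Δ f - g(∇η, ∇f)`. -/
def etaLaplacian (g : Metric n M) (η f : M → ℝ) (p : M) : ℝ :=
  laplacian g f p - g.inner p (riemannianGradient g η p) (riemannianGradient g f p)

/-! ### Families depending on a parameter -/

/-- The real functions `f t` on `s`, `t ∈ J`, depend differentiably on `t`: at every `t₀ ∈ J` the
difference quotients in `t` converge locally uniformly on `s`. -/
def DifferentiableFamily {X : Type*} [TopologicalSpace X] (J : Set ℝ) (f : ℝ → X → ℝ)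
    (s : Set X) : Prop :=
  ∀ t₀ ∈ J, ∃ D : X → ℝ,
    TendstoLocallyUniformlyOn (fun t x => slope (fun r => f r x) t₀ t) D (𝓝[≠] t₀) s

/-- The metrics `g t`, `t ∈ J`, depend differentiably on `t`: so do their components `g_{ij}(t)` in
the charts. -/
def DifferentiableVariation (J : Set ℝ) (g : ℝ → Metric n M) : Prop :=
  ∀ (x₀ : M) (i j : Fin n),
    DifferentiableFamily J (fun t y => chartGram (g t) x₀ y i j) (extChartAt (𝓡∂ n) x₀).target

/-- The `(0,2)`-tensor `H = d/dt|_{t=0} g(t)`. -/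
def metricVelocity (g : ℝ → Metric n M) (p : M) (v w : TangentSpace (𝓡∂ n) p) : ℝ :=
  deriv (fun t => (g t).inner p v w) 0

/-- The function `d/dt|_{t=0} η(t)`. -/
def weightVelocity (η : ℝ → M → ℝ) (p : M) : ℝ :=
  deriv (fun t => η t p) 0

end EtaLaplacian

end

open EtaLaplacian

/-!
Testing the equations of `φᵢ(t)` and `φⱼ(0)` against each other, with `E_t(u, v) = ∫ ⟨∇u, ∇v⟩ dm_t`,
gives
`(λᵢ(t) - λᵢ(0)) ∫ φᵢ(t) φⱼ(0) dm_t = (E_t - E_0)(φᵢ(t), φⱼ(0)) - λ (∫ · dm_t - ∫ · dm_0)`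
with the integrand `φᵢ(t) φⱼ(0)` on the right. No derivative of the gradient of `φᵢ(t)` in `t` is
available, but none is needed: on the right `φᵢ(t)` can be replaced by `φᵢ(0)` up to `o(t)`, because
`E_t - E_0 = O(t)` and `E_0(φᵢ(t) - φᵢ(0), φᵢ(t) - φᵢ(0)) → 0`, which follows from the equations
again. Hence the right side has the derivative
`Q = ∫ (ρ (⟨∇φᵢ, ∇φⱼ⟩ - λ φᵢ φⱼ) - H(∇φᵢ, ∇φⱼ)) dm` with `ρ = ½ tr H - η̇` the logarithmic
derivative of `dm_t`. Since `½ L(φᵢ φⱼ) = ⟨∇φᵢ, ∇φⱼ⟩ - λ φᵢ φⱼ`, and since this function integrates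
against `η̇` to `-½ ∫ ⟨∇η̇, ∇(φᵢ φⱼ)⟩ dm`, the sum of the two integrals of the theorem is `2 Q`.
-/

namespace EtaLaplacian

open scoped Matrix

/-! ### Calculus of determinants and inverse matrices -/

section MatrixCalculus

open Matrix

variable {ι 𝕜 : Type*} [Fintype ι] [DecidableEq ι] [NontriviallyNormedField 𝕜]

theorem det_updateRow_eq_sum_adjugate {R : Type*} [CommRing R] (A : Matrix ι ι R) (i : ι)
    (b : ι → R) : (A.updateRow i b).det = ∑ j, A.adjugate j i * b j := by
  rw [← cramer_transpose_apply, cramer_eq_adjugate_mulVec, ← adjugate_transpose]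
  rfl

theorem hasDerivAt_det {A : 𝕜 → Matrix ι ι 𝕜} {A' : Matrix ι ι 𝕜} {t : 𝕜}
    (h : ∀ i j, HasDerivAt (fun s => A s i j) (A' i j) t) :
    HasDerivAt (fun s => (A s).det) ((A t).adjugate * A').trace t := by
  let D : ContinuousMultilinearMap 𝕜 (fun _ : ι => ι → 𝕜) 𝕜 :=
    { (detRowAlternating (n := ι) (R := 𝕜)).toMultilinearMap with
      cont := continuous_id.matrix_det }
  have hA : HasDerivAt (F := ι → ι → 𝕜) A A' t :=
    hasDerivAt_pi.2 fun i => hasDerivAt_pi.2 fun j => h i j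
  refine ((D.hasFDerivAt (A t)).comp_hasDerivAt t hA).congr_deriv ?_
  refine (D.linearDeriv_apply (A t) A').trans ?_
  rw [trace_mul_comm]
  refine Finset.sum_congr rfl fun i _ => (det_updateRow_eq_sum_adjugate (A t) i (A' i)).trans ?_
  exact Finset.sum_congr rfl fun j _ => mul_comm _ _

theorem hasDerivAt_det_of_ne_zero {A : 𝕜 → Matrix ι ι 𝕜} {A' : Matrix ι ι 𝕜} {t : 𝕜}
    (h : ∀ i j, HasDerivAt (fun s => A s i j) (A' i j) t) (ht : (A t).det ≠ 0) :
    HasDerivAt (fun s => (A s).det) ((A t).det * ((A t)⁻¹ * A').trace) t := by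
  refine (hasDerivAt_det h).congr_deriv ?_
  rw [inv_def, Ring.inverse_eq_inv, smul_mul_assoc, trace_smul, smul_eq_mul,
    mul_inv_cancel_left₀ ht]

open scoped Matrix.Norms.Operator in
theorem hasDerivAt_inv_apply [CompleteSpace 𝕜] {A : 𝕜 → Matrix ι ι 𝕜} {A' : Matrix ι ι 𝕜} {t : 𝕜}
    (h : ∀ i j, HasDerivAt (fun s => A s i j) (A' i j) t) (ht : (A t).det ≠ 0) (i j : ι) :
    HasDerivAt (fun s => (A s)⁻¹ i j) (-((A t)⁻¹ * A' * (A t)⁻¹) i j) t := by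
  have : @CompleteSpace (Matrix ι ι 𝕜) PseudoMetricSpace.toUniformSpace :=
    FiniteDimensional.complete 𝕜 _
  have hA : HasDerivAt A A' t := by
    rw [matrix_eq_sum_single A']
    simp_rw +singlePass [funext fun s => matrix_eq_sum_single (A s)]
    refine HasDerivAt.fun_sum fun k _ => HasDerivAt.fun_sum fun l _ => ?_
    simpa only [smul_single, smul_eq_mul, mul_one] using (h k l).smul_const (single k l (1 : 𝕜))
  obtain ⟨U, hU⟩ : IsUnit (A t) := (isUnit_iff_isUnit_det _).2 (isUnit_iff_ne_zero.2 ht)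
  have hinv : HasDerivAt (fun s => Ring.inverse (A s)) (-((A t)⁻¹ * A' * (A t)⁻¹)) t := by
    have hU' := hasFDerivAt_ringInverse (𝕜 := 𝕜) U
    rw [hU] at hU'
    refine (hU'.comp_hasDerivAt t hA).congr_deriv ?_
    rw [coe_units_inv, hU]
    simp
  simp_rw [nonsing_inv_eq_ringInverse] at hinv ⊢
  exact (LinearMap.toContinuousLinearMap
    (entryLinearMap 𝕜 𝕜 i j)).hasFDerivAt.comp_hasDerivAt t hinv

theorem contDiff_det {k : ℕ∞ω} : ContDiff 𝕜 k fun A : ι → ι → 𝕜 => (Matrix.of A).det := by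
  simp_rw [det_apply']
  exact ContDiff.sum fun σ _ => contDiff_const.mul (contDiff_prod fun i _ => by
    simp only [of_apply]; fun_prop)

variable {F : Type*} [NormedAddCommGroup F] [NormedSpace 𝕜 F] {k : ℕ∞ω} {A : F → Matrix ι ι 𝕜}
  {s : Set F} {x : F}

theorem contDiffWithinAt_det (h : ∀ i j, ContDiffWithinAt 𝕜 k (fun y => A y i j) s x) :
    ContDiffWithinAt 𝕜 k (fun y => (A y).det) s x :=
  contDiff_det.contDiffAt.comp_contDiffWithinAt x
    (contDiffWithinAt_pi.2 fun i => contDiffWithinAt_pi.2 fun j => h i j)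

theorem contDiffWithinAt_inv_apply (h : ∀ i j, ContDiffWithinAt 𝕜 k (fun y => A y i j) s x)
    (hx : (A x).det ≠ 0) (i j : ι) : ContDiffWithinAt 𝕜 k (fun y => (A y)⁻¹ i j) s x := by
  simp only [inv_def, Matrix.smul_apply, smul_eq_mul, Ring.inverse_eq_inv, adjugate_apply]
  refine ((contDiffWithinAt_det h).inv hx).mul (contDiffWithinAt_det fun a b => ?_)
  obtain rfl | ha := eq_or_ne a j
  · simpa only [updateRow_self] using contDiffWithinAt_const
  · simpa only [updateRow_ne ha] using h a b

end MatrixCalculus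

/-! ### The Piola identity -/

section Piola

open Matrix

variable {n : ℕ}

/-- The Jacobian matrix `(∂σᵏ/∂yˡ)` of `σ` at `y`. -/
noncomputable def jacobian (σ : Model n → Model n) (y : Model n) : Matrix (Fin n) (Fin n) ℝ :=
  Matrix.of fun k l => fderiv ℝ σ y (EuclideanSpace.single l 1) k

/-- The divergence `∑ ∂ᵢVⁱ` of the vector field with components `Vⁱ` with respect to the Lebesgue
measure on `ℝⁿ`. -/
noncomputable def flatDivergence (V : Fin n → Model n → ℝ) (y : Model n) : ℝ :=
  ∑ i, fderiv ℝ (V i) y (EuclideanSpace.single i 1)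

theorem hasDerivAt_abs_det_mul_inv {A : ℝ → Matrix (Fin n) (Fin n) ℝ}
    {A' : Matrix (Fin n) (Fin n) ℝ} {t : ℝ} (h : ∀ i j, HasDerivAt (fun s => A s i j) (A' i j) t)
    (ht : (A t).det ≠ 0) (i j : Fin n) :
    HasDerivAt (fun s => |(A s).det| * (A s)⁻¹ i j)
      (|(A t).det| * (((A t)⁻¹ * A').trace * (A t)⁻¹ i j - ((A t)⁻¹ * A' * (A t)⁻¹) i j)) t := by
  have habs : HasDerivAt (fun s => |(A s).det|) (|(A t).det| * ((A t)⁻¹ * A').trace) t := by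
    refine ((hasDerivAt_abs ht).comp t (hasDerivAt_det_of_ne_zero h ht)).congr_deriv ?_
    rw [← mul_assoc, sign_mul_self]
  exact (habs.fun_mul (hasDerivAt_inv_apply h ht i j)).congr_deriv (by ring)

theorem sum_trace_mul_apply_sub_eq_zero {ι R : Type*} [Fintype ι] [CommRing R]
    (C : Matrix ι ι R) (B : ι → Matrix ι ι R) (hB : ∀ i k l, B i k l = B l k i) (j : ι) :
    ∑ i, ((C * B i).trace * C i j - (C * B i * C) i j) = 0 := by
  rw [Finset.sum_sub_distrib, sub_eq_zero]
  simp_rw [mul_apply (M := C * B _), trace, diag, Finset.sum_mul]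
  rw [Finset.sum_comm (f := fun i l => (C * B i) i l * C l j)]
  refine Finset.sum_congr rfl fun i _ => Finset.sum_congr rfl fun l _ => ?_
  simp_rw [mul_apply, hB]

variable {σ : Model n → Model n} {z : Model n}

theorem contDiffAt_jacobian (hσ : ContDiffAt ℝ 2 σ z) (k l : Fin n) :
    ContDiffAt ℝ 1 (fun y => jacobian σ y k l) z :=
  (EuclideanSpace.proj k : Model n →L[ℝ] ℝ).contDiff.contDiffAt.comp z
    ((hσ.fderiv_right (m := 1) (by norm_cast)).clm_apply contDiffAt_const)

theorem fderiv_jacobian_symm (hσ : ContDiffAt ℝ 2 σ z) (i k l : Fin n) :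
    fderiv ℝ (fun y => jacobian σ y k l) z (EuclideanSpace.single i 1) =
      fderiv ℝ (fun y => jacobian σ y k i) z (EuclideanSpace.single l 1) := by
  have hσ' : DifferentiableAt ℝ (fderiv ℝ σ) z :=
    (hσ.fderiv_right (m := 1) (by norm_cast)).differentiableAt one_ne_zero
  have hfderiv (l : Fin n) : HasFDerivAt (fun y => jacobian σ y k l)
      ((EuclideanSpace.proj k : Model n →L[ℝ] ℝ) ∘L
        ContinuousLinearMap.apply ℝ (Model n) (EuclideanSpace.single l (1 : ℝ) : Model n) ∘L
          fderiv ℝ (fderiv ℝ σ) z) z :=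
    ((EuclideanSpace.proj k : Model n →L[ℝ] ℝ) ∘L
      ContinuousLinearMap.apply ℝ (Model n) (EuclideanSpace.single l (1 : ℝ) :
        Model n)).hasFDerivAt.comp z hσ'.hasFDerivAt
  have hsymm : IsSymmSndFDerivAt ℝ σ z := hσ.isSymmSndFDerivAt (by simp)
  rw [(hfderiv l).fderiv, (hfderiv i).fderiv]
  simp only [ContinuousLinearMap.comp_apply, ContinuousLinearMap.apply_apply, hsymm.eq]

theorem differentiableAt_abs_det_mul_inv (hσ : ContDiffAt ℝ 2 σ z) (hdet : (jacobian σ z).det ≠ 0)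
    (i k : Fin n) :
    DifferentiableAt ℝ (fun y => |(jacobian σ y).det| * (jacobian σ y)⁻¹ i k) z := by
  have hJ (k l : Fin n) : ContDiffWithinAt ℝ 1 (fun y => jacobian σ y k l) univ z :=
    contDiffAt_jacobian hσ k l
  exact (((contDiffWithinAt_det hJ).contDiffAt univ_mem).abs hdet |>.mul
    ((contDiffWithinAt_inv_apply hJ hdet i k).contDiffAt univ_mem)).differentiableAt one_ne_zero

theorem flatDivergence_abs_det_mul_inv (hσ : ContDiffAt ℝ 2 σ z) (hdet : (jacobian σ z).det ≠ 0)
    (k : Fin n) :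
    flatDivergence (fun i y => |(jacobian σ y).det| * (jacobian σ y)⁻¹ i k) z = 0 := by
  let B (i : Fin n) : Matrix (Fin n) (Fin n) ℝ :=
    Matrix.of fun k l => fderiv ℝ (fun y => jacobian σ y k l) z (EuclideanSpace.single i 1)
  have hline (i : Fin n) : fderiv ℝ (fun y => |(jacobian σ y).det| * (jacobian σ y)⁻¹ i k) z
      (EuclideanSpace.single i 1) = |(jacobian σ z).det| * (((jacobian σ z)⁻¹ * B i).trace *
        (jacobian σ z)⁻¹ i k - ((jacobian σ z)⁻¹ * B i * (jacobian σ z)⁻¹) i k) := by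
    rw [← (differentiableAt_abs_det_mul_inv hσ hdet i k).lineDeriv_eq_fderiv]
    have hJ (k l : Fin n) := (((contDiffAt_jacobian hσ k l).differentiableAt
      one_ne_zero).hasFDerivAt.hasLineDerivAt (EuclideanSpace.single i (1 : ℝ)))
    have h := hasDerivAt_abs_det_mul_inv (A' := B i)
      (A := fun s => jacobian σ (z + s • EuclideanSpace.single i 1)) hJ (by simpa using hdet) i k
    simpa [lineDeriv] using h.deriv
  simp_rw [flatDivergence, hline, ← Finset.mul_sum]
  rw [sum_trace_mul_apply_sub_eq_zero _ B fun i k l => fderiv_jacobian_symm hσ i k l, mul_zero]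

theorem fderiv_apply_fderiv_single (w : Model n → ℝ) (i : Fin n) :
    fderiv ℝ w (σ z) (fderiv ℝ σ z (EuclideanSpace.single i 1)) =
      ∑ l, jacobian σ z l i * fderiv ℝ w (σ z) (EuclideanSpace.single l 1) := by
  conv_lhs => rw [← (EuclideanSpace.basisFun (Fin n) ℝ).sum_repr
    (fderiv ℝ σ z (EuclideanSpace.single i 1))]
  simp [jacobian]

theorem fderiv_sum_abs_det_mul_inv_mul_comp {W : Fin n → Model n → ℝ} (hσ : ContDiffAt ℝ 2 σ z)
    (hdet : (jacobian σ z).det ≠ 0) (hW : ∀ k, DifferentiableAt ℝ (W k) (σ z)) (i : Fin n) :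
    fderiv ℝ (fun y => ∑ k, |(jacobian σ y).det| * (jacobian σ y)⁻¹ i k * W k (σ y)) z
        (EuclideanSpace.single i 1) =
      ∑ k, (|(jacobian σ z).det| * (jacobian σ z)⁻¹ i k * ∑ l, jacobian σ z l i *
          fderiv ℝ (W k) (σ z) (EuclideanSpace.single l 1) +
        W k (σ z) * fderiv ℝ (fun y => |(jacobian σ y).det| * (jacobian σ y)⁻¹ i k) z
          (EuclideanSpace.single i 1)) := by
  have hσ' : HasFDerivAt σ (fderiv ℝ σ z) z := (hσ.differentiableAt two_ne_zero).hasFDerivAt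
  have h := HasFDerivAt.fun_sum (u := Finset.univ) fun k _ =>
    (differentiableAt_abs_det_mul_inv hσ hdet i k).hasFDerivAt.fun_mul
      ((hW k).hasFDerivAt.comp z hσ')
  refine (congrArg (fun L => L (EuclideanSpace.single i 1)) h.fderiv).trans ?_
  simp [fderiv_apply_fderiv_single]

theorem flatDivergence_piola {W : Fin n → Model n → ℝ} (hσ : ContDiffAt ℝ 2 σ z)
    (hdet : (jacobian σ z).det ≠ 0) (hW : ∀ k, DifferentiableAt ℝ (W k) (σ z)) :
    flatDivergence
        (fun i y => ∑ k, |(jacobian σ y).det| * (jacobian σ y)⁻¹ i k * W k (σ y)) z =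
      |(jacobian σ z).det| * flatDivergence W (σ z) := by
  have hcancel (k l : Fin n) : ∑ i, (jacobian σ z)⁻¹ i k * jacobian σ z l i =
      (1 : Matrix (Fin n) (Fin n) ℝ) l k := by
    rw [← mul_nonsing_inv _ (isUnit_iff_ne_zero.2 hdet), mul_apply]
    exact Finset.sum_congr rfl fun i _ => mul_comm _ _
  calc _ = ∑ k, ∑ l, |(jacobian σ z).det| * (∑ i, (jacobian σ z)⁻¹ i k * jacobian σ z l i) *
            fderiv ℝ (W k) (σ z) (EuclideanSpace.single l 1) +
          ∑ k, W k (σ z) *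
            flatDivergence (fun i y => |(jacobian σ y).det| * (jacobian σ y)⁻¹ i k) z := by
        simp_rw [flatDivergence, fderiv_sum_abs_det_mul_inv_mul_comp hσ hdet hW]
        rw [Finset.sum_comm]
        simp_rw [Finset.sum_add_distrib, Finset.mul_sum, Finset.sum_mul]
        congr 1
        refine Finset.sum_congr rfl fun k _ => ?_
        rw [Finset.sum_comm]
        exact Finset.sum_congr rfl fun l _ => Finset.sum_congr rfl fun i _ => by ring
    _ = |(jacobian σ z).det| * flatDivergence W (σ z) := by
        simp [hcancel, flatDivergence_abs_det_mul_inv hσ hdet, one_apply, ← Finset.mul_sum,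
          show flatDivergence W (σ z) =
            ∑ k, fderiv ℝ (W k) (σ z) (EuclideanSpace.single k 1) from rfl]

end Piola

/-! ### The divergence theorem on the half space -/

section HalfSpaceDivergence

theorem integral_divergence_eq_zero_of_faces {k : ℕ} {a b : Fin (k + 1) → ℝ} (hab : a ≤ b)
    {f : Fin (k + 1) → (Fin (k + 1) → ℝ) → ℝ} (hc : ∀ i, ContinuousOn (f i) (Icc a b))
    (hd : ∀ x ∈ Set.pi univ fun i => Ioo (a i) (b i), ∀ i, DifferentiableAt ℝ (f i) x)
    (hint : IntegrableOn (fun x => ∑ i, fderiv ℝ (f i) x (Pi.single i 1)) (Icc a b))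
    (hfaces : ∀ i, ∀ x ∈ Icc a b, x i = a i ∨ x i = b i → f i x = 0) :
    ∫ x in Icc a b, ∑ i, fderiv ℝ (f i) x (Pi.single i 1) = 0 := by
  rw [integral_divergence_of_hasFDerivAt_off_countable' a b hab f (fun i x => fderiv ℝ (f i) x)
    ∅ countable_empty hc (fun x hx i => (hd x hx.1 i).hasFDerivAt) hint]
  refine Finset.sum_eq_zero fun i _ => ?_
  have hface (c : ℝ) (hc : c = a i ∨ c = b i) : ∫ x in Icc (a ∘ i.succAbove) (b ∘ i.succAbove),
      f i (i.insertNth c x) = 0 := by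
    refine setIntegral_eq_zero_of_forall_eq_zero fun x hx => hfaces i _ ?_ (by simpa using hc)
    refine Fin.insertNth_mem_Icc.2 ⟨?_, hx⟩
    obtain rfl | rfl := hc
    exacts [⟨le_rfl, hab i⟩, ⟨hab i, le_rfl⟩]
  rw [hface _ (Or.inl rfl), hface _ (Or.inr rfl), sub_zero]

theorem flatDivergence_toLp {n : ℕ} (V : Fin n → Model n → ℝ) (x : Fin n → ℝ) :
    flatDivergence V (WithLp.toLp 2 x) =
      ∑ i, fderiv ℝ (fun x => V i (WithLp.toLp 2 x)) x (Pi.single i 1) := by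
  refine Finset.sum_congr rfl fun i _ => ?_
  have h := (PiLp.continuousLinearEquiv 2 ℝ (fun _ : Fin n => ℝ)).symm.comp_right_fderiv
    (f := V i) (x := x)
  exact (congrArg (fun L => L (Pi.single i 1)) h).symm

theorem flatDivergence_eq_zero {n : ℕ} {V : Fin n → Model n → ℝ} {y : Model n}
    (hV : ∀ i, V i =ᶠ[𝓝 y] 0) : flatDivergence V y = 0 :=
  Finset.sum_eq_zero fun i _ => by simp [(hV i).fderiv_eq]

theorem pi_Ioo_update_subset_halfSpace {k : ℕ} {S : ℝ} :
    (Set.pi univ fun i => Ioo (Function.update (fun _ : Fin (k + 1) => -S) 0 0 i) S) ⊆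
      {x | 0 < x 0} :=
  fun x hx => by simpa using (hx 0 (mem_univ _)).1

theorem pi_Ioo_update_ae_eq_Icc {k : ℕ} {S : ℝ} :
    (Set.pi univ fun i => Ioo (Function.update (fun _ : Fin (k + 1) => -S) 0 0 i) S)
      =ᵐ[volume] Icc (Function.update (fun _ => -S) 0 0) fun _ => S :=
  Measure.univ_pi_Ioo_ae_eq_Icc

theorem setIntegral_halfSpace_eq_setIntegral_Icc {k : ℕ} {S : ℝ} {F : (Fin (k + 1) → ℝ) → ℝ}
    (hF : ∀ x, 0 < x 0 → ∀ i, S ≤ |x i| → F x = 0) :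
    ∫ x in {x | 0 < x 0}, F x =
      ∫ x in Icc (Function.update (fun _ => -S) 0 0) (fun _ => S), F x := by
  rw [← setIntegral_congr_set pi_Ioo_update_ae_eq_Icc]
  refine setIntegral_eq_of_subset_of_forall_sdiff_eq_zero
    (measurableSet_lt measurable_const (measurable_pi_apply 0)) pi_Ioo_update_subset_halfSpace ?_
  rintro x ⟨hx, hxQ⟩
  obtain ⟨i, hi⟩ : ∃ i, S ≤ |x i| := by
    by_contra! hlt
    refine hxQ fun i _ => ⟨?_, (abs_lt.1 (hlt i)).2⟩
    obtain rfl | hi := eq_or_ne i 0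
    · simpa using hx
    · simpa [hi] using (abs_lt.1 (hlt i)).1
  exact hF x hx i hi

theorem integral_flatDivergence_halfSpace {n : ℕ} [NeZero n] {V : Fin n → Model n → ℝ} {R : ℝ}
    (hR : ∀ i y, 0 ≤ y 0 → R < ‖y‖ → V i y = 0)
    (hc : ∀ i, ContinuousOn (V i) {y : Model n | 0 ≤ y 0})
    (h0 : ∀ i y, y 0 = 0 → V i y = 0)
    (hd : ∀ i y, 0 < y 0 → DifferentiableAt ℝ (V i) y)
    (hint : IntegrableOn (flatDivergence V) {y : Model n | 0 < y 0}) :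
    ∫ y in {y : Model n | 0 < y 0}, flatDivergence V y = 0 := by
  obtain ⟨k, rfl⟩ : ∃ k, n = k + 1 := Nat.exists_eq_succ_of_ne_zero (NeZero.ne n)
  -- A box in the half space with one face on the boundary and large enough to contain the supports.
  let S : ℝ := |R| + 1
  let a : Fin (k + 1) → ℝ := Function.update (fun _ => -S) 0 0
  have hS : 0 < S := by positivity
  have hab : a ≤ fun _ => S := update_le_iff.2 ⟨hS.le, fun _ _ => neg_le_self hS.le⟩
  let T : (Fin (k + 1) → ℝ) → Model (k + 1) := WithLp.toLp 2
  have hT : MeasurePreserving T := PiLp.volume_preserving_toLp (Fin (k + 1))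
  have hTd : Differentiable ℝ T := ((PiLp.continuousLinearEquiv 2 ℝ fun _ : Fin (k + 1) =>
    ℝ).symm : (Fin (k + 1) → ℝ) →L[ℝ] Model (k + 1)).differentiable
  have hT' : MeasurableEmbedding T := (MeasurableEquiv.toLp 2 _).measurableEmbedding
  have hfar (x : Fin (k + 1) → ℝ) (i : Fin (k + 1)) (hx : S ≤ |x i|) : R < ‖T x‖ :=
    ((le_abs_self R).trans_lt (lt_add_one _)).trans_le (hx.trans (PiLp.norm_apply_le (T x) i))
  rw [← hT.setIntegral_preimage_emb hT']
  refine (setIntegral_halfSpace_eq_setIntegral_Icc (S := S) fun x hx i hi => ?_).trans ?_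
  · refine flatDivergence_eq_zero fun j => ?_
    have hcoord : ContinuousAt (fun y : Model (k + 1) => y 0) (T x) := by fun_prop
    filter_upwards [hcoord.eventually (lt_mem_nhds hx),
      continuous_norm.continuousAt.eventually (lt_mem_nhds (hfar x i hi))] with y hy hy'
    exact hR j y hy.le hy'
  simp_rw [T, flatDivergence_toLp]
  have hnonneg (x : Fin (k + 1) → ℝ) (hx : x ∈ Icc a fun _ => S) : 0 ≤ x 0 := by
    simpa [a] using hx.1 0
  refine integral_divergence_eq_zero_of_faces hab
    (fun i => (hc i).comp (PiLp.continuous_toLp 2 _).continuousOn hnonneg)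
    (fun x hx i => (hd i (T x) (pi_Ioo_update_subset_halfSpace hx)).comp x
      (hTd x)) ?_ fun i x hx hi => ?_
  · simp_rw [← flatDivergence_toLp]
    exact (((hT.integrableOn_comp_preimage hT').2 hint).mono_set
      pi_Ioo_update_subset_halfSpace).congr_set_ae pi_Ioo_update_ae_eq_Icc.symm
  · obtain rfl | hi0 := eq_or_ne i 0
    · obtain h | h := hi
      · exact h0 _ _ (h.trans (Function.update_self ..))
      · exact hR _ _ (hnonneg x hx) (hfar x 0 (h ▸ le_abs_self S))
    · refine hR i _ (hnonneg x hx) (hfar x i ?_)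
      obtain h | h := hi
      · simpa [h, a, hi0] using le_abs_self S
      · exact h ▸ le_abs_self S

end HalfSpaceDivergence

/-! ### Metrics and differentials in charts -/

section Chart

variable {n : ℕ} [NeZero n] {M : Type*} [TopologicalSpace M]
  [ChartedSpace (EuclideanHalfSpace n) M]

section Frame

theorem sum_smul_single {n : ℕ} (v : Model n) :
    ∑ i, v i • EuclideanSpace.single i (1 : ℝ) = v := by
  ext m
  simp [Pi.single_apply]

/-- The components of `df` at `p` in the basis `frame p`. -/
noncomputable def diffVec (f : M → ℝ) (p : M) : Fin n → ℝ := fun i => differential f p (frame p i)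

theorem differential_eq_sum (f : M → ℝ) (p : M) (v : Model n) :
    differential f p v = ∑ k, diffVec f p k * v k := by
  have hv : (v : TangentSpace (𝓡∂ n) p) = ∑ i, v i • frame p i := (sum_smul_single v).symm
  have h : differential f p v = differential f p (∑ i, v i • frame p i) := by rw [← hv]
  refine (h.trans (map_sum (mfderiv (𝓡∂ n) 𝓘(ℝ, ℝ) f p) _ _)).trans
    (Finset.sum_congr rfl fun i _ => ?_)
  refine (map_smul (mfderiv (𝓡∂ n) 𝓘(ℝ, ℝ) f p) (v i) (frame p i)).trans ?_
  exact mul_comm (v i) (diffVec f p i)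

end Frame

variable [IsManifold (𝓡∂ n) ∞ M]

section Transition

instance isManifold_one : IsManifold (𝓡∂ n) 1 M := IsManifold.of_le (n := ∞) (by simp)

/-- The Jacobian matrix at `p` of the transition from the chart at `x` to the chart at `x'`. -/
noncomputable def transition (n : ℕ) [NeZero n] {M : Type*} [TopologicalSpace M]
    [ChartedSpace (EuclideanHalfSpace n) M] [IsManifold (𝓡∂ n) ∞ M] (x x' p : M) :
    Matrix (Fin n) (Fin n) ℝ :=
  Matrix.of fun k i => tangentCoordChange (𝓡∂ n) x x' p (EuclideanSpace.single i 1) k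

theorem tangentCoordChange_apply (x x' p : M) (v : Model n) (k : Fin n) :
    tangentCoordChange (𝓡∂ n) x x' p v k = (transition n x x' p *ᵥ v) k := by
  conv_lhs => rw [← sum_smul_single v]
  simp [transition, Matrix.mulVec, dotProduct, mul_comm]

theorem transition_mul {x x' x'' p : M} (hx : p ∈ (extChartAt (𝓡∂ n) x).source)
    (hx' : p ∈ (extChartAt (𝓡∂ n) x').source) (hx'' : p ∈ (extChartAt (𝓡∂ n) x'').source) :
    transition n x' x'' p * transition n x x' p = transition n x x'' p := by
  ext k i
  have h := tangentCoordChange_comp (I := 𝓡∂ n) (v := (EuclideanSpace.single i 1 : Model n))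
    ⟨⟨hx, hx'⟩, hx''⟩
  simp only [transition, Matrix.of_apply]
  rw [← h, tangentCoordChange_apply]
  rfl

theorem transition_self {x p : M} (hx : p ∈ (extChartAt (𝓡∂ n) x).source) :
    transition n x x p = 1 := by
  ext k i
  simp only [transition, Matrix.of_apply, tangentCoordChange_self (I := 𝓡∂ n) hx]
  simp [Matrix.one_apply]

theorem transition_mul_symm {x x' p : M} (hx : p ∈ (extChartAt (𝓡∂ n) x).source)
    (hx' : p ∈ (extChartAt (𝓡∂ n) x').source) :
    transition n x' x p * transition n x x' p = 1 := by
  rw [transition_mul hx hx' hx, transition_self hx]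

theorem transition_det_ne_zero {x x' p : M} (hx : p ∈ (extChartAt (𝓡∂ n) x).source)
    (hx' : p ∈ (extChartAt (𝓡∂ n) x').source) : (transition n x x' p).det ≠ 0 :=
  (Matrix.isUnit_det_of_left_inverse (transition_mul_symm hx hx')).ne_zero

theorem transition_inv {x x' p : M} (hx : p ∈ (extChartAt (𝓡∂ n) x).source)
    (hx' : p ∈ (extChartAt (𝓡∂ n) x').source) :
    (transition n x x' p)⁻¹ = transition n x' x p :=
  Matrix.inv_eq_left_inv (transition_mul_symm hx hx')

theorem mfderivWithin_extChartAt_symm {x p : M} (hx : p ∈ (extChartAt (𝓡∂ n) x).source) :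
    mfderivWithin 𝓘(ℝ, Model n) (𝓡∂ n) (extChartAt (𝓡∂ n) x).symm (range (𝓡∂ n))
      (extChartAt (𝓡∂ n) x p) = tangentCoordChange (𝓡∂ n) x p p := by
  rw [extChartAt_source] at hx
  exact (TangentBundle.symmL_trivializationAt hx).symm.trans
    (TangentBundle.symmL_trivializationAt_eq_core hx)

theorem mfderiv_extChartAt {x p : M} (hx : p ∈ (extChartAt (𝓡∂ n) x).source) :
    mfderiv (𝓡∂ n) 𝓘(ℝ, Model n) (extChartAt (𝓡∂ n) x) p = tangentCoordChange (𝓡∂ n) p x p := by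
  rw [extChartAt_source] at hx
  exact (TangentBundle.continuousLinearMapAt_trivializationAt hx).symm.trans
    (TangentBundle.continuousLinearMapAt_trivializationAt_eq_core hx)

end Transition

section Gram

theorem inner_eq_dotProduct (g : Metric n M) (p : M) (v w : Model n) :
    g.inner p v w = v.ofLp ⬝ᵥ gram g p *ᵥ w.ofLp := by
  have hframe (v : Model n) : (v : TangentSpace (𝓡∂ n) p) = ∑ i, v i • frame p i :=
    (sum_smul_single v).symm
  have h : g.inner p v w = g.inner p (∑ i, v i • frame p i) (∑ i, w i • frame p i) := by
    rw [← hframe, ← hframe]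
  rw [h, map_sum]
  simp_rw [map_sum, map_smul, sum_apply, smul_apply, smul_eq_mul, Finset.mul_sum]
  rw [Finset.sum_comm]
  simp only [dotProduct, Matrix.mulVec, gram, Matrix.of_apply, Finset.mul_sum]
  exact Finset.sum_congr rfl fun k _ => Finset.sum_congr rfl fun l _ => by ring

theorem chartGram_extChartAt (g : Metric n M) {x p : M} (hx : p ∈ (extChartAt (𝓡∂ n) x).source) :
    chartGram g x (extChartAt (𝓡∂ n) x p) =
      (transition n x p p)ᵀ * gram g p * transition n x p p := by
  ext i j
  have hbase (q : M) (hq : q = p) (v w : Model n) : g.inner q v w = g.inner p v w := by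
    subst hq
    rfl
  have h : chartGram g x (extChartAt (𝓡∂ n) x p) i j =
      g.inner p (tangentCoordChange (𝓡∂ n) x p p (EuclideanSpace.single i 1))
        (tangentCoordChange (𝓡∂ n) x p p (EuclideanSpace.single j 1)) := by
    rw [← mfderivWithin_extChartAt_symm hx]
    exact hbase _ ((extChartAt (𝓡∂ n) x).left_inv hx) _ _
  rw [h, inner_eq_dotProduct, Matrix.mul_assoc]
  rfl

theorem chartGram_transition (g : Metric n M) {x x' p : M}
    (hx : p ∈ (extChartAt (𝓡∂ n) x).source) (hx' : p ∈ (extChartAt (𝓡∂ n) x').source) :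
    chartGram g x (extChartAt (𝓡∂ n) x p) = (transition n x x' p)ᵀ *
      chartGram g x' (extChartAt (𝓡∂ n) x' p) * transition n x x' p := by
  rw [chartGram_extChartAt g hx, chartGram_extChartAt g hx',
    ← transition_mul hx hx' (mem_extChartAt_source p), Matrix.transpose_mul]
  simp only [Matrix.mul_assoc]

theorem gram_posDef (g : Metric n M) (p : M) : (gram g p).PosDef := by
  refine Matrix.PosDef.of_dotProduct_mulVec_pos ?_ fun v hv => ?_
  · ext i j
    simp [gram, g.symm p (frame p j) (frame p i)]
  · have h := g.pos p (WithLp.toLp 2 v : Model n) (mt (WithLp.toLp_eq_zero 2).1 hv)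
    rwa [inner_eq_dotProduct] at h

theorem transpose_gram (g : Metric n M) (p : M) : (gram g p)ᵀ = gram g p :=
  (Matrix.conjTranspose_eq_transpose_of_trivial _).symm.trans (gram_posDef g p).isHermitian

theorem chartGram_posDef (g : Metric n M) {x : M} {y : Model n}
    (hy : y ∈ (extChartAt (𝓡∂ n) x).target) : (chartGram g x y).PosDef := by
  have hp := (extChartAt (𝓡∂ n) x).map_target hy
  rw [← (extChartAt (𝓡∂ n) x).right_inv hy, chartGram_extChartAt g hp,
    ← Matrix.conjTranspose_eq_transpose_of_trivial]
  refine (gram_posDef g _).conjTranspose_mul_mul_same ?_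
  exact Matrix.mulVec_injective_of_isUnit ((Matrix.isUnit_iff_isUnit_det _).2
    (transition_det_ne_zero hp (mem_extChartAt_source _)).isUnit)

theorem sqrt_chartGram_det_transition (g : Metric n M) {x x' p : M}
    (hx : p ∈ (extChartAt (𝓡∂ n) x).source) (hx' : p ∈ (extChartAt (𝓡∂ n) x').source) :
    √(chartGram g x (extChartAt (𝓡∂ n) x p)).det =
      |(transition n x x' p).det| * √(chartGram g x' (extChartAt (𝓡∂ n) x' p)).det := by
  rw [chartGram_transition g hx hx', Matrix.det_mul, Matrix.det_mul, Matrix.det_transpose,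
    mul_right_comm, Real.sqrt_mul (mul_self_nonneg _), Real.sqrt_mul_self_eq_abs]

theorem localFrame_extChartAt_symm {x : M} {y : Model n}
    (hy : y ∈ (extChartAt (𝓡∂ n) x).target) (i : Fin n) :
    (trivializationAt (Model n) (TangentSpace (𝓡∂ n) : M → Type _) x).localFrame
        (EuclideanSpace.basisFun (Fin n) ℝ).toBasis i ((extChartAt (𝓡∂ n) x).symm y) =
      mfderivWithin 𝓘(ℝ, Model n) (𝓡∂ n) (extChartAt (𝓡∂ n) x).symm (range (𝓡∂ n)) y
        (EuclideanSpace.single i (1 : ℝ) : Model n) := by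
  have hp := (extChartAt (𝓡∂ n) x).map_target hy
  rw [extChartAt_source] at hp
  have h := TangentBundle.symmL_trivializationAt (I := 𝓡∂ n) hp
  rw [(extChartAt (𝓡∂ n) x).right_inv hy] at h
  have hb : (EuclideanSpace.basisFun (Fin n) ℝ).toBasis i = EuclideanSpace.single i (1 : ℝ) := by
    simp
  rw [Bundle.Trivialization.localFrame_apply_of_mem_baseSet _ _ hp, ← h, ← hb]
  exact (Module.Basis.map_apply _ _ _).trans
    (Bundle.Trivialization.symmL_apply (R := ℝ) _ hp _).symm

theorem contDiffOn_chartGram (g : Metric n M) (x : M) (i j : Fin n) :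
    ContDiffOn ℝ ∞ (fun y => chartGram g x y i j) (extChartAt (𝓡∂ n) x).target := by
  let e := trivializationAt (Model n) (TangentSpace (𝓡∂ n) : M → Type _) x
  let b := (EuclideanSpace.basisFun (Fin n) ℝ).toBasis
  have hframe (i : Fin n) : ContMDiffOn (𝓡∂ n) ((𝓡∂ n).prod 𝓘(ℝ, Model n)) ∞
      (fun p : M => (Bundle.TotalSpace.mk' (Model n) p (e.localFrame b i p) :
        TangentBundle (𝓡∂ n) M)) e.baseSet :=
    e.contMDiffOn_localFrame_baseSet (n := ∞) (I := 𝓡∂ n) b i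
  have hinner : ContMDiffOn (𝓡∂ n) ((𝓡∂ n).prod 𝓘(ℝ, ℝ)) ∞ (fun p : M =>
      Bundle.TotalSpace.mk' ℝ (E := Bundle.Trivial M ℝ) p
        (g.inner p (e.localFrame b i p) (e.localFrame b j p))) e.baseSet :=
    ContMDiffOn.clm_bundle_apply₂ (F₁ := Model n) (F₂ := Model n) (b := fun p : M => p)
      g.contMDiff.contMDiffOn (hframe i) (hframe j)
  have hcoord : ContMDiffOn (𝓡∂ n) 𝓘(ℝ, ℝ) ∞ (fun p : M =>
      g.inner p (e.localFrame b i p) (e.localFrame b j p)) e.baseSet := fun p hp =>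
    ((Bundle.contMDiffWithinAt_totalSpace).1 (hinner p hp)).2
  have hmaps : MapsTo (extChartAt (𝓡∂ n) x).symm (extChartAt (𝓡∂ n) x).target e.baseSet :=
    fun y hy => by simpa [e] using (extChartAt (𝓡∂ n) x).map_target hy
  refine (contMDiffOn_iff_contDiffOn.1 (hcoord.comp
    (contMDiffOn_extChartAt_symm (n := ∞) x) hmaps)).congr fun y hy => ?_
  simp only [Function.comp_apply, e, b, localFrame_extChartAt_symm hy]
  rfl

end Gram

section Differential

/-- The partial derivatives of `f` in the chart at `x`, at the point with coordinates `y` (within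
the half space, if that point lies on the boundary). -/
noncomputable def chartDiff (f : M → ℝ) (x : M) (y : Model n) : Fin n → ℝ := fun i =>
  fderivWithin ℝ (f ∘ (extChartAt (𝓡∂ n) x).symm) (range (𝓡∂ n)) y (EuclideanSpace.single i 1)

theorem chartDiff_extChartAt {f : M → ℝ} {x p : M} (hx : p ∈ (extChartAt (𝓡∂ n) x).source)
    (hf : MDifferentiableAt (𝓡∂ n) 𝓘(ℝ, ℝ) f p) :
    chartDiff f x (extChartAt (𝓡∂ n) x p) = (transition n x p p)ᵀ *ᵥ diffVec f p := by
  ext i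
  have hy := (extChartAt (𝓡∂ n) x).map_source hx
  have hsymm : HasMFDerivWithinAt 𝓘(ℝ, Model n) (𝓡∂ n) (extChartAt (𝓡∂ n) x).symm
      (range (𝓡∂ n)) (extChartAt (𝓡∂ n) x p) (tangentCoordChange (𝓡∂ n) x p p) := by
    rw [← mfderivWithin_extChartAt_symm hx]
    exact (mdifferentiableWithinAt_extChartAt_symm hy).hasMFDerivWithinAt
  have hf' : HasMFDerivAt (𝓡∂ n) 𝓘(ℝ, ℝ) f
      ((extChartAt (𝓡∂ n) x).symm (extChartAt (𝓡∂ n) x p)) (mfderiv (𝓡∂ n) 𝓘(ℝ, ℝ) f p) := by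
    rw [(extChartAt (𝓡∂ n) x).left_inv hx]
    exact hf.hasMFDerivAt
  have hcomp : HasFDerivWithinAt (f ∘ (extChartAt (𝓡∂ n) x).symm)
      (ContinuousLinearMap.comp (mfderiv (𝓡∂ n) 𝓘(ℝ, ℝ) f p : Model n →L[ℝ] ℝ)
        (tangentCoordChange (𝓡∂ n) x p p) : Model n →L[ℝ] ℝ) (range (𝓡∂ n))
      (extChartAt (𝓡∂ n) x p) :=
    (hf'.comp_hasMFDerivWithinAt _ hsymm).hasFDerivWithinAt
  have huniq : UniqueDiffWithinAt ℝ (range (𝓡∂ n)) (extChartAt (𝓡∂ n) x p) :=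
    (𝓡∂ n).uniqueDiffOn _ (extChartAt_target_subset_range x hy)
  refine (congrArg (fun L : Model n →L[ℝ] ℝ => L (EuclideanSpace.single i 1))
    (hcomp.fderivWithin huniq)).trans ((differential_eq_sum f p _).trans ?_)
  simp only [Matrix.mulVec, dotProduct, Matrix.transpose_apply, transition, Matrix.of_apply]
  exact Finset.sum_congr rfl fun k _ => mul_comm _ _

theorem contDiffOn_comp_extChartAt_symm {f : M → ℝ} (hf : ContMDiff (𝓡∂ n) 𝓘(ℝ, ℝ) ∞ f) (x : M) :
    ContDiffOn ℝ ∞ (f ∘ (extChartAt (𝓡∂ n) x).symm) (extChartAt (𝓡∂ n) x).target :=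
  contMDiffOn_iff_contDiffOn.1 (hf.comp_contMDiffOn (contMDiffOn_extChartAt_symm (n := ∞) x))

theorem contDiffOn_chartDiff {f : M → ℝ} (hf : ContMDiff (𝓡∂ n) 𝓘(ℝ, ℝ) ∞ f) (x : M) (i : Fin n) :
    ContDiffOn ℝ ∞ (fun y => chartDiff f x y i) (extChartAt (𝓡∂ n) x).target := by
  have h := (contDiffOn_comp_extChartAt_symm hf x).fderivWithin (m := ∞)
    (uniqueDiffOn_extChartAt_target x) (by simp)
  refine (h.clm_apply (contDiffOn_const (c := EuclideanSpace.single i 1))).congr fun y hy => ?_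
  rw [chartDiff, fderivWithin_congr_set (extChartAt_target_eventuallyEq_of_mem hy)]

end Differential

end Chart

/-! ### The cometric and the Laplacian in charts -/

section ChartLaplacian

variable {n : ℕ} [NeZero n] {M : Type*} [TopologicalSpace M]
  [ChartedSpace (EuclideanHalfSpace n) M]

theorem diffVec_mul {u v : M → ℝ} {p : M} (hu : MDifferentiableAt (𝓡∂ n) 𝓘(ℝ, ℝ) u p)
    (hv : MDifferentiableAt (𝓡∂ n) 𝓘(ℝ, ℝ) v p) :
    diffVec (n := n) (fun q => u q * v q) p = u p • diffVec v p + v p • diffVec u p := by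
  have h := (hu.hasMFDerivAt.mul hv.hasMFDerivAt).mfderiv
  ext i
  exact congrArg (fun L : Model n →L[ℝ] ℝ => L (EuclideanSpace.single i 1)) h

theorem diffVec_add {u v : M → ℝ} {p : M} (hu : MDifferentiableAt (𝓡∂ n) 𝓘(ℝ, ℝ) u p)
    (hv : MDifferentiableAt (𝓡∂ n) 𝓘(ℝ, ℝ) v p) :
    diffVec (n := n) (fun q => u q + v q) p = diffVec u p + diffVec v p := by
  have h := (hu.hasMFDerivAt.add hv.hasMFDerivAt).mfderiv
  ext i
  exact congrArg (fun L : Model n →L[ℝ] ℝ => L (EuclideanSpace.single i 1)) h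

theorem diffVec_sub {u v : M → ℝ} {p : M} (hu : MDifferentiableAt (𝓡∂ n) 𝓘(ℝ, ℝ) u p)
    (hv : MDifferentiableAt (𝓡∂ n) 𝓘(ℝ, ℝ) v p) :
    diffVec (n := n) (fun q => u q - v q) p = diffVec u p - diffVec v p := by
  have h := (hu.hasMFDerivAt.sub hv.hasMFDerivAt).mfderiv
  ext i
  exact congrArg (fun L : Model n →L[ℝ] ℝ => L (EuclideanSpace.single i 1)) h

theorem mdifferentiableAt_and_diffVec_sum {ι : Type*} {s : Finset ι} {u : ι → M → ℝ} {p : M}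
    (hu : ∀ i ∈ s, MDifferentiableAt (𝓡∂ n) 𝓘(ℝ, ℝ) (u i) p) :
    MDifferentiableAt (𝓡∂ n) 𝓘(ℝ, ℝ) (fun q => ∑ i ∈ s, u i q) p ∧
      diffVec (n := n) (fun q => ∑ i ∈ s, u i q) p = ∑ i ∈ s, diffVec (u i) p := by
  classical
  induction s using Finset.induction_on with
  | empty =>
    refine ⟨mdifferentiableAt_const, ?_⟩
    ext k
    exact congrArg (fun L : Model n →L[ℝ] ℝ => L (EuclideanSpace.single k 1))
      (hasMFDerivAt_const (0 : ℝ) p).mfderiv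
  | insert i s hi ih =>
    have hui := hu i (Finset.mem_insert_self i s)
    obtain ⟨hsum, hdiff⟩ := ih fun j hj => hu j (Finset.mem_insert_of_mem hj)
    simp only [Finset.sum_insert hi, ← hdiff]
    exact ⟨hui.add hsum, diffVec_add hui hsum⟩

theorem range_mem_nhds_of_coord_pos {y : Model n} (h0 : 0 < y 0) : range (𝓡∂ n) ∈ 𝓝 y := by
  rw [range_modelWithCornersEuclideanHalfSpace]
  have hcoord : ContinuousAt (fun y : Model n => y 0) y := by fun_prop
  filter_upwards [hcoord.eventually (lt_mem_nhds h0)] with w hw using hw.le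

theorem extChartAt_target_mem_nhds_of_coord_pos {x : M} {y : Model n}
    (hy : y ∈ (extChartAt (𝓡∂ n) x).target) (h0 : 0 < y 0) :
    (extChartAt (𝓡∂ n) x).target ∈ 𝓝 y := by
  rw [← nhdsWithin_eq_nhds.2 (range_mem_nhds_of_coord_pos h0)]
  exact extChartAt_target_mem_nhdsWithin_of_mem hy

theorem differentiableWithinAt_range_of_contDiffOn {x : M} {w : Model n → ℝ}
    (hw : ContDiffOn ℝ ∞ w (extChartAt (𝓡∂ n) x).target) {y : Model n}
    (hy : y ∈ (extChartAt (𝓡∂ n) x).target) :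
    DifferentiableWithinAt ℝ w (range (𝓡∂ n)) y :=
  ((hw y hy).differentiableWithinAt (by simp)).mono_of_mem_nhdsWithin
    (extChartAt_target_mem_nhdsWithin_of_mem hy)

variable [IsManifold (𝓡∂ n) ∞ M]

section Cometric

/-- The inner product `⟨du, dv⟩` of covectors induced by `g`. -/
noncomputable def cometric (g : Metric n M) (u v : M → ℝ) (p : M) : ℝ :=
  diffVec u p ⬝ᵥ (gram g p)⁻¹ *ᵥ diffVec v p

theorem cometric_comm (g : Metric n M) (u v : M → ℝ) (p : M) :
    cometric g u v p = cometric g v u p := by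
  unfold cometric
  rw [dotProduct_comm, ← Matrix.vecMul_transpose, ← Matrix.dotProduct_mulVec,
    Matrix.transpose_nonsing_inv, transpose_gram]

theorem riemannianGradient_eq_toLp (g : Metric n M) (f : M → ℝ) (p : M) :
    (riemannianGradient g f p : Model n) = WithLp.toLp 2 ((gram g p)⁻¹ *ᵥ diffVec f p) :=
  sum_smul_single (WithLp.toLp 2 ((gram g p)⁻¹ *ᵥ diffVec f p))

theorem inner_riemannianGradient (g : Metric n M) (u v : M → ℝ) (p : M) :
    g.inner p (riemannianGradient g u p) (riemannianGradient g v p) = cometric g u v p := by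
  refine (inner_eq_dotProduct g p (riemannianGradient g u p) (riemannianGradient g v p)).trans ?_
  rw [riemannianGradient_eq_toLp, riemannianGradient_eq_toLp, Matrix.mulVec_mulVec,
    Matrix.mul_nonsing_inv _ (gram_posDef g p).det_pos.ne'.isUnit, Matrix.one_mulVec,
    dotProduct_comm]
  exact cometric_comm g v u p

/-- The components of `∇ f` in the chart at `x`. -/
noncomputable def chartGradient (g : Metric n M) (f : M → ℝ) (x : M) (y : Model n) : Fin n → ℝ :=
  (chartGram g x y)⁻¹ *ᵥ chartDiff f x y

theorem chartGradient_extChartAt (g : Metric n M) {f : M → ℝ} {x p : M}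
    (hx : p ∈ (extChartAt (𝓡∂ n) x).source) (hf : MDifferentiableAt (𝓡∂ n) 𝓘(ℝ, ℝ) f p) :
    chartGradient g f x (extChartAt (𝓡∂ n) x p) =
      transition n p x p *ᵥ ((gram g p)⁻¹ *ᵥ diffVec f p) := by
  have hp := mem_extChartAt_source (I := 𝓡∂ n) p
  have hT : IsUnit (transition n x p p)ᵀ.det := by
    rw [Matrix.det_transpose]
    exact (transition_det_ne_zero hx hp).isUnit
  rw [chartGradient, chartDiff_extChartAt hx hf, chartGram_extChartAt g hx, Matrix.mul_inv_rev,
    Matrix.mul_inv_rev, Matrix.mulVec_mulVec, Matrix.mul_assoc, Matrix.mul_assoc,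
    Matrix.nonsing_inv_mul _ hT, Matrix.mul_one, transition_inv hx hp, Matrix.mulVec_mulVec]

theorem cometric_eq_chartDiff_dotProduct (g : Metric n M) {u v : M → ℝ} {x p : M}
    (hx : p ∈ (extChartAt (𝓡∂ n) x).source)
    (hu : MDifferentiableAt (𝓡∂ n) 𝓘(ℝ, ℝ) u p) (hv : MDifferentiableAt (𝓡∂ n) 𝓘(ℝ, ℝ) v p) :
    cometric g u v p = chartDiff u x (extChartAt (𝓡∂ n) x p) ⬝ᵥ
      chartGradient g v x (extChartAt (𝓡∂ n) x p) := by
  have hp := mem_extChartAt_source (I := 𝓡∂ n) p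
  rw [chartDiff_extChartAt hx hu, chartGradient_extChartAt g hx hv, Matrix.mulVec_transpose,
    ← Matrix.dotProduct_mulVec, Matrix.mulVec_mulVec, transition_mul_symm hp hx,
    Matrix.one_mulVec, cometric]

theorem mfderiv_extChartAt_riemannianGradient (g : Metric n M) {f : M → ℝ} {x p : M}
    (hx : p ∈ (extChartAt (𝓡∂ n) x).source) (hf : MDifferentiableAt (𝓡∂ n) 𝓘(ℝ, ℝ) f p)
    (k : Fin n) :
    (EuclideanSpace.proj k : Model n →L[ℝ] ℝ)
      (mfderiv (𝓡∂ n) 𝓘(ℝ, Model n) (extChartAt (𝓡∂ n) x) p (riemannianGradient g f p)) =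
      chartGradient g f x (extChartAt (𝓡∂ n) x p) k := by
  rw [chartGradient_extChartAt g hx hf, mfderiv_extChartAt hx]
  refine (tangentCoordChange_apply p x p (riemannianGradient g f p) k).trans ?_
  rw [riemannianGradient_eq_toLp]

/-- The components of `√(det g) ∇ f` in the chart at `x`. -/
noncomputable def chartFlux (g : Metric n M) (f : M → ℝ) (x : M) (k : Fin n) (y : Model n) : ℝ :=
  √(chartGram g x y).det * chartGradient g f x y k

theorem chartFlux_transition (g : Metric n M) {f : M → ℝ} {x x' p : M}
    (hx : p ∈ (extChartAt (𝓡∂ n) x).source) (hx' : p ∈ (extChartAt (𝓡∂ n) x').source)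
    (hf : MDifferentiableAt (𝓡∂ n) 𝓘(ℝ, ℝ) f p) (i : Fin n) :
    chartFlux g f x i (extChartAt (𝓡∂ n) x p) = ∑ k, |(transition n x x' p).det| *
      (transition n x x' p)⁻¹ i k * chartFlux g f x' k (extChartAt (𝓡∂ n) x' p) := by
  have hgrad : chartGradient g f x (extChartAt (𝓡∂ n) x p) =
      (transition n x x' p)⁻¹ *ᵥ chartGradient g f x' (extChartAt (𝓡∂ n) x' p) := by
    rw [chartGradient_extChartAt g hx hf, chartGradient_extChartAt g hx' hf,
      transition_inv hx hx', Matrix.mulVec_mulVec (M := transition n x' x p),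
      transition_mul (mem_extChartAt_source p) hx' hx]
  simp only [chartFlux, sqrt_chartGram_det_transition g hx hx', hgrad, Matrix.mulVec, dotProduct,
    Finset.mul_sum]
  exact Finset.sum_congr rfl fun k _ => by ring

theorem contDiffOn_sqrt_chartGram_det (g : Metric n M) (x : M) :
    ContDiffOn ℝ ∞ (fun y => √(chartGram g x y).det) (extChartAt (𝓡∂ n) x).target := fun y hy =>
  (contDiffWithinAt_det fun i j => contDiffOn_chartGram g x i j y hy).sqrt
    (chartGram_posDef g hy).det_pos.ne'

theorem contDiffOn_chartGradient (g : Metric n M) {f : M → ℝ}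
    (hf : ContMDiff (𝓡∂ n) 𝓘(ℝ, ℝ) ∞ f) (x : M) (k : Fin n) :
    ContDiffOn ℝ ∞ (fun y => chartGradient g f x y k) (extChartAt (𝓡∂ n) x).target := by
  simp only [chartGradient, Matrix.mulVec, dotProduct]
  exact ContDiffOn.sum fun j _ => ContDiffOn.mul (fun y hy => contDiffWithinAt_inv_apply
    (fun i j => contDiffOn_chartGram g x i j y hy) (chartGram_posDef g hy).det_pos.ne' k j)
    (contDiffOn_chartDiff hf x j)

theorem contDiffOn_chartFlux (g : Metric n M) {f : M → ℝ}
    (hf : ContMDiff (𝓡∂ n) 𝓘(ℝ, ℝ) ∞ f) (x : M) (k : Fin n) :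
    ContDiffOn ℝ ∞ (chartFlux g f x k) (extChartAt (𝓡∂ n) x).target :=
  (contDiffOn_sqrt_chartGram_det g x).mul (contDiffOn_chartGradient g hf x k)

theorem continuous_cometric (g : Metric n M) {u v : M → ℝ} (hu : ContMDiff (𝓡∂ n) 𝓘(ℝ, ℝ) ∞ u)
    (hv : ContMDiff (𝓡∂ n) 𝓘(ℝ, ℝ) ∞ v) : Continuous (cometric g u v) := by
  refine continuous_iff_continuousAt.2 fun x => ?_
  have hchart : ContinuousOn (fun y => chartDiff u x y ⬝ᵥ chartGradient g v x y)
      (extChartAt (𝓡∂ n) x).target :=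
    (ContDiffOn.sum fun j _ =>
      (contDiffOn_chartDiff hu x j).mul (contDiffOn_chartGradient g hv x j)).continuousOn
  have hsource := extChartAt_source_mem_nhds (I := 𝓡∂ n) x
  refine ((hchart.comp (continuousOn_extChartAt x)
    (extChartAt (𝓡∂ n) x).mapsTo).continuousAt hsource).congr ?_
  filter_upwards [hsource] with p hp
  exact (cometric_eq_chartDiff_dotProduct g hp (hu.mdifferentiableAt (by simp))
    (hv.mdifferentiableAt (by simp))).symm

end Cometric

section HalfSpace

theorem isInteriorPoint_iff_coord_pos {x p : M} (hx : p ∈ (extChartAt (𝓡∂ n) x).source) :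
    (𝓡∂ n).IsInteriorPoint p ↔ 0 < extChartAt (𝓡∂ n) x p 0 := by
  have hx' := hx
  rw [extChartAt_source] at hx'
  rw [ModelWithCorners.isInteriorPoint_iff_of_mem_atlas (n := ∞) (by simp)
    (chart_mem_atlas _ x) hx']
  refine ⟨fun h => ?_, fun h => ?_⟩
  · have hint := interior_mono (extChartAt_target_subset_range (I := 𝓡∂ n) x) h
    rwa [interior_range_modelWithCornersEuclideanHalfSpace] at hint
  · exact mem_interior_iff_mem_nhds.2
      (extChartAt_target_mem_nhds_of_coord_pos ((extChartAt (𝓡∂ n) x).map_source hx) h)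

theorem mem_boundary_of_coord_eq_zero {x p : M} (hx : p ∈ (extChartAt (𝓡∂ n) x).source)
    (h0 : extChartAt (𝓡∂ n) x p 0 = 0) : p ∈ (𝓡∂ n).boundary M := by
  rw [← ModelWithCorners.compl_interior]
  exact fun hp => ((isInteriorPoint_iff_coord_pos hx).1 hp).ne' h0

end HalfSpace

section Laplacian

/-- The divergence of the vector field with components `Vⁱ`, with partial derivatives within the
half space. -/
noncomputable def halfSpaceDivergence (V : Fin n → Model n → ℝ) (y : Model n) : ℝ :=
  ∑ i, fderivWithin ℝ (V i) (range (𝓡∂ n)) y (EuclideanSpace.single i 1)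

theorem halfSpaceDivergence_eq_flatDivergence {V : Fin n → Model n → ℝ} {y : Model n}
    (h0 : 0 < y 0) : halfSpaceDivergence V y = flatDivergence V y := by
  simp only [halfSpaceDivergence, flatDivergence,
    fderivWithin_of_mem_nhds (range_mem_nhds_of_coord_pos h0)]

theorem laplacian_eq (g : Metric n M) {f : M → ℝ} (hf : ContMDiff (𝓡∂ n) 𝓘(ℝ, ℝ) ∞ f) (p : M) :
    laplacian g f p = (√(chartGram g p (extChartAt (𝓡∂ n) p p)).det)⁻¹ *
      halfSpaceDivergence (chartFlux g f p) (extChartAt (𝓡∂ n) p p) := by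
  unfold laplacian divergence halfSpaceDivergence
  congr 1
  refine Finset.sum_congr rfl fun i _ => ?_
  have hflux : ∀ y ∈ (extChartAt (𝓡∂ n) p).target, √(chartGram g p y).det *
        (EuclideanSpace.proj i : Model n →L[ℝ] ℝ)
          (mfderiv (𝓡∂ n) 𝓘(ℝ, Model n) (extChartAt (𝓡∂ n) p) ((extChartAt (𝓡∂ n) p).symm y)
            (riemannianGradient g f ((extChartAt (𝓡∂ n) p).symm y))) = chartFlux g f p i y := by
    intro y hy
    refine congrArg (√(chartGram g p y).det * ·) ((mfderiv_extChartAt_riemannianGradient g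
      ((extChartAt (𝓡∂ n) p).map_target hy) (hf.mdifferentiableAt (by simp)) i).trans ?_)
    rw [(extChartAt (𝓡∂ n) p).right_inv hy]
  rw [Filter.EventuallyEq.fderivWithin_eq
    (eventually_of_mem (extChartAt_target_mem_nhdsWithin p) hflux)
    (hflux _ (mem_extChartAt_target p))]

theorem transition_eq_jacobian {x x' p : M}
    (h0 : 0 < extChartAt (𝓡∂ n) x p 0) :
    transition n x x' p =
      jacobian (extChartAt (𝓡∂ n) x' ∘ (extChartAt (𝓡∂ n) x).symm) (extChartAt (𝓡∂ n) x p) := by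
  ext k l
  simp only [transition, jacobian, Matrix.of_apply]
  rw [tangentCoordChange_def, fderivWithin_of_mem_nhds (range_mem_nhds_of_coord_pos h0)]

theorem flatDivergence_chartFlux_transition (g : Metric n M) {f : M → ℝ}
    (hf : ContMDiff (𝓡∂ n) 𝓘(ℝ, ℝ) ∞ f) {x x' p : M} (hx : p ∈ (extChartAt (𝓡∂ n) x).source)
    (hx' : p ∈ (extChartAt (𝓡∂ n) x').source) (hp : (𝓡∂ n).IsInteriorPoint p) :
    flatDivergence (chartFlux g f x) (extChartAt (𝓡∂ n) x p) = |(transition n x x' p).det| *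
      flatDivergence (chartFlux g f x') (extChartAt (𝓡∂ n) x' p) := by
  have h0 := (isInteriorPoint_iff_coord_pos hx).1 hp
  have hy := (extChartAt (𝓡∂ n) x).map_source hx
  have hleft := (extChartAt (𝓡∂ n) x).left_inv hx
  let σ : Model n → Model n := extChartAt (𝓡∂ n) x' ∘ (extChartAt (𝓡∂ n) x).symm
  have hσy : σ (extChartAt (𝓡∂ n) x p) = extChartAt (𝓡∂ n) x' p :=
    congrArg (extChartAt (𝓡∂ n) x') hleft
  have hσ : ContDiffAt ℝ ∞ σ (extChartAt (𝓡∂ n) x p) :=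
    (contDiffWithinAt_ext_coord_change x' x
      ⟨hy, mem_preimage.2 (hleft.symm ▸ hx' : (extChartAt (𝓡∂ n) x).symm _ ∈ _)⟩).contDiffAt
      (range_mem_nhds_of_coord_pos h0)
  have hflux (i : Fin n) : chartFlux g f x i =ᶠ[𝓝 (extChartAt (𝓡∂ n) x p)] fun y =>
      ∑ k, |(jacobian σ y).det| * (jacobian σ y)⁻¹ i k * chartFlux g f x' k (σ y) := by
    have hcoord : ContinuousAt (fun y : Model n => y 0) (extChartAt (𝓡∂ n) x p) := by fun_prop
    have hsource : ∀ᶠ y in 𝓝 (extChartAt (𝓡∂ n) x p),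
        (extChartAt (𝓡∂ n) x).symm y ∈ (extChartAt (𝓡∂ n) x').source :=
      (continuousAt_extChartAt_symm' hx).eventually_mem
        (hleft.symm ▸ (isOpen_extChartAt_source x').mem_nhds hx')
    filter_upwards [extChartAt_target_mem_nhds_of_coord_pos hy h0, hsource,
      hcoord.eventually (lt_mem_nhds h0)] with y hy hy' hy0
    have hq := (extChartAt (𝓡∂ n) x).map_target hy
    have h := chartFlux_transition g hq hy' (hf.mdifferentiableAt (by simp)) i
    rwa [transition_eq_jacobian (by rwa [(extChartAt (𝓡∂ n) x).right_inv hy]),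
      (extChartAt (𝓡∂ n) x).right_inv hy] at h
  have hW (k : Fin n) : DifferentiableAt ℝ (chartFlux g f x' k) (σ (extChartAt (𝓡∂ n) x p)) := by
    rw [hσy]
    exact ((contDiffOn_chartFlux g hf x' k).contDiffAt (extChartAt_target_mem_nhds_of_coord_pos
      ((extChartAt (𝓡∂ n) x').map_source hx')
      ((isInteriorPoint_iff_coord_pos hx').1 hp))).differentiableAt (by simp)
  have hT := transition_eq_jacobian (x' := x') h0
  rw [hT, ← hσy, ← flatDivergence_piola (hσ.of_le (by norm_cast))
    (hT ▸ transition_det_ne_zero hx hx') hW]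
  exact Finset.sum_congr rfl fun i _ => by rw [(hflux i).fderiv_eq]

theorem laplacian_eq_flatDivergence (g : Metric n M) {f : M → ℝ}
    (hf : ContMDiff (𝓡∂ n) 𝓘(ℝ, ℝ) ∞ f) {x p : M} (hx : p ∈ (extChartAt (𝓡∂ n) x).source)
    (hp : (𝓡∂ n).IsInteriorPoint p) :
    laplacian g f p = (√(chartGram g x (extChartAt (𝓡∂ n) x p)).det)⁻¹ *
      flatDivergence (chartFlux g f x) (extChartAt (𝓡∂ n) x p) := by
  have hpp := mem_extChartAt_source (I := 𝓡∂ n) p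
  have hdet : |(transition n p x p).det| ≠ 0 := abs_ne_zero.2 (transition_det_ne_zero hpp hx)
  rw [laplacian_eq g hf,
    halfSpaceDivergence_eq_flatDivergence ((isInteriorPoint_iff_coord_pos hpp).1 hp),
    flatDivergence_chartFlux_transition g hf hpp hx hp, sqrt_chartGram_det_transition g hpp hx,
    mul_inv, mul_mul_mul_comm, inv_mul_cancel₀ hdet, one_mul]

end Laplacian

section ProductRules

variable {u v : M → ℝ}

theorem cometric_mul_right (g : Metric n M) (w : M → ℝ) {p : M}
    (hu : MDifferentiableAt (𝓡∂ n) 𝓘(ℝ, ℝ) u p) (hv : MDifferentiableAt (𝓡∂ n) 𝓘(ℝ, ℝ) v p) :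
    cometric g w (fun q => u q * v q) p = u p * cometric g w v p + v p * cometric g w u p := by
  simp only [cometric, diffVec_mul hu hv, Matrix.mulVec_add, Matrix.mulVec_smul, dotProduct_add,
    dotProduct_smul, smul_eq_mul]

theorem cometric_mul_left (g : Metric n M) (w : M → ℝ) {p : M}
    (hu : MDifferentiableAt (𝓡∂ n) 𝓘(ℝ, ℝ) u p) (hv : MDifferentiableAt (𝓡∂ n) 𝓘(ℝ, ℝ) v p) :
    cometric g (fun q => u q * v q) w p = u p * cometric g v w p + v p * cometric g u w p := by
  rw [cometric_comm, cometric_mul_right g w hu hv, cometric_comm g w v, cometric_comm g w u]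

theorem cometric_sub_left (g : Metric n M) (w : M → ℝ) {p : M}
    (hu : MDifferentiableAt (𝓡∂ n) 𝓘(ℝ, ℝ) u p) (hv : MDifferentiableAt (𝓡∂ n) 𝓘(ℝ, ℝ) v p) :
    cometric g (fun q => u q - v q) w p = cometric g u w p - cometric g v w p := by
  simp only [cometric, diffVec_sub hu hv, sub_dotProduct]

theorem chartFlux_mul (g : Metric n M) (hu : MDifferentiable (𝓡∂ n) 𝓘(ℝ, ℝ) u)
    (hv : MDifferentiable (𝓡∂ n) 𝓘(ℝ, ℝ) v) {x : M} {y : Model n}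
    (hy : y ∈ (extChartAt (𝓡∂ n) x).target) (i : Fin n) :
    chartFlux g (fun q => u q * v q) x i y =
      u ((extChartAt (𝓡∂ n) x).symm y) * chartFlux g v x i y +
        v ((extChartAt (𝓡∂ n) x).symm y) * chartFlux g u x i y := by
  have hp := (extChartAt (𝓡∂ n) x).map_target hy
  rw [← (extChartAt (𝓡∂ n) x).right_inv hy]
  simp only [(extChartAt (𝓡∂ n) x).left_inv hp, chartFlux]
  rw [chartGradient_extChartAt (f := fun q => u q * v q) g hp ((hu _).mul (hv _)),
    chartGradient_extChartAt g hp (hu _),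
    chartGradient_extChartAt g hp (hv _), diffVec_mul (hu _) (hv _)]
  simp only [Matrix.mulVec_add, Matrix.mulVec_smul, Pi.add_apply, Pi.smul_apply, smul_eq_mul]
  ring

theorem halfSpaceDivergence_mul_chartFlux (g : Metric n M)
    (hu : ContMDiff (𝓡∂ n) 𝓘(ℝ, ℝ) ∞ u) (hv : ContMDiff (𝓡∂ n) 𝓘(ℝ, ℝ) ∞ v) {x : M} {y : Model n}
    (hy : y ∈ (extChartAt (𝓡∂ n) x).target) :
    halfSpaceDivergence (fun i y => u ((extChartAt (𝓡∂ n) x).symm y) * chartFlux g v x i y) y =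
      u ((extChartAt (𝓡∂ n) x).symm y) * halfSpaceDivergence (chartFlux g v x) y +
        √(chartGram g x y).det * cometric g u v ((extChartAt (𝓡∂ n) x).symm y) := by
  have hcometric := cometric_eq_chartDiff_dotProduct g ((extChartAt (𝓡∂ n) x).map_target hy)
    (hu.mdifferentiableAt (by simp)) (hv.mdifferentiableAt (by simp))
  rw [(extChartAt (𝓡∂ n) x).right_inv hy] at hcometric
  simp only [hcometric, halfSpaceDivergence, dotProduct, Finset.mul_sum, ← Finset.sum_add_distrib]
  refine Finset.sum_congr rfl fun i _ => ?_
  have hprod := fderivWithin_fun_mul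
    ((𝓡∂ n).uniqueDiffOn y (extChartAt_target_subset_range x hy))
    (differentiableWithinAt_range_of_contDiffOn (contDiffOn_comp_extChartAt_symm hu x) hy)
    (differentiableWithinAt_range_of_contDiffOn (contDiffOn_chartFlux g hv x i) hy)
  refine (congrArg (fun L : Model n →L[ℝ] ℝ => L (EuclideanSpace.single i 1)) hprod).trans ?_
  simp only [add_apply, smul_apply, smul_eq_mul, Function.comp_apply, chartDiff]
  rw [chartFlux]
  ring

theorem laplacian_mul (g : Metric n M) (hu : ContMDiff (𝓡∂ n) 𝓘(ℝ, ℝ) ∞ u)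
    (hv : ContMDiff (𝓡∂ n) 𝓘(ℝ, ℝ) ∞ v) (p : M) :
    laplacian g (fun q => u q * v q) p =
      u p * laplacian g v p + v p * laplacian g u p + 2 * cometric g u v p := by
  have hz := mem_extChartAt_target (I := 𝓡∂ n) p
  have hmd {w : M → ℝ} (hw : ContMDiff (𝓡∂ n) 𝓘(ℝ, ℝ) ∞ w) : MDifferentiable (𝓡∂ n) 𝓘(ℝ, ℝ) w :=
    hw.mdifferentiable (by simp)
  have hd {a b : M → ℝ} (ha : ContMDiff (𝓡∂ n) 𝓘(ℝ, ℝ) ∞ a) (hb : ContMDiff (𝓡∂ n) 𝓘(ℝ, ℝ) ∞ b)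
      (i : Fin n) : DifferentiableWithinAt ℝ
        (fun y => a ((extChartAt (𝓡∂ n) p).symm y) * chartFlux g b p i y)
        (range (𝓡∂ n)) (extChartAt (𝓡∂ n) p p) :=
    (differentiableWithinAt_range_of_contDiffOn (contDiffOn_comp_extChartAt_symm ha p) hz).mul
      (differentiableWithinAt_range_of_contDiffOn (contDiffOn_chartFlux g hb p i) hz)
  have hflux : halfSpaceDivergence (chartFlux g (fun q => u q * v q) p) (extChartAt (𝓡∂ n) p p) =
      halfSpaceDivergence (fun i y => u ((extChartAt (𝓡∂ n) p).symm y) * chartFlux g v p i y)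
        (extChartAt (𝓡∂ n) p p) +
      halfSpaceDivergence (fun i y => v ((extChartAt (𝓡∂ n) p).symm y) * chartFlux g u p i y)
        (extChartAt (𝓡∂ n) p p) := by
    simp only [halfSpaceDivergence, ← Finset.sum_add_distrib]
    refine Finset.sum_congr rfl fun i _ => ?_
    rw [Filter.EventuallyEq.fderivWithin_eq (eventually_of_mem
      (extChartAt_target_mem_nhdsWithin p) fun y hy => chartFlux_mul g (hmd hu) (hmd hv) hy i)
      (chartFlux_mul g (hmd hu) (hmd hv) hz i), fderivWithin_fun_add
      ((𝓡∂ n).uniqueDiffOn _ (extChartAt_target_subset_range p hz)) (hd hu hv i) (hd hv hu i)]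
    rfl
  have hsqrt := (Real.sqrt_pos.2 (chartGram_posDef g hz).det_pos).ne'
  rw [laplacian_eq (f := fun q => u q * v q) g (hu.mul hv), laplacian_eq g hu, laplacian_eq g hv,
    hflux, halfSpaceDivergence_mul_chartFlux g hu hv hz,
    halfSpaceDivergence_mul_chartFlux g hv hu hz, cometric_comm g v u, extChartAt_to_inv]
  field_simp
  ring

theorem etaLaplacian_mul (g : Metric n M) {η : M → ℝ} (hu : ContMDiff (𝓡∂ n) 𝓘(ℝ, ℝ) ∞ u)
    (hv : ContMDiff (𝓡∂ n) 𝓘(ℝ, ℝ) ∞ v) (p : M) :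
    etaLaplacian g η (fun q => u q * v q) p =
      u p * etaLaplacian g η v p + v p * etaLaplacian g η u p + 2 * cometric g u v p := by
  simp only [etaLaplacian, inner_riemannianGradient]
  rw [laplacian_mul g hu hv, cometric_mul_right g η (hu.mdifferentiableAt (by simp))
    (hv.mdifferentiableAt (by simp))]
  ring

end ProductRules

end ChartLaplacian

/-! ### The Riemannian volume in charts -/

section RiemannianVolume

variable {n : ℕ} [NeZero n] {M : Type*} [TopologicalSpace M]
  [ChartedSpace (EuclideanHalfSpace n) M]

section Volume

theorem measurableSet_extChartAt_target (x : M) : MeasurableSet (extChartAt (𝓡∂ n) x).target := by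
  rw [extChartAt_target]
  exact ((chartAt (EuclideanHalfSpace n) x).open_target.preimage
    (𝓡∂ n).continuous_symm).measurableSet.inter (𝓡∂ n).isClosed_range.measurableSet

theorem exists_finset_iUnion_extChartAt_source [CompactSpace M] :
    ∃ t : Finset M, ⋃ x ∈ t, (extChartAt (𝓡∂ n) x).source = univ := by
  obtain ⟨t, -, ht⟩ := isCompact_univ.elim_nhds_subcover (fun x : M => (extChartAt (𝓡∂ n) x).source)
    fun x _ => extChartAt_source_mem_nhds (I := 𝓡∂ n) x
  exact ⟨t, univ_subset_iff.1 ht⟩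

section

variable [IsManifold (𝓡∂ n) ∞ M]

theorem aemeasurable_sqrt_chartGram_det (g : Metric n M) (x : M) :
    AEMeasurable (fun y => ENNReal.ofReal (√(chartGram g x y).det))
      ((volume : Measure (Model n)).restrict (extChartAt (𝓡∂ n) x).target) :=
  ((contDiffOn_sqrt_chartGram_det g x).continuousOn.aemeasurable
    (measurableSet_extChartAt_target x)).ennreal_ofReal

theorem det_tangentCoordChange (x x' p : M) :
    (tangentCoordChange (𝓡∂ n) x x' p : Model n →L[ℝ] Model n).det =
      (transition n x x' p).det := by
  change LinearMap.det _ = _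
  rw [← LinearMap.det_toMatrix (EuclideanSpace.basisFun (Fin n) ℝ).toBasis]
  congr 1

end

variable [MeasurableSpace M] [BorelSpace M]

theorem measurableSet_extChartAt_source (x : M) :
    MeasurableSet (extChartAt (𝓡∂ n) x).source :=
  (isOpen_extChartAt_source x).measurableSet

theorem aemeasurable_extChartAt_symm (x : M) :
    AEMeasurable (extChartAt (𝓡∂ n) x).symm
      ((volume : Measure (Model n)).restrict (extChartAt (𝓡∂ n) x).target) :=
  (continuousOn_extChartAt_symm x).aemeasurable (measurableSet_extChartAt_target x)

theorem measurableSet_image_extChartAt {x : M} {S : Set M} (hS : MeasurableSet S)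
    (h : S ⊆ (extChartAt (𝓡∂ n) x).source) : MeasurableSet (extChartAt (𝓡∂ n) x '' S) := by
  have hmeas : Measurable ((extChartAt (𝓡∂ n) x).target.domRestrict (extChartAt (𝓡∂ n) x).symm) :=
    (continuousOn_iff_continuous_domRestrict.1 (continuousOn_extChartAt_symm x)).measurable
  rw [(extChartAt (𝓡∂ n) x).image_eq_target_inter_inv_preimage h, ← Subtype.image_preimage_val]
  exact (measurableSet_extChartAt_target x).subtype_image (hmeas hS)

variable [IsManifold (𝓡∂ n) ∞ M]

theorem lintegral_chartVolume (g : Metric n M) (x : M) {f : M → ENNReal} (hf : Measurable f) :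
    ∫⁻ p, f p ∂(chartVolume g x) = ∫⁻ y in (extChartAt (𝓡∂ n) x).target,
      ENNReal.ofReal (√(chartGram g x y).det) * f ((extChartAt (𝓡∂ n) x).symm y) := by
  unfold chartVolume
  rw [lintegral_map' hf.aemeasurable
      ((aemeasurable_extChartAt_symm x).mono_ac (withDensity_absolutelyContinuous _ _)),
    lintegral_withDensity_eq_lintegral_mul₀ (aemeasurable_sqrt_chartGram_det g x)]
  · rfl
  · exact hf.comp_aemeasurable (aemeasurable_extChartAt_symm x)

theorem integral_chartVolume (g : Metric n M) (x : M) {f : M → ℝ} (hf : Measurable f) :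
    ∫ p, f p ∂(chartVolume g x) = ∫ y in (extChartAt (𝓡∂ n) x).target,
      √(chartGram g x y).det * f ((extChartAt (𝓡∂ n) x).symm y) := by
  unfold chartVolume
  rw [integral_map
      ((aemeasurable_extChartAt_symm x).mono_ac (withDensity_absolutelyContinuous _ _))
      hf.aestronglyMeasurable,
    integral_withDensity_eq_integral_toReal_smul₀ (aemeasurable_sqrt_chartGram_det g x)
      (Eventually.of_forall fun _ => ENNReal.ofReal_lt_top)]
  simp only [ENNReal.toReal_ofReal (Real.sqrt_nonneg _), smul_eq_mul]

theorem chartVolume_apply (g : Metric n M) {x : M} {S : Set M} (hS : MeasurableSet S)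
    (h : S ⊆ (extChartAt (𝓡∂ n) x).source) :
    chartVolume g x S =
      ∫⁻ y in extChartAt (𝓡∂ n) x '' S, ENNReal.ofReal (√(chartGram g x y).det) := by
  rw [(extChartAt (𝓡∂ n) x).image_eq_target_inter_inv_preimage h, inter_comm, chartVolume,
    Measure.map_apply_of_aemeasurable
      ((aemeasurable_extChartAt_symm x).mono_ac (withDensity_absolutelyContinuous _ _)) hS,
    withDensity_apply', Measure.restrict_restrict' (measurableSet_extChartAt_target x)]

theorem chartVolume_restrict_source (g : Metric n M) (x : M) :
    (chartVolume g x).restrict (extChartAt (𝓡∂ n) x).source = chartVolume g x := by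
  refine Measure.restrict_eq_self_of_ae_mem ((ae_map_iff
    ((aemeasurable_extChartAt_symm x).mono_ac (withDensity_absolutelyContinuous _ _))
    (measurableSet_extChartAt_source x)).2 ((withDensity_absolutelyContinuous _ _).ae_le ?_))
  filter_upwards [ae_restrict_mem (measurableSet_extChartAt_target x)] with y hy
  exact (extChartAt (𝓡∂ n) x).map_target hy

theorem chartVolume_apply_eq (g : Metric n M) {x x' : M} {S : Set M} (hS : MeasurableSet S)
    (h : S ⊆ (extChartAt (𝓡∂ n) x).source) (h' : S ⊆ (extChartAt (𝓡∂ n) x').source) :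
    chartVolume g x S = chartVolume g x' S := by
  rw [chartVolume_apply g hS h, chartVolume_apply g hS h']
  set e := extChartAt (𝓡∂ n) x
  set e' := extChartAt (𝓡∂ n) x'
  have himage : (e' ∘ e.symm) '' (e '' S) = e' '' S := by
    rw [image_image]
    exact image_congr fun p hp => congrArg e' (e.left_inv (h hp))
  have hinj : InjOn (e' ∘ e.symm) (e '' S) := by
    rintro _ ⟨p, hp, rfl⟩ _ ⟨q, hq, rfl⟩ hpq
    simp only [Function.comp_apply, e.left_inv (h hp), e.left_inv (h hq)] at hpq
    rw [e'.injOn (h' hp) (h' hq) hpq]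
  have hderiv : ∀ y ∈ e '' S,
      HasFDerivWithinAt (e' ∘ e.symm) (tangentCoordChange (𝓡∂ n) x x' (e.symm y)) (e '' S) y := by
    rintro _ ⟨p, hp, rfl⟩
    rw [e.left_inv (h hp)]
    exact (hasFDerivWithinAt_tangentCoordChange (I := 𝓡∂ n) ⟨h hp, h' hp⟩).mono
      ((e.mapsTo.mono_left h).image_subset.trans (extChartAt_target_subset_range x))
  rw [← himage, lintegral_image_eq_lintegral_abs_det_fderiv_mul volume
    (measurableSet_image_extChartAt hS h) hderiv hinj]
  refine setLIntegral_congr_fun (measurableSet_image_extChartAt hS h) ?_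
  rintro _ ⟨p, hp, rfl⟩
  simp only [Function.comp_apply, e.left_inv (h hp), det_tangentCoordChange]
  rw [← ENNReal.ofReal_mul (abs_nonneg _), sqrt_chartGram_det_transition g (h hp) (h' hp)]

theorem riemannianVolume_restrict_source (g : Metric n M) (x : M) :
    (riemannianVolume g).restrict (extChartAt (𝓡∂ n) x).source = chartVolume g x := by
  have hU := measurableSet_extChartAt_source (n := n) x
  set U := (extChartAt (𝓡∂ n) x).source
  have hchart (x' : M) : (chartVolume g x').restrict U ≤ chartVolume g x := by
    refine Measure.le_iff.2 fun S hS => ?_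
    rw [Measure.restrict_apply hS, ← chartVolume_restrict_source g x',
      Measure.restrict_apply (hS.inter hU), chartVolume_apply_eq g (x := x') (x' := x)
        ((hS.inter hU).inter (measurableSet_extChartAt_source x')) inter_subset_right
        (inter_subset_left.trans inter_subset_right)]
    exact measure_mono (inter_subset_left.trans inter_subset_left)
  have hsup : riemannianVolume g ≤ chartVolume g x + (riemannianVolume g).restrict Uᶜ :=
    iSup_le fun x' => by
      rw [← Measure.restrict_add_restrict_compl (μ := chartVolume g x') hU]
      exact add_le_add (hchart x') (Measure.restrict_mono le_rfl (le_iSup (chartVolume g) x'))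
  refine le_antisymm ?_ ?_
  · calc (riemannianVolume g).restrict U
        ≤ (chartVolume g x + (riemannianVolume g).restrict Uᶜ).restrict U :=
          Measure.restrict_mono le_rfl hsup
      _ = chartVolume g x := by
          rw [Measure.restrict_add, Measure.restrict_restrict hU, inter_compl_self,
            Measure.restrict_empty, add_zero, chartVolume_restrict_source]
  · rw [← chartVolume_restrict_source]
    exact Measure.restrict_mono le_rfl (le_iSup (chartVolume g) x)

instance isLocallyFiniteMeasure_riemannianVolume (g : Metric n M) :
    IsLocallyFiniteMeasure (riemannianVolume g) := by
  refine ⟨fun x => ?_⟩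
  obtain ⟨V, hV, hint⟩ := (contDiffOn_sqrt_chartGram_det g x).continuousOn.integrableAt_nhdsWithin
    (μ := volume) (measurableSet_extChartAt_target x) (mem_extChartAt_target x)
  have hpre : (extChartAt (𝓡∂ n) x).source ∩ extChartAt (𝓡∂ n) x ⁻¹' V ∈ 𝓝 x := by
    have htendsto : Tendsto (extChartAt (𝓡∂ n) x) (𝓝 x)
        (𝓝[(extChartAt (𝓡∂ n) x).target] (extChartAt (𝓡∂ n) x x)) :=
      tendsto_nhdsWithin_iff.2 ⟨continuousAt_extChartAt x, eventually_of_mem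
        (extChartAt_source_mem_nhds x) fun p hp => (extChartAt (𝓡∂ n) x).map_source hp⟩
    exact inter_mem (extChartAt_source_mem_nhds x) (htendsto hV)
  obtain ⟨U, hUV, hU, hxU⟩ := mem_nhds_iff.1 hpre
  refine ⟨U, hU.mem_nhds hxU, ?_⟩
  calc riemannianVolume g U = chartVolume g x U := by
        rw [← riemannianVolume_restrict_source g x, Measure.restrict_apply hU.measurableSet,
          inter_eq_left.2 (hUV.trans inter_subset_left)]
    _ = ∫⁻ y in extChartAt (𝓡∂ n) x '' U, ENNReal.ofReal (√(chartGram g x y).det) :=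
        chartVolume_apply g hU.measurableSet (hUV.trans inter_subset_left)
    _ ≤ ∫⁻ y in V, ENNReal.ofReal (√(chartGram g x y).det) :=
        lintegral_mono_set (image_subset_iff.2 (hUV.trans inter_subset_right))
    _ < ⊤ := hint.setLIntegral_lt_top

end Volume

section DensityRatio

variable [IsManifold (𝓡∂ n) ∞ M]

/-- The density of `dV_{g'}` with respect to `dV_g`. -/
noncomputable def volumeRatio (g g' : Metric n M) (p : M) : ℝ :=
  √((gram g' p).det / (gram g p).det)

theorem volumeRatio_eq_div (g g' : Metric n M) {x p : M}
    (hx : p ∈ (extChartAt (𝓡∂ n) x).source) :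
    volumeRatio g g' p = √(chartGram g' x (extChartAt (𝓡∂ n) x p)).det /
      √(chartGram g x (extChartAt (𝓡∂ n) x p)).det := by
  have hT : (transition n x p p).det ^ 2 ≠ 0 :=
    pow_ne_zero 2 (transition_det_ne_zero hx (mem_extChartAt_source p))
  rw [← Real.sqrt_div (chartGram_posDef g' ((extChartAt (𝓡∂ n) x).map_source hx)).det_pos.le,
    chartGram_extChartAt g hx, chartGram_extChartAt g' hx]
  simp only [Matrix.det_mul, Matrix.det_transpose, mul_right_comm _ _ (transition n x p p).det,
    ← sq]
  rw [mul_div_mul_left _ _ hT, volumeRatio]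

theorem continuous_volumeRatio (g g' : Metric n M) : Continuous (volumeRatio g g') := by
  refine continuous_iff_continuousAt.2 fun x => ?_
  have hchart : ContinuousOn (fun y => √(chartGram g' x y).det / √(chartGram g x y).det)
      (extChartAt (𝓡∂ n) x).target :=
    (contDiffOn_sqrt_chartGram_det g' x).continuousOn.div
      (contDiffOn_sqrt_chartGram_det g x).continuousOn
      fun y hy => (Real.sqrt_pos.2 (chartGram_posDef g hy).det_pos).ne'
  have hsource := extChartAt_source_mem_nhds (I := 𝓡∂ n) x
  refine ((hchart.comp (continuousOn_extChartAt x)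
    (extChartAt (𝓡∂ n) x).mapsTo).continuousAt hsource).congr ?_
  filter_upwards [hsource] with p hp
  exact (volumeRatio_eq_div g g' hp).symm

/-- The density of `e^{-η'} dV_{g'}` with respect to `e^{-η} dV_g`. -/
noncomputable def weightRatio (g g' : Metric n M) (η η' : M → ℝ) (p : M) : ℝ :=
  volumeRatio g g' p * Real.exp (η p - η' p)

theorem continuous_weightRatio (g g' : Metric n M) {η η' : M → ℝ} (hη : Continuous η)
    (hη' : Continuous η') : Continuous (weightRatio g g' η η') :=
  (continuous_volumeRatio g g').mul (Real.continuous_exp.comp (hη.sub hη'))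

theorem weightRatio_nonneg (g g' : Metric n M) (η η' : M → ℝ) (p : M) :
    0 ≤ weightRatio g g' η η' p := mul_nonneg (Real.sqrt_nonneg _) (Real.exp_pos _).le

theorem weightRatio_self (g : Metric n M) (η : M → ℝ) (p : M) : weightRatio g g η η p = 1 := by
  rw [weightRatio, volumeRatio, div_self (gram_posDef g p).det_pos.ne', Real.sqrt_one, sub_self,
    Real.exp_zero, one_mul]

variable [MeasurableSpace M] [BorelSpace M]

theorem chartVolume_withDensity_volumeRatio (g g' : Metric n M) (x : M) :
    (chartVolume g x).withDensity (fun p => ENNReal.ofReal (volumeRatio g g' p)) =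
      chartVolume g' x := by
  have hratio : Measurable fun p => ENNReal.ofReal (volumeRatio g g' p) :=
    (continuous_volumeRatio g g').measurable.ennreal_ofReal
  ext S hS
  rw [withDensity_apply _ hS, ← lintegral_indicator hS, ← lintegral_indicator_one hS,
    lintegral_chartVolume g x (hratio.indicator hS),
    lintegral_chartVolume g' x (measurable_one.indicator hS)]
  refine setLIntegral_congr_fun (measurableSet_extChartAt_target x) fun y hy => ?_
  by_cases hyS : (extChartAt (𝓡∂ n) x).symm y ∈ S
  · simp only [indicator_of_mem hyS, Pi.one_apply, mul_one]
    rw [← ENNReal.ofReal_mul (Real.sqrt_nonneg _),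
      volumeRatio_eq_div g g' ((extChartAt (𝓡∂ n) x).map_target hy),
      (extChartAt (𝓡∂ n) x).right_inv hy,
      mul_div_cancel₀ _ (Real.sqrt_pos.2 (chartGram_posDef g hy).det_pos).ne']
  · simp only [indicator_of_notMem hyS, mul_zero]

variable [CompactSpace M]

theorem riemannianVolume_withDensity_volumeRatio (g g' : Metric n M) :
    (riemannianVolume g).withDensity (fun p => ENNReal.ofReal (volumeRatio g g' p)) =
      riemannianVolume g' := by
  obtain ⟨t, ht⟩ := exists_finset_iUnion_extChartAt_source (n := n) (M := M)
  refine (Measure.ext_iff_of_biUnion_eq_univ t.countable_toSet ht).2 fun x _ => ?_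
  rw [restrict_withDensity (measurableSet_extChartAt_source x), riemannianVolume_restrict_source,
    riemannianVolume_restrict_source, chartVolume_withDensity_volumeRatio]

theorem weightedVolume_eq_withDensity (g g' : Metric n M) {η η' : M → ℝ} (hη : Continuous η)
    (hη' : Continuous η') : weightedVolume g' η' =
      (weightedVolume g η).withDensity (fun p => ENNReal.ofReal (weightRatio g g' η η' p)) := by
  have hexp {ζ : M → ℝ} (hζ : Continuous ζ) :
      Measurable fun p => ENNReal.ofReal (Real.exp (-ζ p)) :=
    (Real.continuous_exp.comp hζ.neg).measurable.ennreal_ofReal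
  unfold weightedVolume
  rw [← riemannianVolume_withDensity_volumeRatio g g',
    ← withDensity_mul _ (continuous_volumeRatio g g').measurable.ennreal_ofReal (hexp hη'),
    ← withDensity_mul _ (hexp hη) (continuous_weightRatio g g' hη hη').measurable.ennreal_ofReal]
  congr 1
  ext p
  simp only [Pi.mul_apply]
  rw [← ENNReal.ofReal_mul (show 0 ≤ volumeRatio g g' p from Real.sqrt_nonneg _),
    ← ENNReal.ofReal_mul (Real.exp_pos _).le, weightRatio, mul_left_comm,
    ← Real.exp_add, neg_add_eq_sub, sub_sub_cancel_left]

theorem integral_weightedVolume_eq (g g' : Metric n M) {η η' : M → ℝ} (hη : Continuous η)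
    (hη' : Continuous η') (f : M → ℝ) : ∫ p, f p ∂(weightedVolume g' η') =
      ∫ p, weightRatio g g' η η' p * f p ∂(weightedVolume g η) := by
  rw [weightedVolume_eq_withDensity g g' hη hη', integral_withDensity_eq_integral_toReal_smul
    (continuous_weightRatio g g' hη hη').measurable.ennreal_ofReal
    (Eventually.of_forall fun _ => ENNReal.ofReal_lt_top)]
  simp only [ENNReal.toReal_ofReal (weightRatio_nonneg _ _ _ _ _), smul_eq_mul]

end DensityRatio

section WeightedVolume

theorem integrable_of_compactSpace {X : Type*} [TopologicalSpace X] [CompactSpace X]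
    [MeasurableSpace X] [OpensMeasurableSpace X] {μ : Measure X} [IsFiniteMeasureOnCompacts μ]
    {f : X → ℝ} (hf : Continuous f) : Integrable f μ :=
  hf.integrable_of_hasCompactSupport (HasCompactSupport.of_compactSpace f)

variable [IsManifold (𝓡∂ n) ∞ M] [MeasurableSpace M] [BorelSpace M]

theorem integral_weightedVolume_eq_integral_riemannianVolume (g : Metric n M) {η : M → ℝ}
    (hη : Continuous η) (f : M → ℝ) :
    ∫ p, f p ∂(weightedVolume g η) = ∫ p, Real.exp (-η p) * f p ∂(riemannianVolume g) := by
  have hexp : Continuous fun p => Real.exp (-η p) := Real.continuous_exp.comp hη.neg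
  rw [weightedVolume, integral_withDensity_eq_integral_toReal_smul hexp.measurable.ennreal_ofReal
    (Eventually.of_forall fun _ => ENNReal.ofReal_lt_top)]
  simp only [ENNReal.toReal_ofReal (Real.exp_pos _).le, smul_eq_mul]

theorem integral_riemannianVolume_of_support_subset (g : Metric n M) {x : M} {f : M → ℝ}
    (hf : Function.support f ⊆ (extChartAt (𝓡∂ n) x).source) (hfm : Measurable f) :
    ∫ p, f p ∂(riemannianVolume g) = ∫ y in (extChartAt (𝓡∂ n) x).target,
      √(chartGram g x y).det * f ((extChartAt (𝓡∂ n) x).symm y) := by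
  rw [← setIntegral_eq_integral_of_forall_compl_eq_zero
    fun p hp => Function.notMem_support.1 fun h => hp (hf h),
    riemannianVolume_restrict_source, integral_chartVolume g x hfm]

theorem isFiniteMeasure_weightedVolume [CompactSpace M] (g : Metric n M) {η : M → ℝ}
    (hη : Continuous η) : IsFiniteMeasure (weightedVolume g η) :=
  isFiniteMeasure_withDensity_ofReal
    (integrable_of_compactSpace (Real.continuous_exp.comp hη.neg)).hasFiniteIntegral

end WeightedVolume

end RiemannianVolume

/-! ### Green's formula -/

section GreenFormula

variable {n : ℕ} [NeZero n] {M : Type*} [TopologicalSpace M]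
  [ChartedSpace (EuclideanHalfSpace n) M]

section HalfSpaceIntegral

theorem ae_coord_ne_zero : ∀ᵐ y : Model n, y 0 ≠ 0 := by
  let L : Model n →ₗ[ℝ] ℝ := (EuclideanSpace.proj (0 : Fin n) : Model n →L[ℝ] ℝ).toLinearMap
  have hker : LinearMap.ker L ≠ ⊤ := fun h => by
    have hmem : (EuclideanSpace.single 0 1 : Model n) ∈ LinearMap.ker L := h ▸ Submodule.mem_top
    simp [L] at hmem
  exact compl_mem_ae_iff.2 (Measure.addHaar_submodule volume _ hker)

theorem contDiffOn_indicator {E F : Type*} [NormedAddCommGroup E] [NormedSpace ℝ E]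
    [NormedAddCommGroup F] [NormedSpace ℝ F] {k : WithTop ℕ∞} {f : E → F} {s t K : Set E}
    (hf : ContDiffOn ℝ k f t) (ht : ∀ y ∈ t, t ∈ 𝓝[s] y) (hK : IsClosed K) (hKt : K ⊆ t)
    (hfK : ∀ y ∈ t \ K, f y = 0) : ContDiffOn ℝ k (t.indicator f) s := by
  intro y _
  by_cases hyK : y ∈ K
  · exact ((hf y (hKt hyK)).congr (fun z hz => indicator_of_mem hz f)
      (indicator_of_mem (hKt hyK) f)).mono_of_mem_nhdsWithin (ht y (hKt hyK))
  · have hzero : ∀ z ∈ Kᶜ, t.indicator f z = 0 := fun z hz =>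
      indicator_apply_eq_zero.2 fun hzt => hfK z ⟨hzt, hz⟩
    exact (contDiffWithinAt_const (c := (0 : F))).congr_of_eventuallyEq
      (mem_nhdsWithin_of_mem_nhds (mem_of_superset (hK.isOpen_compl.mem_nhds hyK) hzero))
      (hzero y hyK)

theorem halfSpaceDivergence_congr {V W : Fin n → Model n → ℝ} {y : Model n}
    (h : ∀ i, V i =ᶠ[𝓝[range (𝓡∂ n)] y] W i) (hy : ∀ i, V i y = W i y) :
    halfSpaceDivergence V y = halfSpaceDivergence W y :=
  Finset.sum_congr rfl fun i _ => by rw [(h i).fderivWithin_eq (hy i)]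

theorem halfSpaceDivergence_zero (y : Model n) :
    halfSpaceDivergence (fun _ : Fin n => fun _ => 0) y = 0 := by
  simp [halfSpaceDivergence]

theorem integral_halfSpaceDivergence_eq_zero {V : Fin n → Model n → ℝ} {R : ℝ}
    (hV : ∀ i, ContDiffOn ℝ 1 (V i) (range (𝓡∂ n)))
    (hR : ∀ i, ∀ y ∈ range (𝓡∂ n), R < ‖y‖ → V i y = 0)
    (h0 : ∀ i (y : Model n), y 0 = 0 → V i y = 0) :
    ∫ y in range (𝓡∂ n), halfSpaceDivergence V y = 0 := by
  have hrange : range (𝓡∂ n) = {y : Model n | 0 ≤ y 0} := range_modelWithCornersEuclideanHalfSpace n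
  have hclosed := (𝓡∂ n).isClosed_range
  have hpos : (range (𝓡∂ n) : Set (Model n)) =ᵐ[volume] {y : Model n | 0 < y 0} := by
    filter_upwards [ae_coord_ne_zero] with y hy
    exact propext (hrange ▸ ⟨fun h => lt_of_le_of_ne h hy.symm, le_of_lt⟩)
  have hcont : ContinuousOn (halfSpaceDivergence V) (range (𝓡∂ n)) :=
    continuousOn_finsetSum _ fun i _ =>
      ((hV i).continuousOn_fderivWithin (𝓡∂ n).uniqueDiffOn le_rfl).clm_apply continuousOn_const
  have hint : IntegrableOn (halfSpaceDivergence V) (range (𝓡∂ n)) := by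
    refine ((hcont.mono inter_subset_left).integrableOn_compact
      ((isCompact_closedBall (0 : Model n) R).inter_left hclosed)).of_forall_sdiff_eq_zero
      hclosed.measurableSet fun y hy => ?_
    have hyR : R < ‖y‖ := not_le.1 fun h => hy.2 ⟨hy.1, mem_closedBall_zero_iff.2 h⟩
    refine (halfSpaceDivergence_congr (fun i => ?_) fun i => hR i y hy.1 hyR).trans
      (halfSpaceDivergence_zero y)
    filter_upwards [self_mem_nhdsWithin, mem_nhdsWithin_of_mem_nhds
      (continuous_norm.continuousAt.eventually (lt_mem_nhds hyR))] with z hz hzR using hR i z hz hzR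
  have hflat : ∀ y ∈ {y : Model n | 0 < y 0}, halfSpaceDivergence V y = flatDivergence V y :=
    fun y hy => halfSpaceDivergence_eq_flatDivergence hy
  have hmeas : MeasurableSet {y : Model n | 0 < y 0} :=
    (isOpen_lt continuous_const (by fun_prop)).measurableSet
  rw [setIntegral_congr_set hpos, setIntegral_congr_fun hmeas hflat]
  exact integral_flatDivergence_halfSpace (fun i y hy => hR i y (hrange ▸ hy))
    (fun i => hrange ▸ (hV i).continuousOn) h0
    (fun i y hy => ((hV i).contDiffAt (range_mem_nhds_of_coord_pos hy)).differentiableAt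
      one_ne_zero)
    ((hint.congr_set_ae hpos.symm).congr_fun hflat hmeas)

end HalfSpaceIntegral

section Green

variable [IsManifold (𝓡∂ n) ∞ M] {f u : M → ℝ}

theorem setIntegral_halfSpaceDivergence_mul_chartFlux [CompactSpace M] [T2Space M]
    (g : Metric n M) (hf : ContMDiff (𝓡∂ n) 𝓘(ℝ, ℝ) ∞ f) (hu : ContMDiff (𝓡∂ n) 𝓘(ℝ, ℝ) ∞ u)
    (hu0 : ∀ p ∈ (𝓡∂ n).boundary M, u p = 0) {x : M}
    (hsupp : tsupport u ⊆ (extChartAt (𝓡∂ n) x).source) :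
    ∫ y in (extChartAt (𝓡∂ n) x).target, halfSpaceDivergence
      (fun i y => u ((extChartAt (𝓡∂ n) x).symm y) * chartFlux g f x i y) y = 0 := by
  set e := extChartAt (𝓡∂ n) x
  let W : Fin n → Model n → ℝ := fun i y => u (e.symm y) * chartFlux g f x i y
  have htarget : ∀ y ∈ e.target, e.target ∈ 𝓝[range (𝓡∂ n)] y := fun y hy =>
    extChartAt_target_mem_nhdsWithin_of_mem hy
  have hK : IsCompact (e '' tsupport u) := (isClosed_tsupport u).isCompact.image_of_continuousOn
    ((continuousOn_extChartAt x).mono hsupp)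
  have hKt : e '' tsupport u ⊆ e.target := (e.mapsTo.mono_left hsupp).image_subset
  have hWK : ∀ i, ∀ y ∈ e.target \ e '' tsupport u, W i y = 0 := fun i y hy => by
    have hy' : e.symm y ∉ tsupport u := fun h => hy.2 ⟨_, h, e.right_inv hy.1⟩
    simp only [W, image_eq_zero_of_notMem_tsupport hy', zero_mul]
  have hVK : ∀ i, ∀ y ∉ e '' tsupport u, e.target.indicator (W i) y = 0 := fun i y hy =>
    indicator_apply_eq_zero.2 fun h => hWK i y ⟨h, hy⟩
  have hV : ∀ i, ContDiffOn ℝ 1 (e.target.indicator (W i)) (range (𝓡∂ n)) := fun i =>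
    contDiffOn_indicator (((contDiffOn_comp_extChartAt_symm hu x).mul
      (contDiffOn_chartFlux g hf x i)).of_le (by simp)) htarget hK.isClosed hKt (hWK i)
  have hV0 : ∀ i (y : Model n), y 0 = 0 → e.target.indicator (W i) y = 0 := fun i y hy =>
    indicator_apply_eq_zero.2 fun h => by
      have hboundary : e.symm y ∈ (𝓡∂ n).boundary M := mem_boundary_of_coord_eq_zero (x := x)
        (e.map_target h) (by rw [e.right_inv h, hy])
      simp only [W, hu0 _ hboundary, zero_mul]
  obtain ⟨R, hR⟩ := hK.isBounded.exists_norm_le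
  have hdiv : ∀ y, halfSpaceDivergence (fun i => e.target.indicator (W i)) y =
      e.target.indicator (halfSpaceDivergence W) y := fun y => by
    by_cases hy : y ∈ e.target
    · rw [indicator_of_mem hy]
      exact halfSpaceDivergence_congr (fun i => eventually_of_mem (htarget y hy) fun z hz =>
        indicator_of_mem hz _) fun i => indicator_of_mem hy _
    · rw [indicator_of_notMem hy, ← halfSpaceDivergence_zero y]
      have hyK : y ∉ e '' tsupport u := fun h => hy (hKt h)
      exact halfSpaceDivergence_congr (fun i => mem_nhdsWithin_of_mem_nhds
        (mem_of_superset (hK.isClosed.isOpen_compl.mem_nhds hyK) (hVK i))) fun i => hVK i y hyK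
  have hzero := integral_halfSpaceDivergence_eq_zero hV
    (fun i y _ hyR => hVK i y fun h => (hR y h).not_gt hyR) hV0
  simp only [hdiv] at hzero
  rwa [setIntegral_indicator (measurableSet_extChartAt_target x),
    inter_eq_self_of_subset_right (extChartAt_target_subset_range x)] at hzero

theorem cometric_eq_zero_of_notMem_tsupport (g : Metric n M) (f : M → ℝ) {p : M}
    (hp : p ∉ tsupport u) : cometric g u f p = 0 := by
  have hu : mfderiv (𝓡∂ n) 𝓘(ℝ, ℝ) u p = 0 :=
    (notMem_tsupport_iff_eventuallyEq.1 hp).mfderiv_eq.trans mfderiv_const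
  have hdiff : diffVec (n := n) u p = 0 := by
    ext i
    simp only [diffVec, differential, hu]
    rfl
  rw [cometric, hdiff, zero_dotProduct]

theorem cometric_sum_left {ι : Type*} (g : Metric n M) (f : M → ℝ) {s : Finset ι}
    {u : ι → M → ℝ} {p : M} (hu : ∀ i ∈ s, MDifferentiableAt (𝓡∂ n) 𝓘(ℝ, ℝ) (u i) p) :
    cometric g (fun q => ∑ i ∈ s, u i q) f p = ∑ i ∈ s, cometric g (u i) f p := by
  rw [cometric, (mdifferentiableAt_and_diffVec_sum hu).2, sum_dotProduct]
  rfl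

theorem cometric_exp_neg (g : Metric n M) (f : M → ℝ) {η : M → ℝ} {p : M}
    (hη : MDifferentiableAt (𝓡∂ n) 𝓘(ℝ, ℝ) η p) :
    cometric g (fun q => Real.exp (-η q)) f p = -(Real.exp (-η p) * cometric g η f p) := by
  have h := ((Real.hasDerivAt_exp (-η p)).hasFDerivAt.hasMFDerivAt.comp p
    hη.hasMFDerivAt.neg).mfderiv
  have hdiff : diffVec (n := n) (fun q => Real.exp (-η q)) p =
      -(Real.exp (-η p) • diffVec η p) := by
    ext i
    refine (congrArg (fun L : Model n →L[ℝ] ℝ => L (EuclideanSpace.single i 1)) h).trans ?_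
    change -diffVec η p i * Real.exp (-η p) = -(Real.exp (-η p) * diffVec η p i)
    ring
  rw [cometric, hdiff, neg_dotProduct, smul_dotProduct]
  rfl

variable [CompactSpace M] [T2Space M] [MeasurableSpace M] [BorelSpace M]

theorem integral_mul_laplacian_add_cometric_of_tsupport_subset (g : Metric n M)
    (hf : ContMDiff (𝓡∂ n) 𝓘(ℝ, ℝ) ∞ f) (hu : ContMDiff (𝓡∂ n) 𝓘(ℝ, ℝ) ∞ u)
    (hu0 : ∀ p ∈ (𝓡∂ n).boundary M, u p = 0) (hΔ : Continuous (laplacian g f)) {x : M}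
    (hsupp : tsupport u ⊆ (extChartAt (𝓡∂ n) x).source) :
    ∫ p, (u p * laplacian g f p + cometric g u f p) ∂(riemannianVolume g) = 0 := by
  have hsupport : Function.support (fun p => u p * laplacian g f p + cometric g u f p) ⊆
      (extChartAt (𝓡∂ n) x).source := fun p hp => hsupp <| by_contra fun h => hp <| by
    simp only [image_eq_zero_of_notMem_tsupport h, cometric_eq_zero_of_notMem_tsupport g f h,
      zero_mul, add_zero]
  rw [integral_riemannianVolume_of_support_subset g hsupport
    ((hu.continuous.mul hΔ).add (continuous_cometric g hu hf)).measurable,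
    ← setIntegral_halfSpaceDivergence_mul_chartFlux g hf hu hu0 hsupp]
  refine setIntegral_congr_ae (measurableSet_extChartAt_target x) ?_
  filter_upwards [ae_coord_ne_zero] with y hy0 hy
  have hpos : 0 < y 0 := lt_of_le_of_ne
    ((range_modelWithCornersEuclideanHalfSpace n) ▸ extChartAt_target_subset_range x hy :) hy0.symm
  have hp := (extChartAt (𝓡∂ n) x).map_target hy
  have hright := (extChartAt (𝓡∂ n) x).right_inv hy
  have hinterior : (𝓡∂ n).IsInteriorPoint ((extChartAt (𝓡∂ n) x).symm y) :=
    (isInteriorPoint_iff_coord_pos hp).2 (by rwa [hright])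
  have hsqrt := (Real.sqrt_pos.2 (chartGram_posDef g hy).det_pos).ne'
  rw [halfSpaceDivergence_mul_chartFlux g hu hf hy, halfSpaceDivergence_eq_flatDivergence hpos,
    laplacian_eq_flatDivergence g hf hp hinterior, hright]
  field_simp

theorem integral_mul_laplacian_add_cometric (g : Metric n M)
    (hf : ContMDiff (𝓡∂ n) 𝓘(ℝ, ℝ) ∞ f) (hu : ContMDiff (𝓡∂ n) 𝓘(ℝ, ℝ) ∞ u)
    (hu0 : ∀ p ∈ (𝓡∂ n).boundary M, u p = 0) (hΔ : Continuous (laplacian g f)) :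
    ∫ p, (u p * laplacian g f p + cometric g u f p) ∂(riemannianVolume g) = 0 := by
  obtain ⟨ρ, hρ⟩ := SmoothPartitionOfUnity.exists_isSubordinate_chartAt_source (𝓡∂ n) M
  have hfin : {i | (Function.support (ρ i)).Nonempty}.Finite :=
    ρ.locallyFinite.finite_nonempty_of_compact
  have hone (q : M) : ∑ i ∈ hfin.toFinset, ρ i q = 1 := by
    rw [← ρ.sum_eq_one (mem_univ q)]
    exact (finsum_eq_sum_of_support_subset _ fun i hi => by
      simpa only [Finite.coe_toFinset] using ⟨q, hi⟩).symm
  have hρu (i : M) : ContMDiff (𝓡∂ n) 𝓘(ℝ, ℝ) ∞ fun q => ρ i q * u q := (ρ i).contMDiff.mul hu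
  have hsum (q : M) : ∑ i ∈ hfin.toFinset, ρ i q * u q = u q := by
    rw [← Finset.sum_mul, hone, one_mul]
  have hdecomp (p : M) : u p * laplacian g f p + cometric g u f p =
      ∑ i ∈ hfin.toFinset, (ρ i p * u p * laplacian g f p +
        cometric g (fun q => ρ i q * u q) f p) := by
    rw [Finset.sum_add_distrib, ← Finset.sum_mul, hsum,
      ← cometric_sum_left g f fun i _ => (hρu i).mdifferentiableAt (by simp), funext hsum]
  simp only [hdecomp]
  rw [integral_finsetSum _ fun i _ => integrable_of_compactSpace
    (((hρu i).continuous.fun_mul hΔ).fun_add (continuous_cometric g (hρu i) hf))]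
  refine Finset.sum_eq_zero fun i _ => integral_mul_laplacian_add_cometric_of_tsupport_subset g hf
    (hρu i) (fun p hp => by rw [hu0 p hp, mul_zero]) hΔ (x := i) ?_
  rw [extChartAt_source]
  exact tsupport_mul_subset_left.trans (hρ i)

theorem integral_mul_etaLaplacian (g : Metric n M) {η : M → ℝ}
    (hη : ContMDiff (𝓡∂ n) 𝓘(ℝ, ℝ) ∞ η) (hf : ContMDiff (𝓡∂ n) 𝓘(ℝ, ℝ) ∞ f)
    (hu : ContMDiff (𝓡∂ n) 𝓘(ℝ, ℝ) ∞ u) (hu0 : ∀ p ∈ (𝓡∂ n).boundary M, u p = 0)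
    (hL : Continuous (etaLaplacian g η f)) :
    ∫ p, u p * etaLaplacian g η f p ∂(weightedVolume g η) =
      -∫ p, cometric g u f p ∂(weightedVolume g η) := by
  have hexp : ContMDiff (𝓡∂ n) 𝓘(ℝ, ℝ) ∞ fun q => Real.exp (-η q) :=
    Real.contDiff_exp.contMDiff.comp hη.neg
  have hΔ : laplacian g f = fun p => etaLaplacian g η f p + cometric g η f p := funext fun p => by
    rw [etaLaplacian, inner_riemannianGradient, sub_add_cancel]
  have hmd {w : M → ℝ} (hw : ContMDiff (𝓡∂ n) 𝓘(ℝ, ℝ) ∞ w) (p : M) :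
      MDifferentiableAt (𝓡∂ n) 𝓘(ℝ, ℝ) w p := hw.mdifferentiableAt (by simp)
  have := isFiniteMeasure_weightedVolume g hη.continuous
  have hgreen := integral_mul_laplacian_add_cometric g hf (hexp.mul hu)
    (fun p hp => by simp only [Pi.mul_apply, hu0 p hp, mul_zero])
    (hΔ ▸ hL.add (continuous_cometric g hη hf))
  rw [← add_eq_zero_iff_eq_neg, ← integral_add
      (integrable_of_compactSpace (hu.continuous.fun_mul hL))
      (integrable_of_compactSpace (continuous_cometric g hu hf)),
    integral_weightedVolume_eq_integral_riemannianVolume g hη.continuous, ← hgreen]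
  refine integral_congr_ae (Eventually.of_forall fun p => ?_)
  simp only [Pi.mul_apply]
  rw [show cometric g ((fun q => Real.exp (-η q)) * u) f p = _ from
    cometric_mul_left g f (hmd hexp p) (hmd hu p), cometric_exp_neg g f (hmd hη p), hΔ]
  ring

end Green

end GreenFormula

/-! ### Variations of the metric and of the weight -/

section ParameterFamily

section Uniform

open Asymptotics

variable {X : Type*} [TopologicalSpace X]

theorem exists_eventually_forall_of_compactSpace [CompactSpace X] {ι : Type*} {l : Filter ι}
    {P : ℝ → ι → X → Prop} (hmono : ∀ ⦃a b : ℝ⦄, a ≤ b → ∀ t x, P a t x → P b t x)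
    (h : ∀ x, ∃ C, ∀ᶠ q in l ×ˢ 𝓝 x, P C q.1 q.2) : ∃ C, ∀ᶠ t in l, ∀ x, P C t x := by
  suffices ∃ C, ∀ᶠ t in l, ∀ x ∈ (univ : Set X), P C t x by simpa only [mem_univ, true_imp_iff]
  refine isCompact_univ.induction_on (p := fun S => ∃ C, ∀ᶠ t in l, ∀ x ∈ S, P C t x)
    ⟨0, by simp⟩ ?_ ?_ ?_
  · exact fun S T hST ⟨C, hC⟩ => ⟨C, hC.mono fun t ht x hx => ht x (hST hx)⟩
  · rintro S T ⟨C, hC⟩ ⟨C', hC'⟩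
    refine ⟨max C C', ?_⟩
    filter_upwards [hC, hC'] with t ht ht' x hx
    exact hx.elim (fun hx => hmono (le_max_left C C') t x (ht x hx))
      fun hx => hmono (le_max_right C C') t x (ht' x hx)
  · intro x _
    obtain ⟨C, hC⟩ := h x
    obtain ⟨p, hp, q, hq, hpq⟩ := eventually_prod_iff.1 hC
    exact ⟨{y | q y}, nhdsWithin_le_nhds hq, C, hp.mono fun t ht y hy => hpq ht hy⟩

theorem exists_eventually_forall_norm_le [CompactSpace X] {E : Type*} [Norm E]
    {f : ℝ → X → E} {t₀ : ℝ}
    (h : ∀ x, (fun q : ℝ × X => f q.1 q.2) =O[𝓝 t₀ ×ˢ 𝓝 x] fun q => q.1 - t₀) :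
    ∃ C, ∀ᶠ t in 𝓝 t₀, ∀ x, ‖f t x‖ ≤ C * |t - t₀| :=
  exists_eventually_forall_of_compactSpace (P := fun C t x => ‖f t x‖ ≤ C * |t - t₀|)
    (fun _ _ hab _ _ h => h.trans (mul_le_mul_of_nonneg_right hab (abs_nonneg _)))
    fun x => (h x).bound

variable {J : Set ℝ} {f : ℝ → X → ℝ} {s : Set X} {t₀ : ℝ} {x : X}

theorem DifferentiableFamily.differentiableAt (hf : DifferentiableFamily J f s) (ht₀ : t₀ ∈ J)
    (hx : x ∈ s) : DifferentiableAt ℝ (fun t => f t x) t₀ := by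
  obtain ⟨D, hD⟩ := hf t₀ ht₀
  exact (hasDerivAt_iff_tendsto_slope.2 (hD.tendsto_at hx)).differentiableAt

theorem DifferentiableFamily.isBigO_sub (hf : DifferentiableFamily J f s) (ht₀ : t₀ ∈ J)
    (hc : ∀ᶠ t in 𝓝 t₀, ContinuousOn (f t) s) (hx : x ∈ s) :
    (fun q : ℝ × X => f q.1 q.2 - f t₀ q.2) =O[𝓝 t₀ ×ˢ 𝓝[s] x] fun q => q.1 - t₀ := by
  obtain ⟨D, hD⟩ := hf t₀ ht₀
  have hDcont : ContinuousOn D s := by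
    refine hD.continuousOn ((hc.filter_mono nhdsWithin_le_nhds).mono fun t ht => ?_).frequently
    exact (ht.sub hc.self_of_nhds).const_smul (t - t₀)⁻¹
  have hslope : Tendsto (fun q : ℝ × X => slope (fun r => f r q.2) t₀ q.1)
      (𝓝[≠] t₀ ×ˢ 𝓝[s] x) (𝓝 (D x)) :=
    ((hDcont x hx).tendsto.comp tendsto_snd).congr_uniformity
      (tendstoLocallyUniformlyOn_iff_forall_tendsto.1 hD x hx)
  rw [← nhdsNE_sup_pure, sup_prod]
  refine IsBigO.sup ?_ ?_
  · refine ((hslope.isBigO_one ℝ).mul (isBigO_refl (fun q : ℝ × X => q.1 - t₀) _)).congr'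
      (Eventually.of_forall fun q => ?_) (Eventually.of_forall fun q => one_mul _)
    exact (mul_comm _ _).trans (sub_smul_slope (fun r => f r q.2) t₀ q.1)
  · refine IsBigO.of_bound 1 ?_
    filter_upwards [tendsto_fst.eventually (eventually_pure.2 (rfl : t₀ = t₀))] with q hq
    simp only [hq, sub_self, norm_zero, mul_zero, le_refl]

end Uniform

variable {n : ℕ} [NeZero n] {M : Type*} [TopologicalSpace M]
  [ChartedSpace (EuclideanHalfSpace n) M]

section WeightFamily

open Asymptotics

variable {J : Set ℝ} {η : ℝ → M → ℝ}

theorem contMDiff_slice (hη : ContMDiffOn (𝓘(ℝ, ℝ).prod (𝓡∂ n)) 𝓘(ℝ, ℝ) ∞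
    (fun q : ℝ × M => η q.1 q.2) (J ×ˢ univ)) {t : ℝ} (ht : t ∈ J) :
    ContMDiff (𝓡∂ n) 𝓘(ℝ, ℝ) ∞ (η t) := by
  have h : ContMDiff (𝓡∂ n) (𝓘(ℝ, ℝ).prod (𝓡∂ n)) ∞ fun p : M => (t, p) :=
    contMDiff_const.prodMk contMDiff_id
  exact contMDiffOn_univ.1 (hη.comp h.contMDiffOn fun p _ => ⟨ht, mem_univ _⟩)

theorem contMDiffAt_of_mem (hJ : IsOpen J) (hη : ContMDiffOn (𝓘(ℝ, ℝ).prod (𝓡∂ n)) 𝓘(ℝ, ℝ) ∞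
    (fun q : ℝ × M => η q.1 q.2) (J ×ˢ univ)) {t : ℝ} (ht : t ∈ J) (p : M) :
    ContMDiffAt (𝓘(ℝ, ℝ).prod (𝓡∂ n)) 𝓘(ℝ, ℝ) ∞ (fun q : ℝ × M => η q.1 q.2) (t, p) :=
  hη.contMDiffAt ((hJ.prod isOpen_univ).mem_nhds ⟨ht, mem_univ p⟩)

theorem differentiableAt_parameter (hJ : IsOpen J)
    (hη : ContMDiffOn (𝓘(ℝ, ℝ).prod (𝓡∂ n)) 𝓘(ℝ, ℝ) ∞
      (fun q : ℝ × M => η q.1 q.2) (J ×ˢ univ)) {t : ℝ} (ht : t ∈ J) (p : M) :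
    DifferentiableAt ℝ (fun s => η s p) t := by
  have h : ContMDiffAt 𝓘(ℝ, ℝ) (𝓘(ℝ, ℝ).prod (𝓡∂ n)) ∞ (fun s : ℝ => (s, p)) t :=
    contMDiffAt_id.prodMk contMDiffAt_const
  exact ((contMDiffAt_of_mem hJ hη ht p).comp t h).contDiffAt.differentiableAt (by simp)

variable [IsManifold (𝓡∂ n) ∞ M]

theorem contMDiffAt_deriv_parameter (hJ : IsOpen J)
    (hη : ContMDiffOn (𝓘(ℝ, ℝ).prod (𝓡∂ n)) 𝓘(ℝ, ℝ) ∞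
      (fun q : ℝ × M => η q.1 q.2) (J ×ˢ univ)) {t : ℝ} (ht : t ∈ J) (p : M) :
    ContMDiffAt (𝓘(ℝ, ℝ).prod (𝓡∂ n)) 𝓘(ℝ, ℝ) ∞
      (fun q : ℝ × M => deriv (fun s => η s q.2) q.1) (t, p) := by
  have hswap : ContMDiffAt ((𝓘(ℝ, ℝ).prod (𝓡∂ n)).prod 𝓘(ℝ, ℝ)) (𝓘(ℝ, ℝ).prod (𝓡∂ n)) ∞
      (fun q : (ℝ × M) × ℝ => (q.2, q.1.2)) ((t, p), t) :=
    contMDiffAt_snd.prodMk (contMDiffAt_snd.comp _ contMDiffAt_fst)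
  have huncurry : ContMDiffAt ((𝓘(ℝ, ℝ).prod (𝓡∂ n)).prod 𝓘(ℝ, ℝ)) 𝓘(ℝ, ℝ) ∞
      (Function.uncurry fun (q : ℝ × M) (s : ℝ) => η s q.2) ((t, p), t) :=
    (contMDiffAt_of_mem hJ hη ht p).comp (g := fun q : ℝ × M => η q.1 q.2) ((t, p), t) hswap
  have hmfderiv := (ContMDiffAt.mfderiv (fun (q : ℝ × M) (s : ℝ) => η s q.2) Prod.fst huncurry
    contMDiffAt_fst (m := ∞) (by simp)).clm_apply (contMDiffAt_const (c := (1 : ℝ)))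
  refine hmfderiv.congr_of_eventuallyEq (Eventually.of_forall fun q => ?_)
  have hcoord := congrFun (inTangentCoordinates_model_space (𝕜 := ℝ) (I := 𝓘(ℝ, ℝ))
    (I' := 𝓘(ℝ, ℝ)) Prod.fst (fun x : ℝ × M => η x.1 x.2)
    (fun x : ℝ × M => mfderiv 𝓘(ℝ, ℝ) 𝓘(ℝ, ℝ) (fun s => η s x.2) x.1) (t, p)) q
  exact (congrArg (fun L : ℝ →L[ℝ] ℝ => L 1) (hcoord.trans mfderiv_eq_fderiv)).symm

theorem contMDiff_weightVelocity (hJ : IsOpen J)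
    (hη : ContMDiffOn (𝓘(ℝ, ℝ).prod (𝓡∂ n)) 𝓘(ℝ, ℝ) ∞
      (fun q : ℝ × M => η q.1 q.2) (J ×ˢ univ)) (h0 : (0 : ℝ) ∈ J) :
    ContMDiff (𝓡∂ n) 𝓘(ℝ, ℝ) ∞ (weightVelocity η) := by
  intro p
  have h : ContMDiffAt (𝓡∂ n) (𝓘(ℝ, ℝ).prod (𝓡∂ n)) ∞ (fun p : M => ((0 : ℝ), p)) p :=
    contMDiffAt_const.prodMk contMDiffAt_id
  exact ContMDiffAt.comp (g := fun q : ℝ × M => deriv (fun s => η s q.2) q.1) p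
    (contMDiffAt_deriv_parameter hJ hη h0 p) h

theorem isBigO_weight_sub (hJ : IsOpen J)
    (hη : ContMDiffOn (𝓘(ℝ, ℝ).prod (𝓡∂ n)) 𝓘(ℝ, ℝ) ∞
      (fun q : ℝ × M => η q.1 q.2) (J ×ˢ univ)) {t₀ : ℝ} (ht₀ : t₀ ∈ J) (x : M) :
    (fun q : ℝ × M => η q.1 q.2 - η t₀ q.2) =O[𝓝 t₀ ×ˢ 𝓝 x] fun q => q.1 - t₀ := by
  obtain ⟨C, hC⟩ := exists_gt ‖deriv (fun s => η s x) t₀‖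
  have hderiv := (contMDiffAt_deriv_parameter hJ hη ht₀ x).continuousAt.norm.eventually
    (gt_mem_nhds hC)
  have hmem : ∀ᶠ q : ℝ × M in 𝓝 (t₀, x), q.1 ∈ J :=
    continuousAt_fst.eventually (hJ.mem_nhds ht₀)
  rw [nhds_prod_eq] at hderiv hmem
  obtain ⟨P, hP, Q, hQ, hPQ⟩ := eventually_prod_iff.1 (hderiv.and hmem)
  obtain ⟨r, hr, hrP⟩ := Metric.eventually_nhds_iff_ball.1 hP
  refine IsBigO.of_bound C ?_
  filter_upwards [prod_mem_prod (Metric.ball_mem_nhds t₀ hr) hQ] with q hq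
  exact (convex_ball t₀ r).norm_image_sub_le_of_norm_deriv_le (f := fun s => η s q.2)
    (fun s hs => differentiableAt_parameter hJ hη (hPQ (hrP s hs) hq.2).2 q.2)
    (fun s hs => (hPQ (hrP s hs) hq.2).1.le) (Metric.mem_ball_self hr) hq.1

end WeightFamily

end ParameterFamily

section FirstVariation

variable {n : ℕ} [NeZero n] {M : Type*} [TopologicalSpace M]
  [ChartedSpace (EuclideanHalfSpace n) M] [IsManifold (𝓡∂ n) ∞ M]

section TensorInner

theorem tensorInner_eq_trace (g : Metric n M) (p : M)
    (T S : TangentSpace (𝓡∂ n) p → TangentSpace (𝓡∂ n) p → ℝ) :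
    tensorInner g p T S = (Matrix.of (fun i j => T (frame p i) (frame p j)) * (gram g p)⁻¹ *
      (Matrix.of fun i j => S (frame p i) (frame p j))ᵀ * (gram g p)⁻¹).trace := by
  have hsymm (i k : Fin n) : (gram g p)⁻¹ i k = (gram g p)⁻¹ k i := by
    conv_lhs => rw [← transpose_gram, ← Matrix.transpose_nonsing_inv, Matrix.transpose_apply]
  simp only [tensorInner, Matrix.trace, Matrix.diag, Matrix.mul_apply, Matrix.transpose_apply,
    Matrix.of_apply, Finset.sum_mul]
  refine Finset.sum_congr rfl fun i _ => ?_
  rw [Finset.sum_comm]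
  refine Finset.sum_congr rfl fun k _ => ?_
  rw [Finset.sum_comm]
  refine Finset.sum_congr rfl fun l _ => Finset.sum_congr rfl fun j _ => ?_
  rw [hsymm i k]
  ring

end TensorInner

section Velocity

/-- The matrix of the velocity `H` of a family of metrics in the basis `frame p`. -/
noncomputable def velocityGram (g : ℝ → Metric n M) (p : M) : Matrix (Fin n) (Fin n) ℝ :=
  Matrix.of fun i j => metricVelocity g p (frame p i) (frame p j)

/-- The trace `⟨g, H⟩` of the velocity `H` of a family of metrics. -/
noncomputable def velocityTrace (g : ℝ → Metric n M) (p : M) : ℝ :=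
  ((gram (g 0) p)⁻¹ * velocityGram g p).trace

/-- The value `H(∇u, ∇v)` of the velocity `H` of a family of metrics at two gradients. -/
noncomputable def velocityForm (g : ℝ → Metric n M) (u v : M → ℝ) (p : M) : ℝ :=
  diffVec u p ⬝ᵥ ((gram (g 0) p)⁻¹ * velocityGram g p * (gram (g 0) p)⁻¹) *ᵥ diffVec v p

/-- The derivative at `t = 0` of the density of `dm_t` with respect to `dm_0`. -/
noncomputable def ratioVelocity (g : ℝ → Metric n M) (η : ℝ → M → ℝ) (p : M) : ℝ :=
  velocityTrace g p / 2 - weightVelocity η p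

theorem transpose_velocityGram (g : ℝ → Metric n M) (p : M) :
    (velocityGram g p)ᵀ = velocityGram g p := by
  ext i j
  simp only [velocityGram, Matrix.transpose_apply, Matrix.of_apply, metricVelocity,
    (g _).symm p (frame p j) (frame p i)]

theorem tensorInner_metricVelocity (g : ℝ → Metric n M) (c : ℝ) (u v : M → ℝ) (p : M) :
    tensorInner (g 0) p
      (fun a b => c * (g 0).inner p a b - 2 * (differential u p a * differential v p b))
      (metricVelocity g p) = c * velocityTrace g p - 2 * velocityForm g u v p := by
  have hT : Matrix.of (fun i j => c * (g 0).inner p (frame p i) (frame p j) -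
      2 * (differential u p (frame p i) * differential v p (frame p j))) =
      c • gram (g 0) p - (2 : ℝ) • Matrix.vecMulVec (diffVec u p) (diffVec v p) := rfl
  have hS : (Matrix.of fun i j => metricVelocity g p (frame p i) (frame p j))ᵀ =
      velocityGram g p := transpose_velocityGram g p
  have hsymm : ((gram (g 0) p)⁻¹ * velocityGram g p * (gram (g 0) p)⁻¹)ᵀ =
      (gram (g 0) p)⁻¹ * velocityGram g p * (gram (g 0) p)⁻¹ := by
    rw [Matrix.transpose_mul, Matrix.transpose_mul, Matrix.transpose_nonsing_inv, transpose_gram,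
      transpose_velocityGram, Matrix.mul_assoc]
  have hform : (Matrix.vecMulVec (diffVec u p) (diffVec v p) * (gram (g 0) p)⁻¹ *
      velocityGram g p * (gram (g 0) p)⁻¹).trace = velocityForm g u v p := by
    rw [Matrix.mul_assoc, Matrix.mul_assoc, ← Matrix.mul_assoc (gram (g 0) p)⁻¹,
      Matrix.vecMulVec_mul, Matrix.trace_vecMulVec, ← hsymm, Matrix.vecMul_transpose, velocityForm]
  rw [tensorInner_eq_trace, hT, hS, Matrix.sub_mul, Matrix.sub_mul, Matrix.sub_mul,
    Matrix.trace_sub, Matrix.smul_mul, Matrix.smul_mul, Matrix.smul_mul, Matrix.smul_mul,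
    Matrix.smul_mul, Matrix.smul_mul, Matrix.trace_smul, Matrix.trace_smul, hform,
    Matrix.mul_nonsing_inv _ (gram_posDef (g 0) p).det_pos.ne'.isUnit, Matrix.one_mul,
    Matrix.trace_mul_comm, velocityTrace, smul_eq_mul, smul_eq_mul]

variable {J : Set ℝ} {g : ℝ → Metric n M} {η : ℝ → M → ℝ}

theorem hasDerivAt_gram (hg : DifferentiableVariation J g) (h0 : (0 : ℝ) ∈ J) (p : M)
    (i j : Fin n) : HasDerivAt (fun t => gram (g t) p i j) (velocityGram g p i j) 0 := by
  have hp := mem_extChartAt_source (I := 𝓡∂ n) p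
  have hchart (t : ℝ) : chartGram (g t) p (extChartAt (𝓡∂ n) p p) = gram (g t) p := by
    rw [chartGram_extChartAt (g t) hp, transition_self hp, Matrix.transpose_one, Matrix.one_mul,
      Matrix.mul_one]
  have hdiff := (hg p i j).differentiableAt h0 (mem_extChartAt_target p)
  simp only [hchart] at hdiff
  exact hdiff.hasDerivAt

theorem hasDerivAt_weightRatio (hg : DifferentiableVariation J g) (h0 : (0 : ℝ) ∈ J) {p : M}
    (hη : DifferentiableAt ℝ (fun t => η t p) 0) :
    HasDerivAt (fun t => weightRatio (g 0) (g t) (η 0) (η t) p) (ratioVelocity g η p) 0 := by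
  have hdet := (gram_posDef (g 0) p).det_pos.ne'
  have hvolume : HasDerivAt (fun t => volumeRatio (g 0) (g t) p) (velocityTrace g p / 2) 0 := by
    refine (((hasDerivAt_det_of_ne_zero (hasDerivAt_gram hg h0 p) hdet).div_const
      (gram (g 0) p).det).sqrt (by simp [div_self hdet])).congr_deriv ?_
    rw [mul_div_cancel_left₀ _ hdet, div_self hdet, Real.sqrt_one, mul_one, velocityTrace]
  refine (hvolume.fun_mul (hη.hasDerivAt.const_sub (η 0 p)).exp).congr_deriv ?_
  rw [sub_self, Real.exp_zero, volumeRatio, div_self hdet, Real.sqrt_one, ratioVelocity,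
    weightVelocity]
  ring

theorem hasDerivAt_cometric (hg : DifferentiableVariation J g) (h0 : (0 : ℝ) ∈ J) (u v : M → ℝ)
    (p : M) : HasDerivAt (fun t => cometric (g t) u v p) (-velocityForm g u v p) 0 := by
  have h : HasDerivAt (fun t => ∑ i, diffVec (n := n) u p i * ∑ j, (gram (g t) p)⁻¹ i j *
      diffVec v p j) (∑ i, diffVec (n := n) u p i * ∑ j, (-((gram (g 0) p)⁻¹ * velocityGram g p *
        (gram (g 0) p)⁻¹) i j) * diffVec v p j) 0 :=
    HasDerivAt.fun_sum fun i _ => (HasDerivAt.fun_sum fun j _ => (hasDerivAt_inv_apply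
      (hasDerivAt_gram hg h0 p) (gram_posDef (g 0) p).det_pos.ne' i j).mul_const _).const_mul _
  refine h.congr_deriv ?_
  simp only [velocityForm, dotProduct, Matrix.mulVec, neg_mul, mul_neg, Finset.sum_neg_distrib]

theorem hasDerivAt_weightRatio_mul_cometric (hg : DifferentiableVariation J g) (h0 : (0 : ℝ) ∈ J)
    {p : M} (hη : DifferentiableAt ℝ (fun t => η t p) 0) (u v : M → ℝ) :
    HasDerivAt (fun t => weightRatio (g 0) (g t) (η 0) (η t) p * cometric (g t) u v p)
      (ratioVelocity g η p * cometric (g 0) u v p - velocityForm g u v p) 0 := by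
  refine ((hasDerivAt_weightRatio hg h0 hη).mul (hasDerivAt_cometric hg h0 u v p)).congr_deriv ?_
  rw [weightRatio_self, one_mul, sub_eq_add_neg]

end Velocity

end FirstVariation

section DensityEstimate

section QuadraticForm

variable {ι : Type*} [Fintype ι]

theorem sq_dotProduct_mulVec_le {B : Matrix ι ι ℝ} (hB : B.PosSemidef) (x y : ι → ℝ) :
    (x ⬝ᵥ B *ᵥ y) ^ 2 ≤ (x ⬝ᵥ B *ᵥ x) * (y ⬝ᵥ B *ᵥ y) := by
  classical
  have hsymm : (Matrix.toLinearMap₂' ℝ B).IsSymm := by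
    refine ⟨fun x y => ?_⟩
    simp only [Matrix.toLinearMap₂'_apply', RingHom.id_apply]
    rw [dotProduct_comm, ← Matrix.vecMul_transpose, ← Matrix.dotProduct_mulVec,
      ← Matrix.conjTranspose_eq_transpose_of_trivial, hB.isHermitian.eq]
  have hnonneg (x : ι → ℝ) : 0 ≤ Matrix.toLinearMap₂' ℝ B x x := by
    simpa only [Matrix.toLinearMap₂'_apply', star_trivial] using hB.dotProduct_mulVec_nonneg x
  simpa only [Matrix.toLinearMap₂'_apply'] using
    LinearMap.BilinForm.apply_sq_le_of_symm (Matrix.toLinearMap₂' ℝ B) hnonneg hsymm x y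

theorem abs_apply_le_sqrt_mul_sqrt [DecidableEq ι] {A : Matrix ι ι ℝ} (hA : A.PosDef)
    (a : ι → ℝ) (i : ι) : |a i| ≤ √(A i i) * √(a ⬝ᵥ A⁻¹ *ᵥ a) := by
  have hinv : A⁻¹ *ᵥ A *ᵥ Pi.single i 1 = Pi.single i 1 := by
    rw [Matrix.mulVec_mulVec, Matrix.nonsing_inv_mul _ hA.det_pos.ne'.isUnit, Matrix.one_mulVec]
  have hsq := sq_dotProduct_mulVec_le hA.inv.posSemidef a (A *ᵥ Pi.single i 1)
  rw [hinv, dotProduct_single_one, dotProduct_single_one, Matrix.mulVec_single_one, mul_comm] at hsq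
  rw [← Real.sqrt_mul hA.posSemidef.diag_nonneg]
  exact Real.abs_le_sqrt hsq

theorem abs_dotProduct_mulVec_le [DecidableEq ι] {A : Matrix ι ι ℝ} (hA : A.PosDef)
    (N : Matrix ι ι ℝ) (a b : ι → ℝ) : |a ⬝ᵥ N *ᵥ b| ≤
      (∑ i, ∑ j, √(A i i) * √(A j j) * |N i j|) * (√(a ⬝ᵥ A⁻¹ *ᵥ a) * √(b ⬝ᵥ A⁻¹ *ᵥ b)) := by
  have ha := abs_apply_le_sqrt_mul_sqrt hA a
  have hb := abs_apply_le_sqrt_mul_sqrt hA b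
  generalize √(a ⬝ᵥ A⁻¹ *ᵥ a) = α at ha ⊢
  generalize √(b ⬝ᵥ A⁻¹ *ᵥ b) = β at hb ⊢
  simp only [dotProduct, Matrix.mulVec, Finset.mul_sum, Finset.sum_mul]
  refine (Finset.abs_sum_le_sum_abs _ _).trans (Finset.sum_le_sum fun i _ =>
    (Finset.abs_sum_le_sum_abs _ _).trans (Finset.sum_le_sum fun j _ => ?_))
  calc |a i * (N i j * b j)|
    _ = |a i| * |b j| * |N i j| := by rw [abs_mul, abs_mul]; ring
    _ ≤ √(A i i) * α * (√(A j j) * β) * |N i j| := mul_le_mul_of_nonneg_right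
      (mul_le_mul (ha i) (hb j) (abs_nonneg _) ((abs_nonneg _).trans (ha i))) (abs_nonneg _)
    _ = √(A i i) * √(A j j) * |N i j| * (α * β) := by ring

end QuadraticForm

open Asymptotics

theorem isBigO_sub_diagonal {E F α : Type*} [NormedAddCommGroup E] [NormedSpace ℝ E]
    [NormedAddCommGroup F] [NormedSpace ℝ F] {Ψ : E × E → F} {c : E} {l : Filter α} {z w : α → E}
    (hΨ : ContDiffAt ℝ 1 Ψ (c, c)) (hz : Tendsto z l (𝓝 c)) (hw : Tendsto w l (𝓝 c)) :
    (fun q => Ψ (z q, w q) - Ψ (w q, w q)) =O[l] fun q => z q - w q := by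
  have hpair : Tendsto (fun q => ((z q, w q), (w q, w q))) l (𝓝 ((c, c), (c, c))) :=
    (hz.prodMk_nhds hw).prodMk_nhds (hw.prodMk_nhds hw)
  refine ((hΨ.hasStrictFDerivAt one_ne_zero).isBigO_sub.comp_tendsto hpair).trans
    (IsBigO.of_bound 1 (Eventually.of_forall fun q => ?_))
  simp [Prod.norm_def]

section Pair

variable {n : ℕ}

/-- A pair of a matrix and a number, standing for the components of a metric in a chart and the
value of a weight at a point. -/
abbrev GramWeight (n : ℕ) : Type := (Fin n → Fin n → ℝ) × ℝ

/-- The ratio of `e^{-s} √det A` to `e^{-s'} √det A'`, for `z = ((A, s), (A', s'))`. -/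
noncomputable def gramWeightRatio (z : GramWeight n × GramWeight n) : ℝ :=
  √(Matrix.of z.1.1).det / √(Matrix.of z.2.1).det * Real.exp (z.2.2 - z.1.2)

theorem gramWeightRatio_self {z : GramWeight n} (hz : 0 < (Matrix.of z.1).det) :
    gramWeightRatio (z, z) = 1 := by
  rw [gramWeightRatio, div_self (Real.sqrt_pos.2 hz).ne', sub_self, Real.exp_zero, one_mul]

theorem contDiffAt_gramWeightRatio {z : GramWeight n} (hz : 0 < (Matrix.of z.1).det) :
    ContDiffAt ℝ 1 gramWeightRatio (z, z) :=
  (((contDiff_det.contDiffAt.comp (z, z) (contDiffAt_fst.fst)).sqrt hz.ne').div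
    ((contDiff_det.contDiffAt.comp (z, z) (contDiffAt_snd.fst)).sqrt hz.ne')
    (Real.sqrt_pos.2 hz).ne').mul
    (contDiffAt_snd.snd.sub contDiffAt_fst.snd).exp

theorem contDiffAt_gramWeightRatio_mul_inv {z : GramWeight n} (hz : 0 < (Matrix.of z.1).det)
    (i j : Fin n) : ContDiffAt ℝ 1
      (fun z : GramWeight n × GramWeight n => gramWeightRatio z * (Matrix.of z.1.1)⁻¹ i j)
      (z, z) := by
  refine (contDiffAt_gramWeightRatio hz).mul ?_
  rw [← contDiffWithinAt_univ]
  refine contDiffWithinAt_inv_apply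
    (A := fun z : GramWeight n × GramWeight n => Matrix.of z.1.1) (fun a b => ?_) hz.ne' i j
  exact (contDiff_apply_apply ℝ ℝ a b).contDiffAt.comp_contDiffWithinAt _
    contDiffWithinAt_fst.fst

end Pair

variable {n : ℕ} [NeZero n] {M : Type*} [TopologicalSpace M]
  [ChartedSpace (EuclideanHalfSpace n) M] [IsManifold (𝓡∂ n) ∞ M]

/-- The hypotheses on the variation `g(t)`, `η(t)`, `t ∈ J`, of the metric and of the weight. -/
structure IsVariation (J : Set ℝ) (g : ℝ → Metric n M) (η : ℝ → M → ℝ) : Prop where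
  isOpen : IsOpen J
  zero_mem : (0 : ℝ) ∈ J
  metric : DifferentiableVariation J g
  weight : ContMDiffOn (𝓘(ℝ, ℝ).prod (𝓡∂ n)) 𝓘(ℝ, ℝ) ∞ (fun q : ℝ × M => η q.1 q.2) (J ×ˢ univ)

section LocalEstimate

/-- The components of `g` in the chart at `x` and the value of `η`, at a point `p`. -/
noncomputable def chartGramWeight (g : Metric n M) (η : M → ℝ) (x p : M) : GramWeight n :=
  (chartGram g x (extChartAt (𝓡∂ n) x p), η p)

theorem weightRatio_eq_gramWeightRatio (g g' : Metric n M) (η η' : M → ℝ) {x p : M}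
    (hx : p ∈ (extChartAt (𝓡∂ n) x).source) : weightRatio g g' η η' p =
      gramWeightRatio (chartGramWeight g' η' x p, chartGramWeight g η x p) := by
  rw [weightRatio, volumeRatio_eq_div g g' hx]
  rfl

variable {J : Set ℝ} {g : ℝ → Metric n M} {η : ℝ → M → ℝ}

theorem isBigO_chartGramWeight_sub (h : IsVariation J g η) (x : M) :
    (fun q : ℝ × M => chartGramWeight (g q.1) (η q.1) x q.2 - chartGramWeight (g 0) (η 0) x q.2)
      =O[𝓝 0 ×ˢ 𝓝 x] fun q => q.1 := by
  have hchart : Tendsto (Prod.map id (extChartAt (𝓡∂ n) x)) (𝓝 (0 : ℝ) ×ˢ 𝓝 x)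
      (𝓝 0 ×ˢ 𝓝[(extChartAt (𝓡∂ n) x).target] (extChartAt (𝓡∂ n) x x)) :=
    tendsto_id.prodMap (tendsto_nhdsWithin_iff.2 ⟨continuousAt_extChartAt x,
      (eventually_mem_set.2 (extChartAt_source_mem_nhds x)).mono
        fun p hp => (extChartAt (𝓡∂ n) x).map_source hp⟩)
  suffices hzero : (fun q : ℝ × M => chartGramWeight (g q.1) (η q.1) x q.2 -
      chartGramWeight (g 0) (η 0) x q.2) =O[𝓝 0 ×ˢ 𝓝 x] fun q => q.1 - 0 by
    simpa only [sub_zero] using hzero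
  refine IsBigO.prod_left (isBigO_pi.2 fun i => isBigO_pi.2 fun j => ?_)
    (isBigO_weight_sub h.isOpen h.weight h.zero_mem x)
  exact ((h.metric x i j).isBigO_sub h.zero_mem
    (Eventually.of_forall fun t => (contDiffOn_chartGram (g t) x i j).continuousOn)
    (mem_extChartAt_target x)).comp_tendsto hchart

theorem continuousAt_chartGramWeight (g : Metric n M) {η : M → ℝ} {x : M}
    (hη : ContinuousAt η x) : ContinuousAt (chartGramWeight g η x) x := by
  refine ContinuousAt.prodMk (continuousAt_pi.2 fun i => continuousAt_pi.2 fun j => ?_) hη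
  exact ((contDiffOn_chartGram g x i j).continuousOn.comp (continuousOn_extChartAt x)
    (extChartAt (𝓡∂ n) x).mapsTo).continuousAt (extChartAt_source_mem_nhds x)

theorem isBigO_comp_chartGramWeight_sub (h : IsVariation J g η) {x : M}
    {Ψ : GramWeight n × GramWeight n → ℝ}
    (hΨ : ContDiffAt ℝ 1 Ψ (chartGramWeight (g 0) (η 0) x x, chartGramWeight (g 0) (η 0) x x)) :
    (fun q : ℝ × M =>
        Ψ (chartGramWeight (g q.1) (η q.1) x q.2, chartGramWeight (g 0) (η 0) x q.2) -
          Ψ (chartGramWeight (g 0) (η 0) x q.2, chartGramWeight (g 0) (η 0) x q.2))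
      =O[𝓝 0 ×ˢ 𝓝 x] fun q => q.1 := by
  have hsub := isBigO_chartGramWeight_sub h x
  have hfst : Tendsto (fun q : ℝ × M => q.1) (𝓝 0 ×ˢ 𝓝 x) (𝓝 0) := tendsto_fst
  have hbase : Tendsto (fun q : ℝ × M => chartGramWeight (g 0) (η 0) x q.2) (𝓝 0 ×ˢ 𝓝 x)
      (𝓝 (chartGramWeight (g 0) (η 0) x x)) :=
    (continuousAt_chartGramWeight (g 0)
      (contMDiff_slice h.weight h.zero_mem).continuous.continuousAt).tendsto.comp tendsto_snd
  have hmoving : Tendsto (fun q : ℝ × M => chartGramWeight (g q.1) (η q.1) x q.2)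
      (𝓝 0 ×ˢ 𝓝 x) (𝓝 (chartGramWeight (g 0) (η 0) x x)) := by
    simpa only [sub_add_cancel, zero_add] using (hsub.trans_tendsto hfst).add hbase
  exact (isBigO_sub_diagonal hΨ hmoving hbase).trans hsub

theorem isBigO_weightRatio_sub_one (h : IsVariation J g η) (x : M) :
    (fun q : ℝ × M => weightRatio (g 0) (g q.1) (η 0) (η q.1) q.2 - 1)
      =O[𝓝 0 ×ˢ 𝓝 x] fun q => q.1 := by
  refine (isBigO_comp_chartGramWeight_sub h (contDiffAt_gramWeightRatio
    (chartGram_posDef (g 0) (mem_extChartAt_target x)).det_pos)).congr' ?_ .rfl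
  filter_upwards [tendsto_snd.eventually (extChartAt_source_mem_nhds (I := 𝓡∂ n) x)] with q hq
  rw [weightRatio_eq_gramWeightRatio _ _ _ _ hq, gramWeightRatio_self]
  exact (chartGram_posDef (g 0) ((extChartAt (𝓡∂ n) x).map_source hq)).det_pos

theorem isBigO_weightRatio_mul_inv_sub (h : IsVariation J g η) (x : M) (i j : Fin n) :
    (fun q : ℝ × M => (weightRatio (g 0) (g q.1) (η 0) (η q.1) q.2 •
        (chartGram (g q.1) x (extChartAt (𝓡∂ n) x q.2))⁻¹ -
          (chartGram (g 0) x (extChartAt (𝓡∂ n) x q.2))⁻¹) i j)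
      =O[𝓝 0 ×ˢ 𝓝 x] fun q => q.1 := by
  refine (isBigO_comp_chartGramWeight_sub h (contDiffAt_gramWeightRatio_mul_inv
    (z := chartGramWeight (g 0) (η 0) x x)
    (chartGram_posDef (g 0) (mem_extChartAt_target x)).det_pos i j)).congr' ?_ .rfl
  filter_upwards [tendsto_snd.eventually (extChartAt_source_mem_nhds (I := 𝓡∂ n) x)] with q hq
  rw [weightRatio_eq_gramWeightRatio _ _ _ _ hq, gramWeightRatio_self, one_mul]
  · rfl
  · exact (chartGram_posDef (g 0) ((extChartAt (𝓡∂ n) x).map_source hq)).det_pos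

theorem cometric_self_nonneg (g : Metric n M) (u : M → ℝ) (p : M) : 0 ≤ cometric g u u p := by
  simpa only [star_trivial, cometric] using
    (gram_posDef g p).inv.posSemidef.dotProduct_mulVec_nonneg (diffVec u p)

theorem abs_weightRatio_mul_cometric_sub_le (g g' : Metric n M) (η η' : M → ℝ) {x p : M}
    (hx : p ∈ (extChartAt (𝓡∂ n) x).source) {u v : M → ℝ}
    (hu : MDifferentiableAt (𝓡∂ n) 𝓘(ℝ, ℝ) u p) (hv : MDifferentiableAt (𝓡∂ n) 𝓘(ℝ, ℝ) v p) :
    |weightRatio g g' η η' p * cometric g' u v p - cometric g u v p| ≤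
      (∑ i, ∑ j, √(chartGram g x (extChartAt (𝓡∂ n) x p) i i) *
        √(chartGram g x (extChartAt (𝓡∂ n) x p) j j) * |(weightRatio g g' η η' p •
          (chartGram g' x (extChartAt (𝓡∂ n) x p))⁻¹ -
            (chartGram g x (extChartAt (𝓡∂ n) x p))⁻¹) i j|) *
        (√(cometric g u u p) * √(cometric g v v p)) := by
  have h := abs_dotProduct_mulVec_le (chartGram_posDef g ((extChartAt (𝓡∂ n) x).map_source hx))
    (weightRatio g g' η η' p • (chartGram g' x (extChartAt (𝓡∂ n) x p))⁻¹ -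
      (chartGram g x (extChartAt (𝓡∂ n) x p))⁻¹) (chartDiff u x (extChartAt (𝓡∂ n) x p))
    (chartDiff v x (extChartAt (𝓡∂ n) x p))
  simp only [Matrix.sub_mulVec, Matrix.smul_mulVec, dotProduct_sub, dotProduct_smul,
    smul_eq_mul] at h
  simpa only [cometric_eq_chartDiff_dotProduct _ hx, hu, hv, chartGradient] using h

theorem isBigO_sum_sqrt_chartGram (h : IsVariation J g η) (x : M) :
    (fun q : ℝ × M => ∑ i, ∑ j, √(chartGram (g 0) x (extChartAt (𝓡∂ n) x q.2) i i) *
        √(chartGram (g 0) x (extChartAt (𝓡∂ n) x q.2) j j) *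
        |(weightRatio (g 0) (g q.1) (η 0) (η q.1) q.2 •
          (chartGram (g q.1) x (extChartAt (𝓡∂ n) x q.2))⁻¹ -
            (chartGram (g 0) x (extChartAt (𝓡∂ n) x q.2))⁻¹) i j|)
      =O[𝓝 0 ×ˢ 𝓝 x] fun q => q.1 := by
  have hsqrt (i : Fin n) : (fun q : ℝ × M => √(chartGram (g 0) x (extChartAt (𝓡∂ n) x q.2) i i))
      =O[𝓝 0 ×ˢ 𝓝 x] fun _ => (1 : ℝ) :=
    ((((contDiffOn_chartGram (g 0) x i i).continuousOn.comp (continuousOn_extChartAt x)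
      (extChartAt (𝓡∂ n) x).mapsTo).continuousAt (extChartAt_source_mem_nhds x)).sqrt.tendsto.comp
        tendsto_snd).isBigO_one ℝ
  refine IsBigO.fun_sum fun i _ => IsBigO.fun_sum fun j _ => ?_
  simpa only [one_mul] using
    ((hsqrt i).mul (hsqrt j)).mul (isBigO_weightRatio_mul_inv_sub h x i j).abs_left

end LocalEstimate

section UniformEstimate

variable [CompactSpace M] {J : Set ℝ} {g : ℝ → Metric n M} {η : ℝ → M → ℝ}

theorem exists_eventually_abs_weightRatio_sub_one_le (h : IsVariation J g η) :
    ∃ C, ∀ᶠ t in 𝓝 0, ∀ p, |weightRatio (g 0) (g t) (η 0) (η t) p - 1| ≤ C * |t| := by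
  simpa only [sub_zero, Real.norm_eq_abs] using exists_eventually_forall_norm_le (t₀ := 0)
    (f := fun t p => weightRatio (g 0) (g t) (η 0) (η t) p - 1)
    fun x => by simpa only [sub_zero] using isBigO_weightRatio_sub_one h x

theorem exists_eventually_abs_weightRatio_mul_cometric_sub_le (h : IsVariation J g η) :
    ∃ C, ∀ᶠ t in 𝓝 0, ∀ p, ∀ u v : M → ℝ, MDifferentiableAt (𝓡∂ n) 𝓘(ℝ, ℝ) u p →
      MDifferentiableAt (𝓡∂ n) 𝓘(ℝ, ℝ) v p →
      |weightRatio (g 0) (g t) (η 0) (η t) p * cometric (g t) u v p - cometric (g 0) u v p| ≤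
        C * |t| * (√(cometric (g 0) u u p) * √(cometric (g 0) v v p)) := by
  refine exists_eventually_forall_of_compactSpace (fun a b hab t p hp u v hu hv =>
    (hp u v hu hv).trans (by gcongr)) fun x => ?_
  obtain ⟨C, hC⟩ := (isBigO_sum_sqrt_chartGram h x).bound
  refine ⟨C, ?_⟩
  filter_upwards [hC, tendsto_snd.eventually (extChartAt_source_mem_nhds (I := 𝓡∂ n) x)]
    with q hq hx u v hu hv
  refine (abs_weightRatio_mul_cometric_sub_le _ _ _ _ hx hu hv).trans
    (mul_le_mul_of_nonneg_right ?_ (by positivity))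
  exact (Real.le_norm_self _).trans hq

end UniformEstimate

end DensityEstimate

/-! ### The Dirichlet form and the variation of the eigenvalues -/

section DirichletEnergy

section ParametricIntegral

variable {α : Type*} [MeasurableSpace α] {μ : Measure α} {F : ℝ → α → ℝ} {F' bound : α → ℝ}
  {t₀ : ℝ}

theorem aestronglyMeasurable_deriv_of_hasDerivAt
    (hF : ∀ᶠ t in 𝓝 t₀, AEStronglyMeasurable (F t) μ)
    (hF' : ∀ᵐ a ∂μ, HasDerivAt (F · a) (F' a) t₀) : AEStronglyMeasurable F' μ := by
  obtain ⟨x, hx⟩ := exists_seq_tendsto (𝓝[≠] t₀)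
  obtain ⟨N, hN⟩ := eventually_atTop.1 (hx.eventually (hF.filter_mono nhdsWithin_le_nhds))
  refine aestronglyMeasurable_of_tendsto_ae atTop
    (f := fun k a => slope (F · a) t₀ (x (k + N)))
    (fun k => AEStronglyMeasurable.const_smul
      ((hN (k + N) (Nat.le_add_left N k)).sub hF.self_of_nhds) (x (k + N) - t₀)⁻¹) ?_
  filter_upwards [hF'] with a ha
  exact (hasDerivAt_iff_tendsto_slope.1 ha).comp (hx.comp (tendsto_add_atTop_nat N))

theorem hasDerivAt_integral_of_abs_sub_le (hF : ∀ᶠ t in 𝓝 t₀, AEStronglyMeasurable (F t) μ)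
    (hF₀ : Integrable (F t₀) μ) (hbound : Integrable bound μ)
    (hle : ∀ᶠ t in 𝓝 t₀, ∀ a, |F t a - F t₀ a| ≤ bound a * |t - t₀|)
    (hF' : ∀ a, HasDerivAt (F · a) (F' a) t₀) :
    Integrable F' μ ∧ HasDerivAt (fun t => ∫ a, F t a ∂μ) (∫ a, F' a ∂μ) t₀ := by
  obtain ⟨s, hs, hsF⟩ := (hF.and hle).exists_mem
  have hmeas := aestronglyMeasurable_deriv_of_hasDerivAt hF (ae_of_all μ hF')
  have h := hasFDerivAt_integral_of_dominated_loc_of_lip' (𝕜 := ℝ)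
    (F' := fun a => ContinuousLinearMap.toSpanSingleton ℝ (F' a)) hs (fun t ht => (hsF t ht).1)
    hF₀ ((ContinuousLinearMap.toSpanSingletonCLE (𝕜 := ℝ)).continuous.comp_aestronglyMeasurable
      hmeas)
    (ae_of_all μ fun a t ht => (hsF t ht).2 a) hbound
    (ae_of_all μ fun a => (hF' a).hasFDerivAt)
  refine ⟨?_, ?_⟩
  · simpa using h.1.apply_continuousLinearMap 1
  · refine h.2.hasDerivAt.congr_deriv ?_
    simp [ContinuousLinearMap.integral_apply h.1]

theorem hasDerivAt_zero_of_abs_le {f r : ℝ → ℝ} (hr : Tendsto r (𝓝 t₀) (𝓝 0))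
    (h : ∀ᶠ t in 𝓝 t₀, |f t| ≤ |t - t₀| * r t) : HasDerivAt f 0 t₀ := by
  have hzero : f t₀ = 0 := by simpa using h.self_of_nhds
  rw [hasDerivAt_iff_isLittleO]
  simp only [hzero, sub_zero, smul_zero]
  refine (Asymptotics.IsBigO.of_bound 1 ?_).trans_isLittleO
    (g := fun t => (t - t₀) * r t) ?_
  · filter_upwards [h] with t ht
    rw [one_mul, norm_mul]
    exact ht.trans (mul_le_mul_of_nonneg_left (le_abs_self _) (abs_nonneg _))
  · simpa only [mul_one] using (Asymptotics.isBigO_refl (fun t => t - t₀) (𝓝 t₀)).mul_isLittleO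
      ((Asymptotics.isLittleO_one_iff ℝ).2 hr)

theorem hasDerivAt_sub_mul {f s : ℝ → ℝ} {f' : ℝ} (hf : HasDerivAt f f' t₀)
    (hs : ContinuousAt s t₀) :
    HasDerivAt (fun t => (f t - f t₀) * s t) (f' * s t₀) t₀ := by
  rw [hasDerivAt_iff_tendsto_slope] at hf ⊢
  refine (hf.mul (hs.tendsto.mono_left nhdsWithin_le_nhds)).congr fun t => ?_
  simp only [slope_def_field, sub_self, zero_mul, sub_zero]
  ring

end ParametricIntegral

variable {n : ℕ} [NeZero n] {M : Type*} [TopologicalSpace M]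
  [ChartedSpace (EuclideanHalfSpace n) M] [IsManifold (𝓡∂ n) ∞ M] [MeasurableSpace M]

section DirichletForm

/-- The Dirichlet form `E(u, v) = ∫ ⟨∇u, ∇v⟩ dm`. -/
noncomputable def dirichletForm (g : Metric n M) (η u v : M → ℝ) : ℝ :=
  ∫ p, cometric g u v p ∂(weightedVolume g η)

theorem dirichletForm_comm (g : Metric n M) (η u v : M → ℝ) :
    dirichletForm g η u v = dirichletForm g η v u :=
  integral_congr_ae (ae_of_all _ fun p => cometric_comm g u v p)

theorem dirichletForm_self_nonneg (g : Metric n M) (η u : M → ℝ) :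
    0 ≤ dirichletForm g η u u :=
  integral_nonneg fun p => cometric_self_nonneg g u p

variable [CompactSpace M] [BorelSpace M]

theorem dirichletForm_sub_left (g : Metric n M) {η u v w : M → ℝ} (hη : Continuous η)
    (hu : ContMDiff (𝓡∂ n) 𝓘(ℝ, ℝ) ∞ u) (hv : ContMDiff (𝓡∂ n) 𝓘(ℝ, ℝ) ∞ v)
    (hw : ContMDiff (𝓡∂ n) 𝓘(ℝ, ℝ) ∞ w) :
    dirichletForm g η (fun p => u p - v p) w = dirichletForm g η u w - dirichletForm g η v w := by
  have := isFiniteMeasure_weightedVolume g hη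
  rw [dirichletForm, dirichletForm, dirichletForm,
    ← integral_sub (integrable_of_compactSpace (continuous_cometric g hu hw))
      (integrable_of_compactSpace (continuous_cometric g hv hw))]
  exact integral_congr_ae (ae_of_all _ fun p => cometric_sub_left g w
    (hu.mdifferentiableAt (by simp)) (hv.mdifferentiableAt (by simp)))

theorem dirichletForm_sub_sub (g : Metric n M) {η u v : M → ℝ} (hη : Continuous η)
    (hu : ContMDiff (𝓡∂ n) 𝓘(ℝ, ℝ) ∞ u) (hv : ContMDiff (𝓡∂ n) 𝓘(ℝ, ℝ) ∞ v) :
    dirichletForm g η (fun p => u p - v p) (fun p => u p - v p) =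
      dirichletForm g η u u - 2 * dirichletForm g η u v + dirichletForm g η v v := by
  rw [dirichletForm_sub_left g hη hu hv (hu.sub hv), dirichletForm_comm g η u,
    dirichletForm_comm g η v, dirichletForm_sub_left g hη hu hv hu,
    dirichletForm_sub_left g hη hu hv hv, dirichletForm_comm g η v u]
  ring

theorem integral_sqrt_cometric_mul_sqrt_le (g : Metric n M) {η u v : M → ℝ} (hη : Continuous η)
    (hu : ContMDiff (𝓡∂ n) 𝓘(ℝ, ℝ) ∞ u) (hv : ContMDiff (𝓡∂ n) 𝓘(ℝ, ℝ) ∞ v) :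
    ∫ p, √(cometric g u u p) * √(cometric g v v p) ∂(weightedVolume g η) ≤
      √(dirichletForm g η u u) * √(dirichletForm g η v v) := by
  have := isFiniteMeasure_weightedVolume g hη
  have hmem {w : M → ℝ} (hw : ContMDiff (𝓡∂ n) 𝓘(ℝ, ℝ) ∞ w) :
      MemLp (fun p => √(cometric g w w p)) (ENNReal.ofReal 2) (weightedVolume g η) :=
    (continuous_cometric g hw hw).sqrt.memLp_of_hasCompactSupport
      (HasCompactSupport.of_compactSpace _)
  simpa only [Real.sq_sqrt (cometric_self_nonneg g _ _), dirichletForm, Real.rpow_two,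
    ← Real.sqrt_eq_rpow] using integral_mul_le_Lp_mul_Lq_of_nonneg Real.HolderConjugate.two_two
    (ae_of_all _ fun p => Real.sqrt_nonneg (cometric g u u p))
    (ae_of_all _ fun p => Real.sqrt_nonneg (cometric g v v p)) (hmem hu) (hmem hv)

end DirichletForm

end DirichletEnergy

section EigenvalueVariation

variable {n : ℕ} [NeZero n] {M : Type*} [TopologicalSpace M]
  [ChartedSpace (EuclideanHalfSpace n) M] [IsManifold (𝓡∂ n) ∞ M]
  {J : Set ℝ} {g : ℝ → Metric n M} {η : ℝ → M → ℝ}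

section Variation

theorem IsVariation.eventually_mem (h : IsVariation J g η) : ∀ᶠ t in 𝓝 0, t ∈ J :=
  h.isOpen.mem_nhds h.zero_mem

theorem IsVariation.continuous_weight (h : IsVariation J g η) {t : ℝ} (ht : t ∈ J) :
    Continuous (η t) :=
  (contMDiff_slice h.weight ht).continuous

theorem IsVariation.continuous_weightRatio (h : IsVariation J g η) {t : ℝ} (ht : t ∈ J) :
    Continuous (weightRatio (g 0) (g t) (η 0) (η t)) :=
  EtaLaplacian.continuous_weightRatio (g 0) (g t) (h.continuous_weight h.zero_mem)
    (h.continuous_weight ht)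

variable [MeasurableSpace M] [CompactSpace M] [BorelSpace M]

theorem IsVariation.integral_eq (h : IsVariation J g η) {t : ℝ} (ht : t ∈ J) (f : M → ℝ) :
    ∫ p, f p ∂(weightedVolume (g t) (η t)) =
      ∫ p, weightRatio (g 0) (g t) (η 0) (η t) p * f p ∂(weightedVolume (g 0) (η 0)) :=
  integral_weightedVolume_eq (g 0) (g t) (h.continuous_weight h.zero_mem)
    (h.continuous_weight ht) f

theorem exists_eventually_abs_integral_sub_le (h : IsVariation J g η) :
    ∃ C, ∀ᶠ t in 𝓝 0, ∀ f : M → ℝ, Continuous f →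
      |∫ p, f p ∂(weightedVolume (g t) (η t)) - ∫ p, f p ∂(weightedVolume (g 0) (η 0))| ≤
        C * |t| * ∫ p, |f p| ∂(weightedVolume (g 0) (η 0)) := by
  obtain ⟨C, hC⟩ := exists_eventually_abs_weightRatio_sub_one_le h
  have := isFiniteMeasure_weightedVolume (g 0) (h.continuous_weight h.zero_mem)
  refine ⟨C, ?_⟩
  filter_upwards [hC, h.eventually_mem] with t hCt ht f hf
  rw [h.integral_eq ht, ← integral_sub
    (integrable_of_compactSpace ((h.continuous_weightRatio ht).fun_mul hf))
    (integrable_of_compactSpace hf), ← integral_const_mul, ← Real.norm_eq_abs]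
  refine norm_integral_le_of_norm_le ((integrable_of_compactSpace hf.abs).const_mul _)
    (ae_of_all _ fun p => ?_)
  rw [← sub_one_mul, norm_mul, Real.norm_eq_abs, Real.norm_eq_abs]
  exact mul_le_mul_of_nonneg_right (hCt p) (abs_nonneg _)

theorem exists_eventually_abs_dirichletForm_sub_le (h : IsVariation J g η) :
    ∃ C, ∀ᶠ t in 𝓝 0, ∀ u v : M → ℝ, ContMDiff (𝓡∂ n) 𝓘(ℝ, ℝ) ∞ u →
      ContMDiff (𝓡∂ n) 𝓘(ℝ, ℝ) ∞ v →
      |dirichletForm (g t) (η t) u v - dirichletForm (g 0) (η 0) u v| ≤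
        C * |t| * (√(dirichletForm (g 0) (η 0) u u) * √(dirichletForm (g 0) (η 0) v v)) := by
  obtain ⟨C, hC⟩ := exists_eventually_abs_weightRatio_mul_cometric_sub_le h
  have hη := h.continuous_weight h.zero_mem
  have := isFiniteMeasure_weightedVolume (g 0) hη
  refine ⟨|C|, ?_⟩
  filter_upwards [hC, h.eventually_mem] with t hCt ht u v hu hv
  refine le_trans ?_ (mul_le_mul_of_nonneg_left
    (integral_sqrt_cometric_mul_sqrt_le (g 0) hη hu hv) (by positivity))
  have hsqrt {w : M → ℝ} (hw : ContMDiff (𝓡∂ n) 𝓘(ℝ, ℝ) ∞ w) :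
      Continuous fun p => √(cometric (g 0) w w p) := (continuous_cometric (g 0) hw hw).sqrt
  rw [dirichletForm, dirichletForm, h.integral_eq ht, ← integral_sub
    (integrable_of_compactSpace
      ((h.continuous_weightRatio ht).fun_mul (continuous_cometric (g t) hu hv)))
    (integrable_of_compactSpace (continuous_cometric (g 0) hu hv)), ← integral_const_mul,
    ← Real.norm_eq_abs]
  refine norm_integral_le_of_norm_le
    ((integrable_of_compactSpace ((hsqrt hu).fun_mul (hsqrt hv))).const_mul _)
    (ae_of_all _ fun p => (hCt p u v (hu.mdifferentiableAt (by simp))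
      (hv.mdifferentiableAt (by simp))).trans ?_)
  gcongr
  exact le_abs_self C

theorem hasDerivAt_integral_weightedVolume (h : IsVariation J g η) {f : M → ℝ}
    (hf : Continuous f) :
    Integrable (fun p => ratioVelocity g η p * f p) (weightedVolume (g 0) (η 0)) ∧
      HasDerivAt (fun t => ∫ p, f p ∂(weightedVolume (g t) (η t)))
        (∫ p, ratioVelocity g η p * f p ∂(weightedVolume (g 0) (η 0))) 0 := by
  obtain ⟨C, hC⟩ := exists_eventually_abs_weightRatio_sub_one_le h
  have := isFiniteMeasure_weightedVolume (g 0) (h.continuous_weight h.zero_mem)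
  have hcont {t : ℝ} (ht : t ∈ J) :
      Continuous fun p => weightRatio (g 0) (g t) (η 0) (η t) p * f p :=
    (h.continuous_weightRatio ht).fun_mul hf
  have hle : ∀ᶠ t in 𝓝 0, ∀ p, |weightRatio (g 0) (g t) (η 0) (η t) p * f p -
      weightRatio (g 0) (g 0) (η 0) (η 0) p * f p| ≤ C * |f p| * |t - 0| := by
    filter_upwards [hC] with t hCt p
    rw [weightRatio_self, ← sub_mul, abs_mul, sub_zero, mul_right_comm]
    exact mul_le_mul_of_nonneg_right (hCt p) (abs_nonneg _)
  refine (hasDerivAt_integral_of_abs_sub_le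
    (h.eventually_mem.mono fun t ht => (hcont ht).aestronglyMeasurable)
    (integrable_of_compactSpace (hcont h.zero_mem))
    ((integrable_of_compactSpace hf.abs).const_mul C) hle fun p => (hasDerivAt_weightRatio h.metric
      h.zero_mem (differentiableAt_parameter h.isOpen h.weight h.zero_mem p)).mul_const _).imp_right
    fun hderiv => hderiv.congr_of_eventuallyEq ?_
  exact h.eventually_mem.mono fun t ht => h.integral_eq ht f

theorem hasDerivAt_dirichletForm (h : IsVariation J g η) {u v : M → ℝ}
    (hu : ContMDiff (𝓡∂ n) 𝓘(ℝ, ℝ) ∞ u) (hv : ContMDiff (𝓡∂ n) 𝓘(ℝ, ℝ) ∞ v) :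
    Integrable (fun p => ratioVelocity g η p * cometric (g 0) u v p - velocityForm g u v p)
        (weightedVolume (g 0) (η 0)) ∧
      HasDerivAt (fun t => dirichletForm (g t) (η t) u v)
        (∫ p, (ratioVelocity g η p * cometric (g 0) u v p - velocityForm g u v p)
          ∂(weightedVolume (g 0) (η 0))) 0 := by
  obtain ⟨C, hC⟩ := exists_eventually_abs_weightRatio_mul_cometric_sub_le h
  have := isFiniteMeasure_weightedVolume (g 0) (h.continuous_weight h.zero_mem)
  have hcont {t : ℝ} (ht : t ∈ J) :
      Continuous fun p => weightRatio (g 0) (g t) (η 0) (η t) p * cometric (g t) u v p :=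
    (h.continuous_weightRatio ht).fun_mul (continuous_cometric (g t) hu hv)
  have hsqrt {w : M → ℝ} (hw : ContMDiff (𝓡∂ n) 𝓘(ℝ, ℝ) ∞ w) :
      Continuous fun p => √(cometric (g 0) w w p) := (continuous_cometric (g 0) hw hw).sqrt
  have hle : ∀ᶠ t in 𝓝 0, ∀ p, |weightRatio (g 0) (g t) (η 0) (η t) p * cometric (g t) u v p -
      weightRatio (g 0) (g 0) (η 0) (η 0) p * cometric (g 0) u v p| ≤
        C * (√(cometric (g 0) u u p) * √(cometric (g 0) v v p)) * |t - 0| := by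
    filter_upwards [hC] with t hCt p
    rw [weightRatio_self, one_mul, sub_zero, mul_right_comm]
    exact hCt p u v (hu.mdifferentiableAt (by simp)) (hv.mdifferentiableAt (by simp))
  refine (hasDerivAt_integral_of_abs_sub_le
    (h.eventually_mem.mono fun t ht => (hcont ht).aestronglyMeasurable)
    (integrable_of_compactSpace (hcont h.zero_mem))
    ((integrable_of_compactSpace ((hsqrt hu).fun_mul (hsqrt hv))).const_mul C) hle
    fun p => hasDerivAt_weightRatio_mul_cometric h.metric h.zero_mem
      (differentiableAt_parameter h.isOpen h.weight h.zero_mem p) u v).imp_right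
    fun hderiv => hderiv.congr_of_eventuallyEq ?_
  exact h.eventually_mem.mono fun t ht => h.integral_eq ht (cometric (g t) u v)

theorem continuousAt_integral_weightedVolume (h : IsVariation J g η) {F : ℝ → M → ℝ} {K : ℝ}
    (hF : ∀ᶠ t in 𝓝 0, Continuous (F t)) (hK : ∀ᶠ t in 𝓝 0, ∀ p, |F t p| ≤ K)
    (hF₀ : ∀ p, ContinuousAt (F · p) 0) :
    ContinuousAt (fun t => ∫ p, F t p ∂(weightedVolume (g t) (η t))) 0 := by
  obtain ⟨C, hC⟩ := exists_eventually_abs_weightRatio_sub_one_le h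
  have := isFiniteMeasure_weightedVolume (g 0) (h.continuous_weight h.zero_mem)
  have hsmall : ∀ᶠ t : ℝ in 𝓝 0, C * |t| < 1 :=
    (continuous_const.mul continuous_abs).continuousAt.eventually_lt continuousAt_const (by simp)
  refine (continuousAt_of_dominated (μ := weightedVolume (g 0) (η 0)) (bound := fun _ => 2 * K)
    (F := fun t p => weightRatio (g 0) (g t) (η 0) (η t) p * F t p) ?_ ?_ (integrable_const _)
    (ae_of_all _ fun p => ?_)).congr ?_
  · filter_upwards [hF, h.eventually_mem] with t hFt ht
    exact ((h.continuous_weightRatio ht).fun_mul hFt).aestronglyMeasurable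
  · filter_upwards [hC, hsmall, hK] with t hCt hsmallt hKt
    refine ae_of_all _ fun p => ?_
    rw [norm_mul, Real.norm_eq_abs, Real.norm_eq_abs]
    refine mul_le_mul ?_ (hKt p) (abs_nonneg _) zero_le_two
    rw [abs_of_nonneg (weightRatio_nonneg _ _ _ _ _)]
    linarith [(abs_le.1 (hCt p)).2]
  · exact (hasDerivAt_weightRatio h.metric h.zero_mem (differentiableAt_parameter h.isOpen h.weight
      h.zero_mem p)).continuousAt.mul (hF₀ p)
  · exact h.eventually_mem.mono fun t ht => (h.integral_eq ht (F t)).symm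

end Variation

section Eigenfamily

/-- `u` is a smooth Dirichlet eigenfunction of `-L` for the eigenvalue `μ` (the zero function is
allowed). -/
structure IsDirichletEigenfunction (g : Metric n M) (η : M → ℝ) (μ : ℝ) (u : M → ℝ) : Prop where
  contMDiff : ContMDiff (𝓡∂ n) 𝓘(ℝ, ℝ) ∞ u
  eigen : ∀ p, -etaLaplacian g η u p = μ * u p
  boundary : ∀ p ∈ (𝓡∂ n).boundary M, u p = 0

theorem IsDirichletEigenfunction.dirichletForm_eq [MeasurableSpace M] [CompactSpace M]
    [BorelSpace M] [T2Space M] {g : Metric n M} {η u v : M → ℝ}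
    {μ : ℝ} (hu : IsDirichletEigenfunction g η μ u) (hη : ContMDiff (𝓡∂ n) 𝓘(ℝ, ℝ) ∞ η)
    (hv : ContMDiff (𝓡∂ n) 𝓘(ℝ, ℝ) ∞ v) (hv0 : ∀ p ∈ (𝓡∂ n).boundary M, v p = 0) :
    dirichletForm g η u v = μ * ∫ p, u p * v p ∂(weightedVolume g η) := by
  have hL : etaLaplacian g η u = fun p => -μ * u p := funext fun p => by
    rw [neg_mul, ← hu.eigen p, neg_neg]
  have hgreen := integral_mul_etaLaplacian g hη hu.contMDiff hv hv0
    (hL ▸ continuous_const.mul hu.contMDiff.continuous)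
  rw [dirichletForm_comm, dirichletForm, ← neg_eq_iff_eq_neg.2 hgreen, hL, ← integral_neg,
    ← integral_const_mul]
  exact integral_congr_ae (ae_of_all _ fun p => by ring)

/-- A family of Dirichlet eigenfunctions `φ(t)` for the eigenvalues `lam t`, `t ∈ J`, depending
differentiably on `t`. -/
structure IsEigenfamily (J : Set ℝ) (g : ℝ → Metric n M) (η : ℝ → M → ℝ) (lam : ℝ → ℝ)
    (φ : ℝ → M → ℝ) : Prop where
  eigenfunction : ∀ t ∈ J, IsDirichletEigenfunction (g t) (η t) (lam t) (φ t)
  differentiable : DifferentiableFamily J φ univ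
  differentiableOn : DifferentiableOn ℝ lam J

variable {lam : ℝ → ℝ} {φ : ℝ → M → ℝ}

theorem IsEigenfamily.continuous (hφ : IsEigenfamily J g η lam φ) {t : ℝ} (ht : t ∈ J) :
    Continuous (φ t) :=
  (hφ.eigenfunction t ht).contMDiff.continuous

variable [CompactSpace M]

theorem IsEigenfamily.exists_eventually_abs_sub_le (hφ : IsEigenfamily J g η lam φ)
    (h : IsVariation J g η) : ∃ C, ∀ᶠ t in 𝓝 0, ∀ p, |φ t p - φ 0 p| ≤ C * |t| := by
  have hO (x : M) : (fun q : ℝ × M => φ q.1 q.2 - φ 0 q.2) =O[𝓝 0 ×ˢ 𝓝 x] fun q => q.1 - 0 := by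
    simpa only [nhdsWithin_univ] using hφ.differentiable.isBigO_sub h.zero_mem
      (h.eventually_mem.mono fun t ht => (hφ.continuous ht).continuousOn) (mem_univ x)
  simpa only [sub_zero, Real.norm_eq_abs] using
    exists_eventually_forall_norm_le (f := fun t p => φ t p - φ 0 p) hO

theorem IsEigenfamily.exists_eventually_abs_le (hφ : IsEigenfamily J g η lam φ)
    (h : IsVariation J g η) : ∃ K, ∀ᶠ t in 𝓝 0, ∀ p, |φ t p| ≤ K := by
  obtain ⟨C, hC⟩ := hφ.exists_eventually_abs_sub_le h
  obtain ⟨K, hK⟩ := isCompact_univ.exists_bound_of_continuousOn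
    (hφ.continuous h.zero_mem).continuousOn
  have hsmall : ∀ᶠ t : ℝ in 𝓝 0, C * |t| < 1 :=
    (continuous_const.mul continuous_abs).continuousAt.eventually_lt continuousAt_const (by simp)
  refine ⟨K + 1, ?_⟩
  filter_upwards [hC, hsmall] with t hCt hsmallt p
  calc |φ t p| = |φ 0 p + (φ t p - φ 0 p)| := by rw [add_sub_cancel]
    _ ≤ |φ 0 p| + |φ t p - φ 0 p| := abs_add_le _ _
    _ ≤ K + 1 := add_le_add (hK p (mem_univ p)) ((hCt p).trans hsmallt.le)

variable [MeasurableSpace M] [BorelSpace M]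

theorem IsEigenfamily.continuousAt_integral_mul (hφ : IsEigenfamily J g η lam φ)
    (h : IsVariation J g η) {ψ : ℝ → M → ℝ} {K : ℝ} (hψ : ∀ᶠ t in 𝓝 0, Continuous (ψ t))
    (hK : ∀ᶠ t in 𝓝 0, ∀ p, |ψ t p| ≤ K) (hψ₀ : ∀ p, ContinuousAt (ψ · p) 0) :
    ContinuousAt (fun t => ∫ p, φ t p * ψ t p ∂(weightedVolume (g t) (η t))) 0 := by
  obtain ⟨B, hB⟩ := hφ.exists_eventually_abs_le h
  refine continuousAt_integral_weightedVolume h (K := B * K) ?_ ?_ fun p =>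
    (hφ.differentiable.differentiableAt h.zero_mem (mem_univ p)).continuousAt.mul (hψ₀ p)
  · filter_upwards [hψ, h.eventually_mem] with t hψt ht
    exact (hφ.continuous ht).fun_mul hψt
  · filter_upwards [hB, hK] with t hBt hKt p
    rw [abs_mul]
    exact mul_le_mul (hBt p) (hKt p) (abs_nonneg _) ((abs_nonneg _).trans (hBt p))

theorem IsEigenfamily.continuousAt_integral_mul_const (hφ : IsEigenfamily J g η lam φ)
    (h : IsVariation J g η) {ψ : M → ℝ} (hψ : Continuous ψ) :
    ContinuousAt (fun t => ∫ p, φ t p * ψ p ∂(weightedVolume (g t) (η t))) 0 := by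
  obtain ⟨K, hK⟩ := isCompact_univ.exists_bound_of_continuousOn hψ.continuousOn
  exact hφ.continuousAt_integral_mul h (ψ := fun _ => ψ) (Eventually.of_forall fun _ => hψ)
    (Eventually.of_forall fun _ p => hK p (mem_univ p)) fun p => continuousAt_const

theorem IsEigenfamily.tendsto_integral_abs_sub_mul (hφ : IsEigenfamily J g η lam φ)
    (h : IsVariation J g η) {ψ : M → ℝ} (hψ : Continuous ψ) :
    Tendsto (fun t => ∫ p, |(φ t p - φ 0 p) * ψ p| ∂(weightedVolume (g 0) (η 0)))
      (𝓝 0) (𝓝 0) := by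
  obtain ⟨C, hC⟩ := hφ.exists_eventually_abs_sub_le h
  have := isFiniteMeasure_weightedVolume (g 0) (h.continuous_weight h.zero_mem)
  have hbound : Tendsto (fun t : ℝ => C * |t| * ∫ p, |ψ p| ∂(weightedVolume (g 0) (η 0)))
      (𝓝 0) (𝓝 0) :=
    ((continuous_const.mul continuous_abs).mul continuous_const).tendsto' _ _ (by simp)
  refine squeeze_zero' (Eventually.of_forall fun t => integral_nonneg fun p => abs_nonneg _) ?_
    hbound
  filter_upwards [hC, h.eventually_mem] with t hCt ht
  rw [← integral_const_mul]
  refine integral_mono (integrable_of_compactSpace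
      (((hφ.continuous ht).sub (hφ.continuous h.zero_mem)).fun_mul hψ).abs)
    ((integrable_of_compactSpace hψ.abs).const_mul _) fun p => ?_
  rw [abs_mul]
  exact mul_le_mul_of_nonneg_right (hCt p) (abs_nonneg _)

theorem IsEigenfamily.hasDerivAt_integral_mul_sub (hφ : IsEigenfamily J g η lam φ)
    (h : IsVariation J g η) {ψ : M → ℝ} (hψ : Continuous ψ) :
    HasDerivAt (fun t => ∫ p, φ t p * ψ p ∂(weightedVolume (g t) (η t)) -
        ∫ p, φ t p * ψ p ∂(weightedVolume (g 0) (η 0)))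
      (∫ p, ratioVelocity g η p * (φ 0 p * ψ p) ∂(weightedVolume (g 0) (η 0))) 0 := by
  obtain ⟨C, hC⟩ := exists_eventually_abs_integral_sub_le h
  have hη := h.continuous_weight h.zero_mem
  have := isFiniteMeasure_weightedVolume (g 0) hη
  have hφ₀ := hφ.continuous h.zero_mem
  have hdiff {t : ℝ} (ht : t ∈ J) : Continuous fun p => (φ t p - φ 0 p) * ψ p :=
    ((hφ.continuous ht).sub hφ₀).fun_mul hψ
  have hrem : HasDerivAt (fun t => ∫ p, (φ t p - φ 0 p) * ψ p ∂(weightedVolume (g t) (η t)) -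
      ∫ p, (φ t p - φ 0 p) * ψ p ∂(weightedVolume (g 0) (η 0))) 0 0 := by
    have hr := (hφ.tendsto_integral_abs_sub_mul h hψ).const_mul C
    rw [mul_zero] at hr
    refine hasDerivAt_zero_of_abs_le hr ?_
    filter_upwards [hC, h.eventually_mem] with t hCt ht
    refine (hCt _ (hdiff ht)).trans_eq ?_
    rw [sub_zero]
    ring
  refine (((hasDerivAt_integral_weightedVolume h (hφ₀.fun_mul hψ)).2.sub_const
    (∫ p, φ 0 p * ψ p ∂(weightedVolume (g 0) (η 0)))).add hrem).congr_deriv (add_zero _)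
    |>.congr_of_eventuallyEq ?_
  filter_upwards [h.eventually_mem] with t ht
  have := isFiniteMeasure_weightedVolume (g t) (h.continuous_weight ht)
  have hprod {s : ℝ} (hs : s ∈ J) : Continuous fun p => φ s p * ψ p :=
    (hφ.continuous hs).fun_mul hψ
  simp only [Pi.add_apply, sub_mul]
  rw [integral_sub (integrable_of_compactSpace (hprod ht))
      (integrable_of_compactSpace (hprod h.zero_mem)),
    integral_sub (integrable_of_compactSpace (hprod ht))
      (integrable_of_compactSpace (hprod h.zero_mem))]
  ring

variable [T2Space M]

theorem IsEigenfamily.tendsto_dirichletForm_sub_self (hφ : IsEigenfamily J g η lam φ)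
    (h : IsVariation J g η) : Tendsto (fun t => dirichletForm (g t) (η t) (fun p => φ t p - φ 0 p)
      (fun p => φ t p - φ 0 p)) (𝓝 0) (𝓝 0) := by
  obtain ⟨K, hK⟩ := hφ.exists_eventually_abs_le h
  have hφ₀ := hφ.eigenfunction 0 h.zero_mem
  have hlam := (hφ.differentiableOn.differentiableAt (h.isOpen.mem_nhds h.zero_mem)).continuousAt
  have hself : ContinuousAt (fun t => ∫ p, φ t p * φ t p ∂(weightedVolume (g t) (η t))) 0 :=
    hφ.continuousAt_integral_mul h (h.eventually_mem.mono fun t ht => hφ.continuous ht) hK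
      fun p => (hφ.differentiable.differentiableAt h.zero_mem (mem_univ p)).continuousAt
  have hcross := hφ.continuousAt_integral_mul_const h (hφ.continuous h.zero_mem)
  have hfixed := (hasDerivAt_dirichletForm h hφ₀.contMDiff hφ₀.contMDiff).2.continuousAt
  have hlimit := ((hlam.mul hself).sub ((hlam.mul hcross).const_mul 2)).add hfixed
  have hweak {t : ℝ} (ht : t ∈ J) : dirichletForm (g t) (η t) (fun p => φ t p - φ 0 p)
      (fun p => φ t p - φ 0 p) = lam t * ∫ p, φ t p * φ t p ∂(weightedVolume (g t) (η t)) -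
        2 * (lam t * ∫ p, φ t p * φ 0 p ∂(weightedVolume (g t) (η t))) +
          dirichletForm (g t) (η t) (φ 0) (φ 0) := by
    have hφt := hφ.eigenfunction t ht
    have hη := contMDiff_slice h.weight ht
    rw [dirichletForm_sub_sub (g t) hη.continuous hφt.contMDiff hφ₀.contMDiff,
      hφt.dirichletForm_eq hη hφt.contMDiff hφt.boundary,
      hφt.dirichletForm_eq hη hφ₀.contMDiff hφ₀.boundary]
  have hzero : dirichletForm (g 0) (η 0) (fun p => φ 0 p - φ 0 p) (fun p => φ 0 p - φ 0 p) = 0 := by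
    rw [dirichletForm_sub_sub (g 0) (h.continuous_weight h.zero_mem) hφ₀.contMDiff hφ₀.contMDiff]
    ring
  simpa only [ContinuousAt, hzero] using
    hlimit.congr (h.eventually_mem.mono fun t ht => (hweak ht).symm)

theorem IsEigenfamily.tendsto_dirichletForm_zero_sub_self (hφ : IsEigenfamily J g η lam φ)
    (h : IsVariation J g η) : Tendsto (fun t => dirichletForm (g 0) (η 0) (fun p => φ t p - φ 0 p)
      (fun p => φ t p - φ 0 p)) (𝓝 0) (𝓝 0) := by
  obtain ⟨C, hC⟩ := exists_eventually_abs_dirichletForm_sub_le h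
  have hsmall : ∀ᶠ t : ℝ in 𝓝 0, C * |t| < 1 / 2 :=
    (continuous_const.mul continuous_abs).continuousAt.eventually_lt continuousAt_const (by simp)
  refine squeeze_zero' (Eventually.of_forall fun t => dirichletForm_self_nonneg _ _ _) ?_
    (by simpa only [mul_zero] using (hφ.tendsto_dirichletForm_sub_self h).const_mul 2)
  filter_upwards [hC, hsmall, h.eventually_mem] with t hCt hsmallt ht
  have hd := (hφ.eigenfunction t ht).contMDiff.sub (hφ.eigenfunction 0 h.zero_mem).contMDiff
  have hnonneg := dirichletForm_self_nonneg (g 0) (η 0) fun p => φ t p - φ 0 p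
  have hcompare := (abs_le.1 (hCt _ _ hd hd)).1
  rw [Real.mul_self_sqrt hnonneg] at hcompare
  linarith [mul_le_mul_of_nonneg_right hsmallt.le hnonneg]

theorem IsEigenfamily.hasDerivAt_dirichletForm_sub (hφ : IsEigenfamily J g η lam φ)
    (h : IsVariation J g η) {ψ : M → ℝ} (hψ : ContMDiff (𝓡∂ n) 𝓘(ℝ, ℝ) ∞ ψ) :
    HasDerivAt (fun t => dirichletForm (g t) (η t) (φ t) ψ - dirichletForm (g 0) (η 0) (φ t) ψ)
      (∫ p, (ratioVelocity g η p * cometric (g 0) (φ 0) ψ p - velocityForm g (φ 0) ψ p)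
        ∂(weightedVolume (g 0) (η 0))) 0 := by
  obtain ⟨C, hC⟩ := exists_eventually_abs_dirichletForm_sub_le h
  have hφ₀ := (hφ.eigenfunction 0 h.zero_mem).contMDiff
  have hrem : HasDerivAt (fun t =>
      dirichletForm (g t) (η t) (fun p => φ t p - φ 0 p) ψ -
        dirichletForm (g 0) (η 0) (fun p => φ t p - φ 0 p) ψ) 0 0 := by
    have hsqrt := ((Real.continuous_sqrt.tendsto 0).comp
      (hφ.tendsto_dirichletForm_zero_sub_self h)).mul_const
        (C * √(dirichletForm (g 0) (η 0) ψ ψ))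
    rw [Real.sqrt_zero, zero_mul] at hsqrt
    refine hasDerivAt_zero_of_abs_le hsqrt ?_
    filter_upwards [hC, h.eventually_mem] with t hCt ht
    refine (hCt _ ψ ((hφ.eigenfunction t ht).contMDiff.sub hφ₀) hψ).trans_eq ?_
    rw [sub_zero, Function.comp_apply]
    ring
  refine (((hasDerivAt_dirichletForm h hφ₀ hψ).2.sub_const
    (dirichletForm (g 0) (η 0) (φ 0) ψ)).add hrem).congr_deriv (add_zero _)
    |>.congr_of_eventuallyEq ?_
  filter_upwards [h.eventually_mem] with t ht
  have hφt := (hφ.eigenfunction t ht).contMDiff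
  simp only [Pi.add_apply]
  rw [dirichletForm_sub_left (g t) (h.continuous_weight ht) hφt hφ₀ hψ,
    dirichletForm_sub_left (g 0) (h.continuous_weight h.zero_mem) hφt hφ₀ hψ]
  ring

end Eigenfamily

section VariationFormula

/-- The `(0,2)`-tensor `½ L(uv) g - 2 du ⊗ dv`, which is paired with the velocity of the metric in
the variation formula. -/
noncomputable def variationTensor (g : Metric n M) (η u v : M → ℝ) (p : M)
    (a b : TangentSpace (𝓡∂ n) p) : ℝ :=
  1 / 2 * etaLaplacian g η (fun q => u q * v q) p * g.inner p a b -
    2 * (differential u p a * differential v p b)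

theorem tensorInner_variationTensor {u v : M → ℝ} {μ : ℝ}
    (hu : IsDirichletEigenfunction (g 0) (η 0) μ u)
    (hv : IsDirichletEigenfunction (g 0) (η 0) μ v) (p : M) :
    tensorInner (g 0) p (variationTensor (g 0) (η 0) u v p) (metricVelocity g p) =
      2 * ((ratioVelocity g η p * cometric (g 0) u v p - velocityForm g u v p) -
        μ * (ratioVelocity g η p * (u p * v p))) +
      2 * (weightVelocity η p * (cometric (g 0) u v p - μ * (u p * v p))) := by
  have hL : 1 / 2 * etaLaplacian (g 0) (η 0) (fun q => u q * v q) p =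
      cometric (g 0) u v p - μ * (u p * v p) := by
    rw [etaLaplacian_mul (g 0) hu.contMDiff hv.contMDiff]
    linear_combination (-(1 / 2)) * u p * hv.eigen p - 1 / 2 * v p * hu.eigen p
  refine (tensorInner_metricVelocity g _ u v p).trans ?_
  rw [hL, ratioVelocity]
  ring

variable {lam : ℝ → ℝ} {φ : ℝ → M → ℝ} [MeasurableSpace M] [CompactSpace M] [BorelSpace M]

theorem dirichletForm_mul_right (g : Metric n M) {η w u v : M → ℝ} (hη : Continuous η)
    (hw : ContMDiff (𝓡∂ n) 𝓘(ℝ, ℝ) ∞ w) (hu : ContMDiff (𝓡∂ n) 𝓘(ℝ, ℝ) ∞ u)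
    (hv : ContMDiff (𝓡∂ n) 𝓘(ℝ, ℝ) ∞ v) :
    dirichletForm g η w (fun q => u q * v q) =
      dirichletForm g η u (fun q => w q * v q) + dirichletForm g η v (fun q => w q * u q) -
        2 * ∫ p, w p * cometric g u v p ∂(weightedVolume g η) := by
  have := isFiniteMeasure_weightedVolume g hη
  have huv : Integrable (cometric g u fun q => w q * v q) (weightedVolume g η) :=
    integrable_of_compactSpace (continuous_cometric g hu (hw.mul hv))
  have hvu : Integrable (cometric g v fun q => w q * u q) (weightedVolume g η) :=
    integrable_of_compactSpace (continuous_cometric g hv (hw.mul hu))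
  have hwuv : Integrable (fun p => w p * cometric g u v p) (weightedVolume g η) :=
    integrable_of_compactSpace (hw.continuous.fun_mul (continuous_cometric g hu hv))
  rw [dirichletForm, dirichletForm, dirichletForm, ← integral_add huv hvu, ← integral_const_mul,
    ← integral_sub (huv.fun_add hvu) (hwuv.const_mul 2)]
  refine integral_congr_ae (ae_of_all _ fun p => ?_)
  have hd {a : M → ℝ} (ha : ContMDiff (𝓡∂ n) 𝓘(ℝ, ℝ) ∞ a) :=
    ha.mdifferentiableAt (x := p) (by simp)
  dsimp only
  rw [cometric_mul_right g w (hd hu) (hd hv), cometric_mul_right g u (hd hw) (hd hv),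
    cometric_mul_right g v (hd hw) (hd hu), cometric_comm g v u, cometric_comm g v w,
    cometric_comm g u w]
  ring

variable [T2Space M]

theorem IsEigenfamily.sub_mul_integral (hφ : IsEigenfamily J g η lam φ) (h : IsVariation J g η)
    {ψ : M → ℝ} (hψ : IsDirichletEigenfunction (g 0) (η 0) (lam 0) ψ) {t : ℝ} (ht : t ∈ J) :
    (lam t - lam 0) * ∫ p, φ t p * ψ p ∂(weightedVolume (g t) (η t)) =
      dirichletForm (g t) (η t) (φ t) ψ - dirichletForm (g 0) (η 0) (φ t) ψ -
        lam 0 * (∫ p, φ t p * ψ p ∂(weightedVolume (g t) (η t)) -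
          ∫ p, φ t p * ψ p ∂(weightedVolume (g 0) (η 0))) := by
  have hφt := hφ.eigenfunction t ht
  rw [hφt.dirichletForm_eq (contMDiff_slice h.weight ht) hψ.contMDiff hψ.boundary,
    dirichletForm_comm (g 0), hψ.dirichletForm_eq (contMDiff_slice h.weight h.zero_mem)
      hφt.contMDiff hφt.boundary]
  simp only [mul_comm (ψ _)]
  ring

theorem IsEigenfamily.deriv_mul_integral (hφ : IsEigenfamily J g η lam φ) (h : IsVariation J g η)
    {ψ : M → ℝ} (hψ : IsDirichletEigenfunction (g 0) (η 0) (lam 0) ψ) :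
    deriv lam 0 * ∫ p, φ 0 p * ψ p ∂(weightedVolume (g 0) (η 0)) =
      ∫ p, (ratioVelocity g η p * cometric (g 0) (φ 0) ψ p - velocityForm g (φ 0) ψ p)
          ∂(weightedVolume (g 0) (η 0)) -
        lam 0 * ∫ p, ratioVelocity g η p * (φ 0 p * ψ p) ∂(weightedVolume (g 0) (η 0)) := by
  have hlam := (hφ.differentiableOn.differentiableAt (h.isOpen.mem_nhds h.zero_mem)).hasDerivAt
  have hleft := hasDerivAt_sub_mul hlam
    (hφ.continuousAt_integral_mul_const h hψ.contMDiff.continuous)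
  have hright := (hφ.hasDerivAt_dirichletForm_sub h hψ.contMDiff).sub
    ((hφ.hasDerivAt_integral_mul_sub h hψ.contMDiff.continuous).const_mul (lam 0))
  exact hleft.unique (hright.congr_of_eventuallyEq
    (h.eventually_mem.mono fun t ht => hφ.sub_mul_integral h hψ ht))

theorem dirichletForm_mul_of_eigenfunctions {g : Metric n M} {η w u v : M → ℝ} {μ : ℝ}
    (hη : ContMDiff (𝓡∂ n) 𝓘(ℝ, ℝ) ∞ η) (hw : ContMDiff (𝓡∂ n) 𝓘(ℝ, ℝ) ∞ w)
    (hu : IsDirichletEigenfunction g η μ u) (hv : IsDirichletEigenfunction g η μ v) :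
    dirichletForm g η w (fun q => u q * v q) =
      -2 * ∫ p, w p * (cometric g u v p - μ * (u p * v p)) ∂(weightedVolume g η) := by
  have := isFiniteMeasure_weightedVolume g hη.continuous
  have hcometric : Integrable (fun p => w p * cometric g u v p) (weightedVolume g η) :=
    integrable_of_compactSpace (hw.continuous.fun_mul
      (continuous_cometric g hu.contMDiff hv.contMDiff))
  have hmass : Integrable (fun p => w p * (u p * v p)) (weightedVolume g η) :=
    integrable_of_compactSpace (hw.continuous.fun_mul
      (hu.contMDiff.continuous.fun_mul hv.contMDiff.continuous))
  have hweak {a b : M → ℝ} (ha : IsDirichletEigenfunction g η μ a)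
      (hb : IsDirichletEigenfunction g η μ b) : dirichletForm g η a (fun q => w q * b q) =
        μ * ∫ p, w p * (a p * b p) ∂(weightedVolume g η) := by
    simpa only [mul_left_comm] using ha.dirichletForm_eq hη
      (v := fun q => w q * b q) (hw.mul hb.contMDiff)
      fun p hp => mul_eq_zero_of_right _ (hb.boundary p hp)
  simp only [mul_sub, mul_left_comm _ μ]
  rw [dirichletForm_mul_right g hη.continuous hw hu.contMDiff hv.contMDiff, hweak hu hv,
    hweak hv hu, integral_sub hcometric (hmass.const_mul μ), integral_const_mul]
  simp only [mul_comm (v _)]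
  ring

theorem integral_tensorInner_variationTensor (h : IsVariation J g η) {u v : M → ℝ} {μ : ℝ}
    (hu : IsDirichletEigenfunction (g 0) (η 0) μ u)
    (hv : IsDirichletEigenfunction (g 0) (η 0) μ v) :
    Integrable (fun p => tensorInner (g 0) p (variationTensor (g 0) (η 0) u v p)
        (metricVelocity g p)) (weightedVolume (g 0) (η 0)) ∧
      ∫ p, tensorInner (g 0) p (variationTensor (g 0) (η 0) u v p) (metricVelocity g p)
          ∂(weightedVolume (g 0) (η 0)) +
          dirichletForm (g 0) (η 0) (weightVelocity η) (fun q => u q * v q) =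
        2 * (∫ p, (ratioVelocity g η p * cometric (g 0) u v p - velocityForm g u v p)
            ∂(weightedVolume (g 0) (η 0)) -
          μ * ∫ p, ratioVelocity g η p * (u p * v p) ∂(weightedVolume (g 0) (η 0))) := by
  have hη := contMDiff_slice h.weight h.zero_mem
  have hη' := contMDiff_weightVelocity h.isOpen h.weight h.zero_mem
  have := isFiniteMeasure_weightedVolume (g 0) hη.continuous
  have huv := hu.contMDiff.continuous.fun_mul hv.contMDiff.continuous
  have hform := (hasDerivAt_dirichletForm h hu.contMDiff hv.contMDiff).1
  have hmass := (hasDerivAt_integral_weightedVolume h huv).1.const_mul μ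
  have hmain : Integrable (fun p => 2 * ((ratioVelocity g η p * cometric (g 0) u v p -
      velocityForm g u v p) - μ * (ratioVelocity g η p * (u p * v p))))
      (weightedVolume (g 0) (η 0)) := (hform.sub hmass).const_mul 2
  have hweight : Integrable (fun p => 2 * (weightVelocity η p *
      (cometric (g 0) u v p - μ * (u p * v p)))) (weightedVolume (g 0) (η 0)) :=
    integrable_of_compactSpace ((hη'.continuous.fun_mul
      ((continuous_cometric (g 0) hu.contMDiff hv.contMDiff).sub (huv.const_mul μ))).const_mul 2)
  rw [funext fun p => tensorInner_variationTensor hu hv (g := g) p]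
  refine ⟨hmain.add hweight, ?_⟩
  rw [integral_add hmain hweight, integral_const_mul, integral_sub hform hmass,
    integral_const_mul, integral_const_mul, dirichletForm_mul_of_eigenfunctions hη hη' hu hv]
  ring

end VariationFormula

end EigenvalueVariation

end EtaLaplacian

theorem proposition3p2 {n : ℕ} [NeZero n] {M : Type*} [TopologicalSpace M] [T2Space M]
    [CompactSpace M] [ChartedSpace (EuclideanHalfSpace n) M] [IsManifold (𝓡∂ n) ∞ M]
    [MeasurableSpace M] [BorelSpace M]
    (ε : ℝ) (hε : 0 < ε)
    -- the variation of the metric and of the weight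
    (g : ℝ → Metric n M)
    (hg : DifferentiableVariation (Ioo (-ε) ε) g)
    (η : ℝ → M → ℝ)
    (hη : ContMDiffOn (𝓘(ℝ, ℝ).prod (𝓡∂ n)) 𝓘(ℝ, ℝ) ∞ (fun q : ℝ × M => η q.1 q.2)
      (Ioo (-ε) ε ×ˢ univ))
    -- the eigenfunctions and the eigenvalues
    {m : ℕ} (φ : Fin m → ℝ → M → ℝ) (lam : Fin m → ℝ → ℝ) (lam₀ : ℝ)
    (hφ_smooth : ∀ i, ∀ t ∈ Ioo (-ε) ε, ContMDiff (𝓡∂ n) 𝓘(ℝ, ℝ) ∞ (φ i t))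
    (hφ_diff : ∀ i, DifferentiableFamily (Ioo (-ε) ε) (φ i) univ)
    (hlam_diff : ∀ i, DifferentiableOn ℝ (lam i) (Ioo (-ε) ε))
    (hlam_zero : ∀ i, lam i 0 = lam₀)
    (heigen : ∀ i, ∀ t ∈ Ioo (-ε) ε, ∀ p : M,
      -etaLaplacian (g t) (η t) (φ i t) p = lam i t * φ i t p)
    (hdirichlet : ∀ i, ∀ t ∈ Ioo (-ε) ε, ∀ p ∈ (𝓡∂ n).boundary M, φ i t p = 0)
    (hortho : ∀ i j, ∀ t ∈ Ioo (-ε) ε,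
      ∫ p, φ i t p * φ j t p ∂(weightedVolume (g t) (η t)) = if i = j then 1 else 0)
    (i j : Fin m) :
    Integrable (fun p => tensorInner (g 0) p
        (fun v w =>
          1 / 2 * etaLaplacian (g 0) (η 0) (fun q => φ i 0 q * φ j 0 q) p *
              (g 0).inner p v w
            - 2 * (differential (φ i 0) p v * differential (φ j 0) p w))
        (metricVelocity g p))
      (weightedVolume (g 0) (η 0)) ∧
    Integrable (fun p => (g 0).inner p
        (riemannianGradient (g 0) (weightVelocity η) p)
        (riemannianGradient (g 0) (fun q => φ i 0 q * φ j 0 q) p))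
      (weightedVolume (g 0) (η 0)) ∧
    HasDerivAt (fun t => (lam i t + lam j t) * (if i = j then 1 else 0))
      ((∫ p, tensorInner (g 0) p
          (fun v w =>
            1 / 2 * etaLaplacian (g 0) (η 0) (fun q => φ i 0 q * φ j 0 q) p *
                (g 0).inner p v w
              - 2 * (differential (φ i 0) p v * differential (φ j 0) p w))
          (metricVelocity g p) ∂(weightedVolume (g 0) (η 0)))
        + ∫ p, (g 0).inner p
            (riemannianGradient (g 0) (weightVelocity η) p)
            (riemannianGradient (g 0) (fun q => φ i 0 q * φ j 0 q) p)
          ∂(weightedVolume (g 0) (η 0)))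
      0 := by
  have h : IsVariation (Ioo (-ε) ε) g η := ⟨isOpen_Ioo, ⟨neg_lt_zero.2 hε, hε⟩, hg, hη⟩
  have hφ (k) : IsEigenfamily (Ioo (-ε) ε) g η (lam k) (φ k) :=
    ⟨fun t ht => ⟨hφ_smooth k t ht, heigen k t ht, hdirichlet k t ht⟩, hφ_diff k, hlam_diff k⟩
  have hφ₀ (k) : IsDirichletEigenfunction (g 0) (η 0) lam₀ (φ k 0) :=
    hlam_zero k ▸ (hφ k).eigenfunction 0 h.zero_mem
  have hη₀ := contMDiff_slice hη h.zero_mem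
  have := isFiniteMeasure_weightedVolume (g 0) hη₀.continuous
  have hderiv := (hφ i).deriv_mul_integral h ((hlam_zero i).symm ▸ hφ₀ j)
  rw [hortho i j 0 h.zero_mem, hlam_zero] at hderiv
  obtain ⟨hint, hformula⟩ := integral_tensorInner_variationTensor h (hφ₀ i) (hφ₀ j)
  rw [← hderiv] at hformula
  simp only [inner_riemannianGradient]
  refine ⟨hint, integrable_of_compactSpace (continuous_cometric (g 0)
    (contMDiff_weightVelocity isOpen_Ioo hη h.zero_mem)
    ((hφ₀ i).contMDiff.mul (hφ₀ j).contMDiff)), ?_⟩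
  refine HasDerivAt.congr_deriv ?_ hformula.symm
  obtain rfl | hij := eq_or_ne i j
  · have hlam := ((hlam_diff i).differentiableAt (isOpen_Ioo.mem_nhds h.zero_mem)).hasDerivAt
    simpa only [if_true, mul_one, two_mul] using hlam.fun_add hlam
  · simpa only [if_neg hij, mul_zero] using hasDerivAt_const (0 : ℝ) (0 : ℝ)
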